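/- Let $\alpha\in(0,1)$. For a finite directed graph $G$ on $n$ nodes (self-loops allowed, no multiple arcs) let $M$ be the $n\times n$ matrix with $M_{ij}=1/n$ if node $i$ has no children and otherwise, with $m>0$ the number of children of $i$, $M_{ij}=1/m$ if $j$ is a child of $i$ and $M_{ij}=0$ if it is not. The PageRank scores $P(v)$ of $G$ (with damping factor $\alpha$) are the entries of the unique row vector $P$ with $P=\alpha PM+(1-\alpha)\left(\tfrac1n,\dots,\tfrac1n\right)$. A query algorithm is a randomized algorithm which is given only (the identifier of) a node $v$ of an unknown graph $G$, and which accesses $G$ only through two kinds of queries, chosen adaptively: $\mathrm{RandomNode}()$ returns an independent, uniformly random node of $G$; $\mathrm{Neighbourhood}(u)$ returns the set of parents and the set of children of $u$, where $u$ must be $v$ or a node returned by a previous query. The algorithm may know $\alpha$ and $\varepsilon$, but not the size, the maximum outdegree, or the scores of $G$; the node identifiers are arbitrary distinct natural numbers. Theorem. For every $\alpha\in(0,1)$ and every $\varepsilon_0<1$ there is a constant $C>0$ such that for every $\varepsilon\in(0,\varepsilon_0]$ there is a query algorithm with the following property. For every $n\ge 2$ and $\gamma\ge 1$, every $n$-node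 graph $G$ in which each node has outdegree at most $\gamma$, and every node $v$ of $G$, the algorithm with input $v$, with probability at least $1-\varepsilon$, halts after at most $$C\cdot\min\left(\frac{1}{\varepsilon^2}\log\!\Big(\frac1\varepsilon\Big)\frac{1}{P(v)},\ \frac1\varepsilon\sqrt{\log\!\Big(\frac1\varepsilon\Big)}\; n^{2/3}(\log n)^{1/3},\ \frac1\varepsilon\sqrt{\log\!\Big(\frac1\varepsilon\Big)}\; n^{1/2}\gamma^{1/2}\right)$$ queries and outputs a number in $[(1-\varepsilon)P(v),(1+\varepsilon)P(v)]$. -/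

import Mathlib

open scoped ENNReal

noncomputable section

/-- A finite nonempty directed graph whose nodes are identified by natural numbers. Self-loops are
allowed, multiple arcs are not. The set of identifiers is an arbitrary finite set of naturals, so
that an identifier by itself carries no information about the size of the graph. -/
structure IdGraph where
  nodes : Finset ℕ
  arcs : Finset (ℕ × ℕ)
  nonempty : nodes.Nonempty
  source_mem : ∀ e ∈ arcs, e.1 ∈ nodes
  target_mem : ∀ e ∈ arcs, e.2 ∈ nodes

namespace IdGraph

variable (G : IdGraph)

/-- The number of nodes. -/
def size : ℕ := G.nodes.card

/-- The children of `u`. -/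
def children (u : ℕ) : Finset ℕ := G.nodes.filter fun w => (u, w) ∈ G.arcs

/-- The parents of `u`. -/
def parents (u : ℕ) : Finset ℕ := G.nodes.filter fun w => (w, u) ∈ G.arcs

def outdegree (u : ℕ) : ℕ := (G.children u).card

/-- The transition matrix of the surfer without random jumps: from a dangling node all nodes are
equally likely, from any other node all its children are equally likely. -/
def transition : Matrix G.nodes G.nodes ℝ := fun i j =>
  if G.outdegree i = 0 then 1 / (G.size : ℝ)
  else if (j : ℕ) ∈ G.children i then 1 / (G.outdegree i : ℝ)
  else 0

/-- The PageRank vector with damping factor `α`: the row vector `P` which solves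
`P = α P M + (1 - α) / n`. See `pageRank_eq` and `pageRank_unique`. -/
def pageRank (α : ℝ) : G.nodes → ℝ :=
  Matrix.vecMul (fun _ => (1 - α) / (G.size : ℝ)) (1 - α • G.transition)⁻¹

theorem transition_nonneg (i j : G.nodes) : 0 ≤ G.transition i j := by
  unfold transition
  split_ifs <;> positivity

theorem transition_sum (i : G.nodes) : ∑ j, G.transition i j = 1 := by
  have hn : (G.size : ℝ) ≠ 0 := by
    have := G.nonempty.card_pos
    unfold size
    positivity
  unfold transition
  split_ifs with h
  · simp only [Finset.sum_const, Finset.card_univ, Fintype.card_coe, nsmul_eq_mul]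
    exact mul_one_div_cancel hn
  · have h1 : ∑ j : G.nodes, (if (j : ℕ) ∈ G.children i then 1 / (G.outdegree i : ℝ) else 0)
        = ∑ j ∈ G.nodes, (if j ∈ G.children i then 1 / (G.outdegree i : ℝ) else 0) :=
      Finset.sum_coe_sort G.nodes
        (fun j => if j ∈ G.children i then 1 / (G.outdegree i : ℝ) else 0)
    have h2 : G.nodes.filter (fun j => j ∈ G.children i) = G.children i := by
      ext j
      simp only [children, Finset.mem_filter]
      tauto
    rw [h1, ← Finset.sum_filter, h2, Finset.sum_const, nsmul_eq_mul]
    exact mul_one_div_cancel (Nat.cast_ne_zero.mpr h)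

theorem isUnit_det {α : ℝ} (h0 : 0 ≤ α) (h1 : α < 1) :
    IsUnit (1 - α • G.transition).det := by
  rw [isUnit_iff_ne_zero]
  apply det_ne_zero_of_sum_row_lt_diag
  intro i
  have hs := G.transition_sum i
  rw [← Finset.add_sum_erase _ _ (Finset.mem_univ i)] at hs
  have hle : G.transition i i ≤ 1 := by
    have : 0 ≤ ∑ j ∈ Finset.univ.erase i, G.transition i j :=
      Finset.sum_nonneg fun j _ => G.transition_nonneg i j
    linarith
  have hoff : ∑ j ∈ Finset.univ.erase i, ‖(1 - α • G.transition) i j‖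
      = α * ∑ j ∈ Finset.univ.erase i, G.transition i j := by
    rw [Finset.mul_sum]
    refine Finset.sum_congr rfl fun j hj => ?_
    have hne : i ≠ j := (Finset.ne_of_mem_erase hj).symm
    simp [Matrix.one_apply_ne hne, abs_of_nonneg h0, abs_of_nonneg (G.transition_nonneg i j)]
  have hdiag : ‖(1 - α • G.transition) i i‖ = 1 - α * G.transition i i := by
    simp only [Matrix.sub_apply, Matrix.one_apply_eq, Matrix.smul_apply, smul_eq_mul,
      Real.norm_eq_abs]
    apply abs_of_nonneg
    nlinarith [G.transition_nonneg i i]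
  rw [hoff, hdiag]
  nlinarith

/-- The PageRank vector satisfies the defining equation. -/
theorem pageRank_eq {α : ℝ} (h0 : 0 ≤ α) (h1 : α < 1) :
    G.pageRank α = α • Matrix.vecMul (G.pageRank α) G.transition
      + fun _ => (1 - α) / (G.size : ℝ) := by
  have h : Matrix.vecMul (G.pageRank α) (1 - α • G.transition)
      = fun _ => (1 - α) / (G.size : ℝ) := by
    unfold pageRank
    rw [Matrix.vecMul_vecMul, Matrix.nonsing_inv_mul _ (G.isUnit_det h0 h1), Matrix.vecMul_one]
  rw [Matrix.vecMul_sub, Matrix.vecMul_one, Matrix.vecMul_smul] at h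
  rw [← h]
  abel

/-- The PageRank vector is the only solution of the defining equation. -/
theorem pageRank_unique {α : ℝ} (h0 : 0 ≤ α) (h1 : α < 1) (p : G.nodes → ℝ)
    (hp : p = α • Matrix.vecMul p G.transition + fun _ => (1 - α) / (G.size : ℝ)) :
    p = G.pageRank α := by
  have h : Matrix.vecMul p (1 - α • G.transition) = fun _ => (1 - α) / (G.size : ℝ) := by
    rw [Matrix.vecMul_sub, Matrix.vecMul_one, Matrix.vecMul_smul, sub_eq_iff_eq_add']
    exact hp
  unfold pageRank
  rw [← h, Matrix.vecMul_vecMul, Matrix.mul_nonsing_inv _ (G.isUnit_det h0 h1), Matrix.vecMul_one]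

end IdGraph

/-- What an algorithm can do next: issue one of the two queries, or halt with an output. -/
inductive QueryAction where
  | randomNode
  | neighbourhood (u : ℕ)
  | output (x : ℝ)

/-- A randomized algorithm that accesses a graph only through the queries `RandomNode()` and
`Neighbourhood(u)`. Its internal state is arbitrary; the state determines the next action, and is
updated, possibly with the help of internal coin tosses, when the answer to a query arrives. The
only input is the identifier of the node whose score is sought (`start`). -/
structure QueryAlgorithm where
  State : Type
  start : ℕ → PMF State
  act : State → QueryAction
  /-- The new state, given the node returned by `RandomNode()`. -/
  onRandomNode : State → ℕ → PMF State
  /-- The new state, given the parents and the children returned by `Neighbourhood(u)`. -/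
  onNeighbourhood : State → Finset ℕ → Finset ℕ → PMF State

namespace QueryAlgorithm

variable (A : QueryAlgorithm) (G : IdGraph)

/-- One query of `A` on `G`. A configuration is the internal state of `A` together with the set of
nodes known so far, that is, the input node and all the nodes returned by previous queries.
`RandomNode()` returns a fresh uniformly random node. `Neighbourhood(u)` returns the parents and the
children of `u` if `u` is known, and an empty answer, which reveals nothing, otherwise. A halted
algorithm issues no more queries. -/
def step (c : A.State × Finset ℕ) : PMF (A.State × Finset ℕ) :=
  match A.act c.1 with
  | .randomNode =>
      (PMF.uniformOfFinset G.nodes G.nonempty).bind fun w =>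
        (A.onRandomNode c.1 w).map fun s => (s, insert w c.2)
  | .neighbourhood u =>
      if u ∈ c.2 then
        (A.onNeighbourhood c.1 (G.parents u) (G.children u)).map fun s =>
          (s, c.2 ∪ G.parents u ∪ G.children u)
      else
        (A.onNeighbourhood c.1 ∅ ∅).map fun s => (s, c.2)
  | .output _ => PMF.pure c

/-- The distribution of the configuration of `A`, run on `G` with input node `v`, after `q` queries
(or after it has halted, if it halts earlier). -/
def run (v : ℕ) : ℕ → PMF (A.State × Finset ℕ)
  | 0 => (A.start v).map fun s => (s, {v})
  | q + 1 => (run v q).bind (A.step G)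

/-- The probability that `A`, run on `G` with input node `v`, halts after at most `q` queries with
an output in the set `S`. -/
def outputProb (v q : ℕ) (S : Set ℝ) : ℝ≥0∞ :=
  (A.run G v q).toOuterMeasure {c | ∃ x ∈ S, A.act c.1 = QueryAction.output x}

end QueryAlgorithm

/-- The minimum of the three query bounds, for accuracy `ε`, score `p`, size `n` and maximum
outdegree `γ`. -/
def queryBound (ε p : ℝ) (n γ : ℕ) : ℝ :=
  min (1 / ε ^ 2 * Real.log (1 / ε) * (1 / p))
    (min (1 / ε * Real.sqrt (Real.log (1 / ε)) * ((n : ℝ) ^ (2 / 3 : ℝ)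
        * Real.log n ^ (1 / 3 : ℝ)))
      (1 / ε * Real.sqrt (Real.log (1 / ε)) * ((n : ℝ) ^ (1 / 2 : ℝ) * (γ : ℝ) ^ (1 / 2 : ℝ))))

end

/-! Fix a set H of explored nodes that contains v. The gain of a node u is the expected number of
visits to v of a surfer who starts at u and stops at random jumps, at dangling nodes and on leaving
H. Testing the stationarity equation of PageRank against the gain (`IdGraph.sum_rank_mul_sub`,
`View.Sees.rank_eq`) writes P(v) as a multiple of (total gain)/n plus the PageRank expectation, over
unexplored nodes w, of α times the average gain of the children of w. Hence a PageRank-distributed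
node w and a uniform node u yield an unbiased estimate of P(v) (`View.Sees.mean_score`); the unknown
n enters only through the test whether u lies in H. The estimate is at most `View.range`, which is
the total gain over |H| plus the largest gain visible from the frontier. If H has no frontier, the
total gain is compared with the total lifetime instead.

The search simulates the surfer. With probability 1 - α per step a round ends, and the surfer is
then PageRank-distributed. The score is divided by the range known before the round; `hits` sums
these ratios, `mass` sums the reciprocal ranges, and `hits / mass` estimates P(v).

The mass grows quadratically (`search.sq_le_mass_mul`). In each round the most promising frontier
node is explored. If its outdegree is at most U times the number of its known children, this raises
the total gain by at least a 1/U fraction of the frontier gain (`View.Sees.frontierGain_le`), while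
the total gain never exceeds nP(v)/(1 - α). So d rounds that start with s explored nodes have ranges
of sum at most (U + d/s)nP(v)/(1 - α), and by Cauchy–Schwarz the mass is at least d² over this. The
search can stop once P(v)·mass is of order log(1/ε)/ε². The choice U = γ gives the third bound.
After N rounds, sampling has hit the children of all nodes of large outdegree proportionally, so U
of order 1 + (n/N)(log n + log(1/ε)) is admissible, which gives the second bound. The trivial bound
2/(1 - α) for the range gives the first.

Concentration comes from exponential supermartingales with predictable weights
(`search.event_weight_le`, `search.event_deviation_le`), in a self-normalized form, so that the
stopping rule uses only observed quantities. For n below log(1/ε)/ε² a second measure of noise is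
used, bounded by the number of explored nodes (`search.noise_le_card`). If hardly any nodes turn up
in many rounds, the graph is taken to be completely explored and its score is computed exactly. -/

noncomputable section

/-! ### Expectations of nonnegative functions under a `PMF`. -/

namespace PMF

variable {β γ : Type*}

/-- The expectation of a nonnegative function. -/
def expect (p : PMF β) (φ : β → ℝ≥0∞) : ℝ≥0∞ := ∑' a, p a * φ a

theorem expect_pure (a : β) (φ : β → ℝ≥0∞) : (PMF.pure a).expect φ = φ a := by
  unfold expect
  rw [tsum_eq_single a]
  · simp
  · intro b hb
    simp [PMF.pure_apply, hb]

theorem expect_bind (p : PMF β) (f : β → PMF γ) (φ : γ → ℝ≥0∞) :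
    (p.bind f).expect φ = p.expect fun a => (f a).expect φ := by
  unfold expect
  simp only [PMF.bind_apply, ← ENNReal.tsum_mul_right, ← ENNReal.tsum_mul_left, mul_assoc]
  exact ENNReal.tsum_comm

theorem expect_mono {p : PMF β} {φ ψ : β → ℝ≥0∞} (h : ∀ a ∈ p.support, φ a ≤ ψ a) :
    p.expect φ ≤ p.expect ψ := by
  refine ENNReal.tsum_le_tsum fun a => ?_
  by_cases ha : a ∈ p.support
  · gcongr
    exact h a ha
  · simp [(PMF.apply_eq_zero_iff p a).2 ha]

theorem expect_congr {p : PMF β} {φ ψ : β → ℝ≥0∞} (h : ∀ a ∈ p.support, φ a = ψ a) :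
    p.expect φ = p.expect ψ :=
  le_antisymm (expect_mono fun a ha => (h a ha).le) (expect_mono fun a ha => (h a ha).ge)

theorem expect_add (p : PMF β) (φ ψ : β → ℝ≥0∞) :
    p.expect (fun a => φ a + ψ a) = p.expect φ + p.expect ψ := by
  simp [expect, mul_add, ENNReal.tsum_add]

theorem expect_const_mul (p : PMF β) (c : ℝ≥0∞) (φ : β → ℝ≥0∞) :
    p.expect (fun a => c * φ a) = c * p.expect φ := by
  simp only [expect, ← ENNReal.tsum_mul_left]
  exact tsum_congr fun a => by ring

theorem expect_one (p : PMF β) : p.expect (fun _ => 1) = 1 := by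
  simp [expect, p.tsum_coe]

theorem toOuterMeasure_eq_expect (p : PMF β) (S : Set β) :
    p.toOuterMeasure S = p.expect (S.indicator 1) := by
  rw [PMF.toOuterMeasure_apply]
  refine tsum_congr fun a => ?_
  by_cases h : a ∈ S <;> simp [h]

theorem expect_uniformOfFinset (s : Finset β) (hs : s.Nonempty) (φ : β → ℝ≥0∞) :
    (PMF.uniformOfFinset s hs).expect φ = (∑ a ∈ s, φ a) / s.card := by
  unfold expect
  rw [tsum_eq_sum (s := s), ENNReal.div_eq_inv_mul, Finset.mul_sum]
  · refine Finset.sum_congr rfl fun a ha => ?_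
    rw [PMF.uniformOfFinset_apply_of_mem _ ha]
  · intro b hb
    simp [PMF.uniformOfFinset_apply_of_notMem _ hb]

theorem expect_uniformOfFinset_ofReal (s : Finset β) (hs : s.Nonempty) (f : β → ℝ)
    (hf : ∀ a ∈ s, 0 ≤ f a) :
    (PMF.uniformOfFinset s hs).expect (fun a => ENNReal.ofReal (f a))
      = ENNReal.ofReal ((∑ a ∈ s, f a) / s.card) := by
  have : (0 : ℝ) < s.card := by exact_mod_cast hs.card_pos
  rw [expect_uniformOfFinset, ENNReal.ofReal_div_of_pos this, ENNReal.ofReal_sum_of_nonneg hf,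
    ENNReal.ofReal_natCast]

/-- A coin that shows `true` with probability `α`. -/
def coin (α : ℝ) (h0 : 0 ≤ α) (h1 : α ≤ 1) : PMF Bool :=
  PMF.ofFintype (fun b => if b then ENNReal.ofReal α else ENNReal.ofReal (1 - α)) (by
    rw [Fintype.sum_bool]
    simp only [if_true, Bool.false_eq_true, if_false]
    rw [← ENNReal.ofReal_add h0 (by linarith)]
    simp)

theorem expect_coin {α : ℝ} (h0 : 0 ≤ α) (h1 : α ≤ 1) (φ : Bool → ℝ≥0∞) :
    (coin α h0 h1).expect φ
      = ENNReal.ofReal α * φ true + ENNReal.ofReal (1 - α) * φ false := by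
  simp [expect, coin, tsum_fintype]

/-- Markov's inequality for events. -/
theorem expect_indicator_le {p : PMF β} {φ : β → ℝ≥0∞} {S : Set β} {a b : ℝ≥0∞}
    (hS : ∀ x ∈ p.support, x ∈ S → 1 ≤ a * φ x) (hb : a * p.expect φ ≤ b) :
    p.expect (S.indicator 1) ≤ b := by
  refine le_trans ?_ hb
  rw [← expect_const_mul]
  refine expect_mono fun x hx => ?_
  by_cases h : x ∈ S
  · simpa [h] using hS x hx h
  · simp [h]

end PMF

/-! ### PageRank as a linear functional, and its realization by a walk with restarts. -/

namespace IdGraph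

variable (G : IdGraph)

/-- The PageRank score of a node, and `0` for any other number. -/
def rank (α : ℝ) (w : ℕ) : ℝ := if h : w ∈ G.nodes then G.pageRank α ⟨w, h⟩ else 0

/-- The average over all nodes. -/
def avg (f : ℕ → ℝ) : ℝ := (∑ u ∈ G.nodes, f u) / G.size

/-- The expectation of `f` after one step of the surfer from `w`, without random jumps. -/
def stepAvg (f : ℕ → ℝ) (w : ℕ) : ℝ :=
  if G.children w = ∅ then G.avg f else (∑ z ∈ G.children w, f z) / G.outdegree w

theorem size_pos : 0 < G.size := G.nonempty.card_pos

theorem children_subset (u : ℕ) : G.children u ⊆ G.nodes := Finset.filter_subset _ _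

theorem parents_subset (u : ℕ) : G.parents u ⊆ G.nodes := Finset.filter_subset _ _

theorem mem_parents_iff {u w : ℕ} (hu : u ∈ G.nodes) (hw : w ∈ G.nodes) :
    w ∈ G.parents u ↔ u ∈ G.children w := by
  simp [parents, children, hu, hw]

theorem rank_coe (α : ℝ) (w : G.nodes) : G.rank α w = G.pageRank α w := by
  simp [rank]

theorem transition_mulVec (f : ℕ → ℝ) (w : G.nodes) :
    ∑ j : G.nodes, G.transition w j * f j = G.stepAvg f w := by
  unfold transition stepAvg outdegree
  by_cases h : G.children w = ∅
  · simp only [h, Finset.card_empty, if_true]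
    rw [← Finset.mul_sum, Finset.sum_coe_sort G.nodes f, avg]
    ring
  · have h' : (G.children w).card ≠ 0 := by simpa using h
    simp only [h, h', if_false]
    rw [Finset.sum_coe_sort G.nodes fun j => (if j ∈ G.children w then
      1 / ((G.children w).card : ℝ) else 0) * f j]
    simp only [ite_mul, zero_mul, ← Finset.sum_filter]
    have h2 : G.nodes.filter (fun j => j ∈ G.children w) = G.children w := by
      ext j
      simp only [children, Finset.mem_filter]
      tauto
    rw [h2, ← Finset.mul_sum]
    ring

theorem stepAvg_mono {f g : ℕ → ℝ} (h : ∀ u ∈ G.nodes, f u ≤ g u) (w : ℕ) :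
    G.stepAvg f w ≤ G.stepAvg g w := by
  unfold stepAvg avg
  split_ifs
  · gcongr with u hu
    exact h u hu
  · gcongr with u hu
    exact h u (G.children_subset w hu)

theorem stepAvg_const (c : ℝ) (w : ℕ) : G.stepAvg (fun _ => c) w = c := by
  have hn : (G.size : ℝ) ≠ 0 := by exact_mod_cast G.size_pos.ne'
  unfold stepAvg avg
  split_ifs with h
  · rw [Finset.sum_const, nsmul_eq_mul]
    exact mul_div_cancel_left₀ c hn
  · have : (G.outdegree w : ℝ) ≠ 0 := by simpa [outdegree] using h
    rw [Finset.sum_const, nsmul_eq_mul]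
    exact mul_div_cancel_left₀ c this

theorem avg_const (c : ℝ) : G.avg (fun _ => c) = c := by
  have hn : (G.size : ℝ) ≠ 0 := by exact_mod_cast G.size_pos.ne'
  rw [avg, Finset.sum_const, nsmul_eq_mul]
  exact mul_div_cancel_left₀ c hn

theorem avg_mono {f g : ℕ → ℝ} (h : ∀ u ∈ G.nodes, f u ≤ g u) : G.avg f ≤ G.avg g := by
  unfold avg
  gcongr with u hu
  exact h u hu

theorem avg_mul (c : ℝ) (f : ℕ → ℝ) : G.avg (fun u => c * f u) = c * G.avg f := by
  unfold avg
  rw [← Finset.mul_sum, mul_div_assoc]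

theorem avg_add (f g : ℕ → ℝ) : G.avg (fun u => f u + g u) = G.avg f + G.avg g := by
  unfold avg
  rw [Finset.sum_add_distrib, add_div]

theorem stepAvg_mul (c : ℝ) (f : ℕ → ℝ) (w : ℕ) :
    G.stepAvg (fun u => c * f u) w = c * G.stepAvg f w := by
  unfold stepAvg
  rw [avg_mul, ← Finset.mul_sum, mul_div_assoc, mul_ite]

section

variable {α : ℝ} (h0 : 0 ≤ α) (h1 : α < 1)

include h0 h1

/-- The expectation of `φ` at the node where the surfer makes the next random jump, as a function
of the current node. Its average is the expectation of `φ` under PageRank. -/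
theorem exists_walk_value {φ : ℕ → ℝ} {c : ℝ} (hφ : ∀ w ∈ G.nodes, c ≤ φ w) :
    ∃ F : ℕ → ℝ, (∀ w ∈ G.nodes, c ≤ F w ∧ F w = (1 - α) * φ w + α * G.stepAvg F w) ∧
      G.avg F = ∑ w ∈ G.nodes, G.rank α w * φ w := by
  set K : Matrix G.nodes G.nodes ℝ := 1 - α • G.transition with hK
  have hdet : IsUnit K.det := G.isUnit_det h0 h1
  set b : G.nodes → ℝ := fun w => (1 - α) * φ w with hb
  set F' : G.nodes → ℝ := K⁻¹.mulVec b with hF'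
  have hKF : K.mulVec F' = b := by
    rw [hF', Matrix.mulVec_mulVec, Matrix.mul_nonsing_inv _ hdet, Matrix.one_mulVec]
  set F : ℕ → ℝ := fun w => if h : w ∈ G.nodes then F' ⟨w, h⟩ else 0 with hF
  have hFc : ∀ w : G.nodes, F w = F' w := fun w => by simp [hF]
  have heq : ∀ w ∈ G.nodes, F w = (1 - α) * φ w + α * G.stepAvg F w := by
    intro w hw
    have h := congrFun hKF ⟨w, hw⟩
    rw [hK, Matrix.sub_mulVec, Matrix.one_mulVec, Matrix.smul_mulVec] at h
    simp only [Pi.sub_apply, Pi.smul_apply, smul_eq_mul] at h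
    have h2 : G.transition.mulVec F' ⟨w, hw⟩ = G.stepAvg F w := by
      rw [← G.transition_mulVec F ⟨w, hw⟩]
      simp only [Matrix.mulVec, dotProduct, hFc]
    rw [h2, ← hFc] at h
    simp only [hb] at h
    linarith
  refine ⟨F, fun w hw => ⟨?_, heq w hw⟩, ?_⟩
  -- Minimum principle: at a minimum m of F the equation gives F m ≥ (1 - α) c + α F m.
  · obtain ⟨m, hm, hmin⟩ := Finset.exists_min_image G.nodes F G.nonempty
    have h3 : F m ≤ G.stepAvg F m := by
      rw [← G.stepAvg_const (F m) m]
      exact G.stepAvg_mono (fun u hu => by simpa [G.stepAvg_const] using hmin u hu) m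
    have h4 := heq m hm
    have h5 := hφ m hm
    have h6 := hmin w hw
    nlinarith
  -- PageRank is a constant row vector times K⁻¹; moving K⁻¹ to the column vector turns the pairing
  -- with φ into the average of F.
  · have hp : G.pageRank α ⬝ᵥ (fun w : G.nodes => φ w) = G.avg F := by
      unfold pageRank
      rw [← Matrix.dotProduct_mulVec]
      have : K⁻¹.mulVec (fun w : G.nodes => φ w) = (1 - α)⁻¹ • F' := by
        rw [hF', ← Matrix.mulVec_smul]
        congr 1
        ext w
        simp only [hb, Pi.smul_apply, smul_eq_mul]
        have : 1 - α ≠ 0 := by linarith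
        field_simp
      rw [this, avg, ← Finset.sum_coe_sort]
      simp only [dotProduct, Pi.smul_apply, smul_eq_mul, hFc, Finset.sum_div]
      refine Finset.sum_congr rfl fun w _ => ?_
      have : 1 - α ≠ 0 := by linarith
      field_simp
    rw [← hp, ← Finset.sum_coe_sort]
    simp [dotProduct, rank_coe]

theorem rank_nonneg (v : ℕ) : 0 ≤ G.rank α v := by
  by_cases hv : v ∈ G.nodes
  · obtain ⟨F, hF, hF2⟩ := G.exists_walk_value h0 h1 (φ := fun w => if w = v then 1 else 0)
      (c := 0) (fun w _ => by split_ifs <;> norm_num)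
    have h3 : 0 ≤ G.avg F := by
      rw [← G.avg_const 0]
      exact G.avg_mono fun u hu => (hF u hu).1
    rw [hF2] at h3
    simpa [hv] using h3
  · simp [rank, hv]

/-- This is the fixed point equation of PageRank, paired with a test function f. -/
theorem sum_rank_mul (f : ℕ → ℝ) :
    ∑ w ∈ G.nodes, G.rank α w * f w
      = α * ∑ w ∈ G.nodes, G.rank α w * G.stepAvg f w + (1 - α) * G.avg f := by
  have h := congrArg (fun p => p ⬝ᵥ fun w : G.nodes => f w) (G.pageRank_eq h0 h1)
  simp only [add_dotProduct, smul_dotProduct] at h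
  rw [← Matrix.dotProduct_mulVec] at h
  have h2 : G.transition.mulVec (fun w : G.nodes => f w)
      = fun w : G.nodes => G.stepAvg f w := by
    ext w
    rw [← G.transition_mulVec f w]
    rfl
  rw [h2] at h
  simp only [dotProduct, smul_eq_mul] at h
  rw [← Finset.sum_coe_sort G.nodes, ← Finset.sum_coe_sort G.nodes]
  simp only [rank_coe]
  rw [h, ← Finset.mul_sum, avg, ← Finset.sum_coe_sort G.nodes f]
  ring

theorem sum_rank : ∑ w ∈ G.nodes, G.rank α w = 1 := by
  have h := G.sum_rank_mul h0 h1 fun _ => 1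
  simp only [stepAvg_const, avg_const, mul_one] at h
  have : (1 - α) * (∑ w ∈ G.nodes, G.rank α w - 1) = 0 := by linarith
  rcases mul_eq_zero.1 this with h | h <;> linarith

theorem le_rank {v : ℕ} (hv : v ∈ G.nodes) : (1 - α) / G.size ≤ G.rank α v := by
  have h := G.sum_rank_mul h0 h1 fun w => if w = v then 1 else 0
  have h2 : 0 ≤ ∑ w ∈ G.nodes, G.rank α w * G.stepAvg (fun w => if w = v then 1 else 0) w := by
    refine Finset.sum_nonneg fun w _ => mul_nonneg (G.rank_nonneg h0 h1 w) ?_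
    refine (G.stepAvg_const 0 w).ge.trans (G.stepAvg_mono (fun u _ => ?_) w)
    split_ifs <;> norm_num
  have h3 : G.avg (fun w => if w = v then 1 else 0) = 1 / G.size := by simp [avg, hv]
  rw [h3] at h
  simp only [mul_ite, mul_one, mul_zero, Finset.sum_ite_eq', hv, if_true] at h
  rw [h, mul_one_div]
  nlinarith

theorem rank_pos {v : ℕ} (hv : v ∈ G.nodes) : 0 < G.rank α v := by
  refine lt_of_lt_of_le ?_ (G.le_rank h0 h1 hv)
  have : (0 : ℝ) < G.size := by exact_mod_cast G.size_pos
  have : 0 < 1 - α := by linarith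
  positivity

theorem rank_le_one {v : ℕ} (hv : v ∈ G.nodes) : G.rank α v ≤ 1 := by
  rw [← G.sum_rank h0 h1]
  exact Finset.single_le_sum (fun w _ => G.rank_nonneg h0 h1 w) hv

end

end IdGraph
end

/-! ### Views of a partially explored graph: gain, lifetime, range and score. -/

noncomputable section

/-- A set of explored nodes, together with their parents and their children. -/
structure View where
  explored : Finset ℕ
  parents : ℕ → Finset ℕ
  children : ℕ → Finset ℕ

namespace View

variable (V : View) (α : ℝ) (v : ℕ)

/-- The operator whose least fixed point is `potential`. -/
def potentialStep (ψ : ℕ → ℝ≥0∞) : (ℕ → ℝ≥0∞) →o (ℕ → ℝ≥0∞) where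
  -- At a dangling node the quotient is 0 / 0 = 0, so the surfer stops there.
  toFun g u := if u ∈ V.explored then
    ψ u + ENNReal.ofReal α * ((∑ z ∈ V.children u, g z) / (V.children u).card) else 0
  monotone' g g' h u := by
    dsimp only
    split_ifs
    · gcongr with z hz
      exact h z
    · exact le_rfl

/-- The expected total reward, where `ψ` is the reward for a visit, of a surfer who stops at each
step with probability `1 - α`, at dangling nodes, and on leaving the explored nodes. -/
def potential (ψ : ℕ → ℝ≥0∞) : ℕ → ℝ≥0∞ := OrderHom.lfp (V.potentialStep α ψ)

/-- The expected number of visits to `v`. -/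
def gain (u : ℕ) : ℝ := (V.potential α (fun w => if w = v then 1 else 0) u).toReal

/-- The expected number of steps. -/
def life (u : ℕ) : ℝ := (V.potential α (fun _ => 1) u).toReal

def gainSum : ℝ := ∑ u ∈ V.explored, V.gain α v u

def lifeSum : ℝ := ∑ u ∈ V.explored, V.life α u

/-- These are read off from the parents of explored nodes, since the children of an unexplored w
have not been queried. -/
def knownChildren (w : ℕ) : Finset ℕ := V.explored.filter fun u => w ∈ V.parents u

/-- The average gain of the known children. -/
def avgGain (w : ℕ) : ℝ := (∑ u ∈ V.knownChildren w, V.gain α v u) / (V.knownChildren w).card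

/-- The unexplored neighbours of the explored nodes. -/
def frontier : Finset ℕ :=
  (V.explored.biUnion fun u => V.parents u ∪ V.children u) \ V.explored

open Classical in
/-- The most promising node of the frontier. -/
def target : ℕ :=
  if h : V.frontier.Nonempty then (V.frontier.exists_max_image (V.avgGain α v) h).choose else v

/-- This bounds what any unexplored node can contribute to the score; see
`View.Sees.mul_childAvg_gain_le`. -/
def frontierGain : ℝ :=
  if V.frontier = ∅ then 0 else α * V.avgGain α v (V.target α v)

/-- An upper bound for the score. -/
def range : ℝ :=
  if V.frontier = ∅ then V.gainSum α v / V.lifeSum α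
  else V.frontierGain α v + V.gainSum α v / V.explored.card

/-- An unbiased estimate of the PageRank of `v`, for a node `w` distributed according to PageRank,
with set of children `c`, and an independent and uniformly distributed node `u`. -/
def score (w : ℕ) (c : Finset ℕ) (u : ℕ) : ℝ :=
  if V.frontier = ∅ then (if w ∈ V.explored then V.gainSum α v / V.lifeSum α else 0)
  else (if w ∈ V.explored then 0 else α * ((∑ z ∈ c, V.gain α v z) / c.card))
    + V.gainSum α v / V.explored.card
      * ((if c = ∅ then 1 else 1 - α) * (if u ∈ V.explored then 1 else 0))

theorem potentialStep_apply (ψ g : ℕ → ℝ≥0∞) (u : ℕ) :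
    V.potentialStep α ψ g u = if u ∈ V.explored then
      ψ u + ENNReal.ofReal α * ((∑ z ∈ V.children u, g z) / (V.children u).card) else 0 :=
  rfl

theorem potential_eq (ψ : ℕ → ℝ≥0∞) (u : ℕ) :
    V.potential α ψ u = if u ∈ V.explored then ψ u + ENNReal.ofReal α
      * ((∑ z ∈ V.children u, V.potential α ψ z) / (V.children u).card) else 0 :=
  (congrFun (OrderHom.map_lfp (V.potentialStep α ψ)) u).symm

theorem potential_eq_zero {ψ : ℕ → ℝ≥0∞} {u : ℕ} (hu : u ∉ V.explored) :
    V.potential α ψ u = 0 := by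
  rw [potential_eq, if_neg hu]

theorem gain_nonneg (u : ℕ) : 0 ≤ V.gain α v u := ENNReal.toReal_nonneg

theorem gain_eq_zero {u : ℕ} (hu : u ∉ V.explored) : V.gain α v u = 0 := by
  rw [gain, V.potential_eq_zero α hu, ENNReal.toReal_zero]

theorem life_eq_zero {u : ℕ} (hu : u ∉ V.explored) : V.life α u = 0 := by
  rw [life, V.potential_eq_zero α hu, ENNReal.toReal_zero]

theorem gainSum_nonneg : 0 ≤ V.gainSum α v := Finset.sum_nonneg fun u _ => V.gain_nonneg α v u

theorem avgGain_nonneg (w : ℕ) : 0 ≤ V.avgGain α v w :=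
  div_nonneg (Finset.sum_nonneg fun u _ => V.gain_nonneg α v u) (Nat.cast_nonneg _)

theorem target_mem (h : V.frontier ≠ ∅) : V.target α v ∈ V.frontier := by
  have h' := Finset.nonempty_iff_ne_empty.2 h
  rw [target, dif_pos h']
  exact (V.frontier.exists_max_image (V.avgGain α v) h').choose_spec.1

theorem avgGain_le_target {w : ℕ} (hw : w ∈ V.frontier) :
    V.avgGain α v w ≤ V.avgGain α v (V.target α v) := by
  have h' : V.frontier.Nonempty := ⟨w, hw⟩
  rw [target, dif_pos h']
  exact (V.frontier.exists_max_image (V.avgGain α v) h').choose_spec.2 w hw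

theorem frontierGain_nonneg (h0 : 0 ≤ α) : 0 ≤ V.frontierGain α v := by
  unfold frontierGain
  split_ifs
  · exact le_rfl
  · exact mul_nonneg h0 (V.avgGain_nonneg α v _)

theorem frontier_disjoint {w : ℕ} (hw : w ∈ V.frontier) : w ∉ V.explored :=
  (Finset.mem_sdiff.1 hw).2

section

variable {α} (h0 : 0 ≤ α) (h1 : α < 1)

include h0 h1

/-- The constant 1 / (1 - α) is a prefixed point of the operator, as 1 + α / (1 - α) = 1 / (1 - α).
Finiteness of the potential allows passing to real numbers. -/
theorem potential_le {ψ : ℕ → ℝ≥0∞} (hψ : ∀ u, ψ u ≤ 1) (u : ℕ) :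
    V.potential α ψ u ≤ ENNReal.ofReal (1 / (1 - α)) := by
  refine OrderHom.lfp_le (a := fun _ => ENNReal.ofReal (1 / (1 - α))) (V.potentialStep α ψ)
    (fun u => ?_) u
  have h2 : 0 < 1 - α := by linarith
  rw [potentialStep_apply, Finset.sum_const, nsmul_eq_mul]
  split_ifs
  · have h3 : ((V.children u).card : ℝ≥0∞) * ENNReal.ofReal (1 / (1 - α)) / (V.children u).card
        ≤ ENNReal.ofReal (1 / (1 - α)) := by
      rw [mul_div_assoc]
      exact ENNReal.mul_div_le
    calc ψ u + ENNReal.ofReal α * _ ≤ 1 + ENNReal.ofReal α * ENNReal.ofReal (1 / (1 - α)) := by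
          gcongr
          exact hψ u
      _ = ENNReal.ofReal (1 / (1 - α)) := by
          rw [← ENNReal.ofReal_mul h0, ← ENNReal.ofReal_one, ← ENNReal.ofReal_add zero_le_one
            (by positivity)]
          congr 1
          field_simp
          ring
  · exact zero_le

theorem potential_ne_top {ψ : ℕ → ℝ≥0∞} (hψ : ∀ u, ψ u ≤ 1) (u : ℕ) :
    V.potential α ψ u ≠ ⊤ :=
  ((V.potential_le h0 h1 hψ u).trans_lt ENNReal.ofReal_lt_top).ne

theorem toReal_potential {ψ : ℕ → ℝ≥0∞} (hψ : ∀ u, ψ u ≤ 1) {u : ℕ} (hu : u ∈ V.explored) :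
    (V.potential α ψ u).toReal = (ψ u).toReal
      + α * ((∑ z ∈ V.children u, (V.potential α ψ z).toReal) / (V.children u).card) := by
  have ht := fun z => V.potential_ne_top h0 h1 hψ z
  have hs : (∑ z ∈ V.children u, V.potential α ψ z) ≠ ⊤ := by
    simpa using fun z _ => ht z
  have hd : (∑ z ∈ V.children u, V.potential α ψ z) / (V.children u).card ≠ ⊤ := by
    by_cases hc : V.children u = ∅
    · simp [hc]
    · exact ENNReal.div_ne_top hs (by simpa using hc)
  conv_lhs => rw [potential_eq, if_pos hu]
  rw [ENNReal.toReal_add ((hψ u).trans_lt ENNReal.one_lt_top).ne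
    (ENNReal.mul_ne_top ENNReal.ofReal_ne_top hd), ENNReal.toReal_mul, ENNReal.toReal_ofReal h0,
    ENNReal.toReal_div, ENNReal.toReal_sum fun z _ => ht z, ENNReal.toReal_natCast]

theorem gain_eq {u : ℕ} (hu : u ∈ V.explored) :
    V.gain α v u = (if u = v then 1 else 0)
      + α * ((∑ z ∈ V.children u, V.gain α v z) / (V.children u).card) := by
  unfold gain
  rw [V.toReal_potential h0 h1 (fun u => by split_ifs <;> simp) hu]
  congr 1
  split_ifs <;> simp

theorem life_eq {u : ℕ} (hu : u ∈ V.explored) :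
    V.life α u = 1 + α * ((∑ z ∈ V.children u, V.life α z) / (V.children u).card) := by
  unfold life
  rw [V.toReal_potential h0 h1 (fun u => le_rfl) hu]
  simp

theorem gain_le (u : ℕ) : V.gain α v u ≤ 1 / (1 - α) := by
  have h2 : 0 ≤ 1 / (1 - α) := by
    have : 0 < 1 - α := by linarith
    positivity
  rw [gain, ← ENNReal.toReal_ofReal h2]
  exact ENNReal.toReal_mono ENNReal.ofReal_ne_top
    (V.potential_le h0 h1 (fun u => by split_ifs <;> simp) u)

theorem one_le_gainSum (hv : v ∈ V.explored) : 1 ≤ V.gainSum α v := by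
  have h2 : 1 ≤ V.gain α v v := by
    rw [V.gain_eq v h0 h1 hv, if_pos rfl, le_add_iff_nonneg_right]
    exact mul_nonneg h0 (div_nonneg (Finset.sum_nonneg fun z _ => V.gain_nonneg α v z)
      (Nat.cast_nonneg _))
  exact h2.trans (Finset.single_le_sum (fun u _ => V.gain_nonneg α v u) hv)

theorem card_le_lifeSum : (V.explored.card : ℝ) ≤ V.lifeSum α := by
  unfold lifeSum
  rw [Finset.card_eq_sum_ones, Nat.cast_sum]
  refine Finset.sum_le_sum fun u hu => ?_
  rw [V.life_eq h0 h1 hu, Nat.cast_one, le_add_iff_nonneg_right]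
  exact mul_nonneg h0 (div_nonneg (Finset.sum_nonneg fun z _ => ENNReal.toReal_nonneg)
      (Nat.cast_nonneg _))

theorem avgGain_le (w : ℕ) : V.avgGain α v w ≤ 1 / (1 - α) := by
  have h2 : 0 < 1 - α := by linarith
  refine div_le_of_le_mul₀ (Nat.cast_nonneg _) (by positivity) ?_
  rw [mul_comm, ← nsmul_eq_mul, ← Finset.sum_const]
  exact Finset.sum_le_sum fun u _ => V.gain_le v h0 h1 u

theorem range_pos (hv : v ∈ V.explored) : 0 < V.range α v := by
  have h2 := V.one_le_gainSum v h0 h1 hv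
  have h3 : (0 : ℝ) < V.explored.card := by exact_mod_cast Finset.card_pos.2 ⟨v, hv⟩
  have h4 := V.card_le_lifeSum h0 h1
  unfold range
  split_ifs
  · exact div_pos (by linarith) (by linarith)
  · exact add_pos_of_nonneg_of_pos (V.frontierGain_nonneg α v h0) (by positivity)

theorem range_le (hv : v ∈ V.explored) :
    V.range α v ≤ V.frontierGain α v + V.gainSum α v / V.explored.card := by
  have h2 := V.one_le_gainSum v h0 h1 hv
  have h3 : (0 : ℝ) < V.explored.card := by exact_mod_cast Finset.card_pos.2 ⟨v, hv⟩
  have h4 := V.card_le_lifeSum h0 h1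
  unfold range
  split_ifs
  · refine le_add_of_nonneg_of_le (V.frontierGain_nonneg α v h0) ?_
    gcongr
  · exact le_rfl

theorem range_le_const (hv : v ∈ V.explored) : V.range α v ≤ 2 / (1 - α) := by
  have h2 : 0 < 1 - α := by linarith
  refine (V.range_le v h0 h1 hv).trans ?_
  have h3 : V.frontierGain α v ≤ 1 / (1 - α) := by
    unfold frontierGain
    split_ifs
    · positivity
    · have := V.avgGain_le v h0 h1 (V.target α v)
      have := V.avgGain_nonneg α v (V.target α v)
      nlinarith
  have h4 : V.gainSum α v / V.explored.card ≤ 1 / (1 - α) := by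
    refine div_le_of_le_mul₀ (Nat.cast_nonneg _) (by positivity) ?_
    rw [mul_comm, ← nsmul_eq_mul, ← Finset.sum_const]
    exact Finset.sum_le_sum fun u _ => V.gain_le v h0 h1 u
  calc _ ≤ 1 / (1 - α) + 1 / (1 - α) := add_le_add h3 h4
    _ = 2 / (1 - α) := by ring

theorem score_nonneg (w : ℕ) (c : Finset ℕ) (u : ℕ) : 0 ≤ V.score α v w c u := by
  have h2 := V.gainSum_nonneg α v
  have h3 := V.card_le_lifeSum h0 h1
  have h4 : (0 : ℝ) ≤ V.explored.card := Nat.cast_nonneg _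
  have h5 : 0 ≤ (∑ z ∈ c, V.gain α v z) / c.card :=
    div_nonneg (Finset.sum_nonneg fun z _ => V.gain_nonneg α v z) (Nat.cast_nonneg _)
  have h6 : 0 ≤ V.lifeSum α := h4.trans h3
  have h7 : 0 ≤ 1 - α := by linarith
  unfold score
  split_ifs <;> positivity

end

/-- The view tells the truth about `G`. -/
structure Sees (G : IdGraph) : Prop where
  subset : V.explored ⊆ G.nodes
  parents_eq : ∀ u ∈ V.explored, V.parents u = G.parents u
  children_eq : ∀ u ∈ V.explored, V.children u = G.children u

end View

/-! ### Stationarity in a form that separates jumps from moves along arcs. -/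

namespace IdGraph

variable (G : IdGraph)

/-- The probability of a random jump, by node. -/
def jump (α : ℝ) (w : ℕ) : ℝ := if G.children w = ∅ then 1 else 1 - α

/-- Unlike `stepAvg`, this is 0 at a dangling node; the uniform move from there is counted as a
jump. -/
def childAvg (f : ℕ → ℝ) (w : ℕ) : ℝ := (∑ z ∈ G.children w, f z) / (G.children w).card

/-- The probability that the surfer makes a random jump. -/
def jumpRate (α : ℝ) : ℝ := ∑ w ∈ G.nodes, G.rank α w * G.jump α w

theorem childAvg_nonneg {f : ℕ → ℝ} (hf : ∀ u, 0 ≤ f u) (w : ℕ) : 0 ≤ G.childAvg f w :=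
  div_nonneg (Finset.sum_nonneg fun z _ => hf z) (Nat.cast_nonneg _)

section

variable {α : ℝ} (h0 : 0 ≤ α) (h1 : α < 1)

include h0 h1

/-- Random jumps and moves from dangling nodes both lead to a uniform node, so together they
contribute `jumpRate` times the plain average; what remains of a step follows an arc. Applied to the
gain and to the lifetime, this yields all formulas for scores. -/
theorem sum_rank_mul_sub (f : ℕ → ℝ) :
    ∑ w ∈ G.nodes, G.rank α w * (f w - α * G.childAvg f w) = G.jumpRate α * G.avg f := by
  have h := G.sum_rank_mul h0 h1 f
  have h2 := G.sum_rank h0 h1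
  have h3 : ∀ w, α * G.stepAvg f w + (1 - α) * G.avg f
      = α * G.childAvg f w + G.jump α w * G.avg f := by
    intro w
    unfold stepAvg jump childAvg outdegree
    split_ifs with hw
    · simp only [hw, Finset.sum_empty, Finset.card_empty]
      ring_nf
    · ring
  have h4 : ∑ w ∈ G.nodes, G.rank α w * f w
      = ∑ w ∈ G.nodes, G.rank α w * (α * G.stepAvg f w + (1 - α) * G.avg f) := by
    rw [h]
    simp only [mul_add, Finset.sum_add_distrib]
    rw [← Finset.sum_mul, h2, one_mul, Finset.mul_sum]
    congr 1
    exact Finset.sum_congr rfl fun w _ => by ring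
  simp only [mul_sub, Finset.sum_sub_distrib]
  rw [h4, jumpRate, Finset.sum_mul, ← Finset.sum_sub_distrib]
  refine Finset.sum_congr rfl fun w _ => ?_
  rw [h3]
  ring

theorem le_jumpRate : 1 - α ≤ G.jumpRate α := by
  have h := G.sum_rank h0 h1
  calc 1 - α = (1 - α) * ∑ w ∈ G.nodes, G.rank α w := by rw [h, mul_one]
    _ ≤ _ := ?_
  rw [jumpRate, Finset.mul_sum]
  refine Finset.sum_le_sum fun w _ => ?_
  rw [mul_comm]
  refine mul_le_mul_of_nonneg_left ?_ (G.rank_nonneg h0 h1 w)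
  unfold jump
  split_ifs <;> linarith

end

end IdGraph

/-! ### Unbiasedness and bounds of the score, for truthful views. -/

namespace View.Sees

variable {V : View} {G : IdGraph} (hV : V.Sees G) {α : ℝ} (h0 : 0 ≤ α) (h1 : α < 1) {v : ℕ}

include hV

theorem gain_eq {u : ℕ} (h0 : 0 ≤ α) (h1 : α < 1) (hu : u ∈ V.explored) :
    V.gain α v u = (if u = v then 1 else 0) + α * G.childAvg (V.gain α v) u := by
  rw [V.gain_eq v h0 h1 hu, hV.children_eq u hu, IdGraph.childAvg]

theorem life_eq {u : ℕ} (h0 : 0 ≤ α) (h1 : α < 1) (hu : u ∈ V.explored) :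
    V.life α u = 1 + α * G.childAvg (V.life α) u := by
  rw [V.life_eq h0 h1 hu, hV.children_eq u hu, IdGraph.childAvg]

theorem mem_knownChildren {w u : ℕ} (hw : w ∈ G.nodes) :
    u ∈ V.knownChildren w ↔ u ∈ V.explored ∧ u ∈ G.children w := by
  rw [knownChildren, Finset.mem_filter]
  refine and_congr_right fun hu => ?_
  rw [hV.parents_eq u hu, G.mem_parents_iff (hV.subset hu) hw]

theorem knownChildren_eq {w : ℕ} (hw : w ∈ G.nodes) :
    V.knownChildren w = G.children w ∩ V.explored := by
  ext u
  rw [hV.mem_knownChildren hw, Finset.mem_inter, and_comm]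

theorem sum_children {w : ℕ} (hw : w ∈ G.nodes) {f : ℕ → ℝ} (hf : ∀ u ∉ V.explored, f u = 0) :
    ∑ z ∈ G.children w, f z = ∑ z ∈ V.knownChildren w, f z := by
  rw [hV.knownChildren_eq hw]
  refine (Finset.sum_subset Finset.inter_subset_left fun u hu hu' => hf u fun h => hu' ?_).symm
  exact Finset.mem_inter.2 ⟨hu, h⟩

theorem avg_gain : G.avg (V.gain α v) = V.gainSum α v / G.size := by
  unfold IdGraph.avg View.gainSum
  rw [Finset.sum_subset hV.subset fun u _ hu => V.gain_eq_zero α v hu]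

theorem avg_life : G.avg (V.life α) = V.lifeSum α / G.size := by
  unfold IdGraph.avg View.lifeSum
  rw [Finset.sum_subset hV.subset fun u _ hu => V.life_eq_zero α hu]

theorem frontier_subset : V.frontier ⊆ G.nodes := by
  intro w hw
  obtain ⟨u, hu, hw⟩ := Finset.mem_biUnion.1 (Finset.mem_sdiff.1 hw).1
  rw [hV.parents_eq u hu, hV.children_eq u hu] at hw
  rcases Finset.mem_union.1 hw with h | h
  · exact G.parents_subset u h
  · exact G.children_subset u h

theorem target_mem (hv : v ∈ G.nodes) : V.target α v ∈ G.nodes := by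
  by_cases h : V.frontier = ∅
  · simpa [target, h] using hv
  · exact hV.frontier_subset (V.target_mem α v h)

omit hV in
theorem knownChildren_eq_empty {w : ℕ} (hw : w ∉ V.explored) (hf : w ∉ V.frontier) :
    V.knownChildren w = ∅ := by
  rw [Finset.eq_empty_iff_forall_notMem]
  intro u hu
  obtain ⟨h1, h2⟩ := Finset.mem_filter.1 hu
  exact hf (Finset.mem_sdiff.2 ⟨Finset.mem_biUnion.2 ⟨u, h1, Finset.mem_union_left _ h2⟩, hw⟩)

theorem childAvg_eq_zero {f : ℕ → ℝ} (hf : ∀ u ∉ V.explored, f u = 0) {w : ℕ} (hw : w ∈ G.nodes)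
    (hw' : w ∉ V.explored) (hfr : w ∉ V.frontier) : G.childAvg f w = 0 := by
  rw [IdGraph.childAvg, hV.sum_children hw hf, knownChildren_eq_empty hw' hfr]
  simp

/-- Children outside the explored set have gain 0, so both averages have the same numerator, and the
one over known children has the smaller denominator. -/
theorem childAvg_gain_le {w : ℕ} (hw : w ∈ G.nodes) :
    G.childAvg (V.gain α v) w ≤ V.avgGain α v w := by
  rw [IdGraph.childAvg, hV.sum_children hw fun u hu => V.gain_eq_zero α v hu, avgGain]
  rcases Finset.eq_empty_or_nonempty (V.knownChildren w) with h | h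
  · simp [h]
  · have h2 : (0 : ℝ) < (V.knownChildren w).card := by exact_mod_cast h.card_pos
    have h3 : (V.knownChildren w).card ≤ (G.children w).card := by
      rw [hV.knownChildren_eq hw]
      exact Finset.card_le_card Finset.inter_subset_left
    gcongr
    exact Finset.sum_nonneg fun u _ => V.gain_nonneg α v u

include h0

theorem mul_childAvg_gain_le {w : ℕ} (hw : w ∈ G.nodes) (hw' : w ∉ V.explored) :
    α * G.childAvg (V.gain α v) w ≤ V.frontierGain α v := by
  by_cases hf : w ∈ V.frontier
  · rw [frontierGain, if_neg (Finset.ne_empty_of_mem hf)]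
    gcongr
    exact (hV.childAvg_gain_le hw).trans (V.avgGain_le_target α v hf)
  · rw [hV.childAvg_eq_zero (fun u hu => V.gain_eq_zero α v hu) hw hw' hf, mul_zero]
    exact V.frontierGain_nonneg α v h0

include h1

theorem score_le_range {w u : ℕ} (hv : v ∈ V.explored) (hw : w ∈ G.nodes) :
    V.score α v w (G.children w) u ≤ V.range α v := by
  have h2 : 0 ≤ V.gainSum α v / V.explored.card :=
    div_nonneg (V.gainSum_nonneg α v) (Nat.cast_nonneg _)
  have h3 := V.range_pos v h0 h1 hv
  have h4 : ((if G.children w = ∅ then 1 else 1 - α) * (if u ∈ V.explored then 1 else 0)) ≤ 1 := by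
    split_ifs <;> (simp; try linarith)
  have h5 := V.frontierGain_nonneg α v h0
  unfold score
  by_cases hf : V.frontier = ∅
  · rw [range, if_pos hf] at h3 ⊢
    rw [if_pos hf]
    split_ifs
    · exact le_rfl
    · exact h3.le
  · rw [range, if_neg hf, if_neg hf]
    refine add_le_add ?_ (mul_le_of_le_one_right h2 h4)
    split_ifs with hw'
    · exact h5
    · exact hV.mul_childAvg_gain_le h0 hw hw'

/-- In `sum_rank_mul_sub` for the gain, the integrand is the indicator of v on explored nodes, and
minus α times the average gain of the children elsewhere. -/
theorem rank_eq (hv : v ∈ V.explored) :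
    G.rank α v = G.jumpRate α * (V.gainSum α v / G.size)
      + ∑ w ∈ G.nodes, G.rank α w * (if w ∈ V.explored then 0
          else α * G.childAvg (V.gain α v) w) := by
  have h := G.sum_rank_mul_sub h0 h1 (V.gain α v)
  rw [hV.avg_gain] at h
  rw [← h, ← Finset.sum_add_distrib]
  have h2 : ∀ w ∈ G.nodes, G.rank α w * (V.gain α v w - α * G.childAvg (V.gain α v) w)
      + G.rank α w * (if w ∈ V.explored then 0 else α * G.childAvg (V.gain α v) w)
      = if w = v then G.rank α v else 0 := by
    intro w hw
    by_cases hw' : w ∈ V.explored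
    · rw [hV.gain_eq h0 h1 hw', if_pos hw']
      split_ifs with hwv
      · rw [hwv]; ring
      · ring
    · have : w ≠ v := fun h => hw' (h ▸ hv)
      rw [V.gain_eq_zero α v hw', if_neg hw', if_neg this]
      ring
  rw [Finset.sum_congr rfl h2]
  simp [hV.subset hv]

/-- The same identity for the lifetime. With an empty frontier no unexplored node has an explored
child, so there is no boundary term. Dividing it into the formula for P(v) eliminates both n and the
jump rate. -/
theorem rank_explored_eq (hf : V.frontier = ∅) :
    ∑ w ∈ G.nodes, G.rank α w * (if w ∈ V.explored then 1 else 0)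
      = G.jumpRate α * (V.lifeSum α / G.size) := by
  rw [← hV.avg_life, ← G.sum_rank_mul_sub h0 h1]
  refine Finset.sum_congr rfl fun w hw => ?_
  by_cases hw' : w ∈ V.explored
  · rw [hV.life_eq h0 h1 hw', if_pos hw']
    ring
  · rw [V.life_eq_zero α hw', hV.childAvg_eq_zero (fun u hu => V.life_eq_zero α hu) hw hw'
      (by simp [hf]), if_neg hw']
    ring

/-- Drop the nonnegative boundary term in `rank_eq` and use that the jump rate is at least 1 - α. -/
theorem gainSum_le (hv : v ∈ V.explored) : V.gainSum α v ≤ G.size * G.rank α v / (1 - α) := by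
  have h2 : 0 < 1 - α := by linarith
  have h3 : (0 : ℝ) < G.size := by exact_mod_cast G.size_pos
  have h4 := hV.rank_eq h0 h1 hv
  have h5 : 0 ≤ ∑ w ∈ G.nodes, G.rank α w * (if w ∈ V.explored then 0
          else α * G.childAvg (V.gain α v) w) := by
    refine Finset.sum_nonneg fun w _ => mul_nonneg (G.rank_nonneg h0 h1 w) ?_
    split_ifs
    · exact le_rfl
    · exact mul_nonneg h0 (G.childAvg_nonneg (V.gain_nonneg α v) w)
  have h6 := G.le_jumpRate h0 h1
  have h7 := V.gainSum_nonneg α v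
  rw [le_div_iff₀ h2]
  have h8 : (1 - α) * (V.gainSum α v / G.size) ≤ G.rank α v := by
    rw [h4]
    have : (1 - α) * (V.gainSum α v / G.size) ≤ G.jumpRate α * (V.gainSum α v / G.size) := by
      gcongr
    linarith
  calc V.gainSum α v * (1 - α) = G.size * ((1 - α) * (V.gainSum α v / G.size)) := by field_simp
    _ ≤ G.size * G.rank α v := by gcongr

/-- The score is an unbiased estimate. -/
theorem mean_score (hv : v ∈ V.explored) :
    ∑ w ∈ G.nodes, G.rank α w * G.avg (fun u => V.score α v w (G.children w) u)
      = G.rank α v := by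
  have h3 : (0 : ℝ) < G.size := by exact_mod_cast G.size_pos
  have h4 : (0 : ℝ) < V.explored.card := by exact_mod_cast Finset.card_pos.2 ⟨v, hv⟩
  have h5 := V.card_le_lifeSum h0 h1
  have h6 := hV.rank_eq h0 h1 hv
  unfold score
  by_cases hf : V.frontier = ∅
  · simp only [hf, if_true, IdGraph.avg_const]
    have h7 := hV.rank_explored_eq h0 h1 hf
    have h8 : ∑ w ∈ G.nodes, G.rank α w * (if w ∈ V.explored then 0
          else α * G.childAvg (V.gain α v) w) = 0 := by
      refine Finset.sum_eq_zero fun w hw => ?_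
      split_ifs with hw'
      · simp
      · rw [hV.childAvg_eq_zero (fun u hu => V.gain_eq_zero α v hu) hw hw' (by simp [hf])]
        simp
    rw [h6, h8, add_zero]
    calc _ = (V.gainSum α v / V.lifeSum α)
          * ∑ w ∈ G.nodes, G.rank α w * (if w ∈ V.explored then 1 else 0) := by
          rw [Finset.mul_sum]
          refine Finset.sum_congr rfl fun w _ => ?_
          split_ifs <;> ring
      _ = _ := by
          have : V.lifeSum α ≠ 0 := by linarith
          rw [h7]
          field_simp
  -- A uniform node is explored with probability |H| / n, which turns the known factor 1 / |H| of
  -- the score into the required 1 / n.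
  · have h7 : G.avg (fun u => if u ∈ V.explored then 1 else 0) = V.explored.card / G.size := by
      unfold IdGraph.avg
      rw [Finset.sum_ite_mem, Finset.inter_eq_right.2 hV.subset]
      simp
    simp only [hf, if_false, IdGraph.avg_add, IdGraph.avg_const, IdGraph.avg_mul, h7]
    rw [h6, add_comm]
    simp only [mul_add, Finset.sum_add_distrib]
    congr 1
    rw [IdGraph.jumpRate, Finset.sum_mul]
    refine Finset.sum_congr rfl fun w _ => ?_
    rw [IdGraph.jump]
    field_simp

/-- Here the score is constant, so its mean, the PageRank of v, is its value. This makes the output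
after complete exploration exact. -/
theorem closed_score (hv : v ∈ V.explored) (hall : V.explored = G.nodes) :
    V.gainSum α v / V.lifeSum α = G.rank α v := by
  have hf : V.frontier = ∅ := by
    rw [View.frontier, Finset.sdiff_eq_empty_iff_subset, Finset.biUnion_subset]
    intro u hu
    rw [hV.parents_eq u hu, hV.children_eq u hu, hall]
    exact Finset.union_subset (G.parents_subset u) (G.children_subset u)
  rw [← hV.mean_score h0 h1 hv]
  unfold score
  simp only [hf, if_true, IdGraph.avg_const, hall]
  rw [Finset.sum_congr rfl fun w hw => by rw [if_pos hw], ← Finset.sum_mul, G.sum_rank h0 h1,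
    one_mul]

-- The potential of the larger view is a prefixed point of the operator of the smaller one.
omit hV in
theorem gain_mono {V' : View} (hV : V.Sees G) (hV' : V'.Sees G)
    (h : V.explored ⊆ V'.explored) (u : ℕ) : V.gain α v u ≤ V'.gain α v u := by
  unfold View.gain
  refine ENNReal.toReal_mono (V'.potential_ne_top h0 h1 (fun u => by split_ifs <;> simp) u) ?_
  refine OrderHom.lfp_le (V.potentialStep α _) (fun u => ?_) u
  rw [V'.potential_eq, View.potentialStep_apply]
  by_cases h2 : u ∈ V.explored
  · rw [if_pos h2, if_pos (h h2), hV.children_eq u h2, hV'.children_eq u (h h2)]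
  · rw [if_neg h2]
    exact zero_le

omit hV in
theorem gainSum_mono {V' : View} (hV : V.Sees G) (hV' : V'.Sees G)
    (h : V.explored ⊆ V'.explored) : V.gainSum α v ≤ V'.gainSum α v :=
  (Finset.sum_le_sum fun u _ => gain_mono h0 h1 hV hV' h u).trans
    (Finset.sum_le_sum_of_subset_of_nonneg h fun u _ _ => V'.gain_nonneg α v u)

omit hV in
/-- Exploring the target increases the total gain. -/
theorem frontierGain_le {V' : View} (hV : V.Sees G) (hV' : V'.Sees G)
    (h : V.explored ⊆ V'.explored) (ht : V.target α v ∈ V'.explored) {U : ℝ} (hU : 0 ≤ U)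
    (hdeg : ∀ w ∈ G.nodes,
      (G.outdegree w : ℝ) ≤ U * max 1 ((G.children w ∩ V.explored).card : ℝ)) :
    V.frontierGain α v ≤ U * (V'.gainSum α v - V.gainSum α v) := by
  have hmono : 0 ≤ V'.gainSum α v - V.gainSum α v := sub_nonneg.2 (gainSum_mono h0 h1 hV hV' h)
  unfold frontierGain
  split_ifs with hf
  · positivity
  have hfr := V.target_mem α v hf
  set a := V.target α v with ha
  have han := hV.frontier_subset hfr
  have hae := V.frontier_disjoint hfr
  rcases Finset.eq_empty_or_nonempty (V.knownChildren a) with hk | hk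
  · rw [avgGain, hk]
    simp only [Finset.sum_empty, zero_div, mul_zero]
    positivity
  have h2 : (1 : ℝ) ≤ (V.knownChildren a).card := by exact_mod_cast hk.card_pos
  have hkc := hV.knownChildren_eq han
  have h3 := hdeg a han
  rw [← hkc, max_eq_right h2] at h3
  have h4 : (V.knownChildren a).card ≤ (G.children a).card := by
    rw [hkc]
    exact Finset.card_le_card Finset.inter_subset_left
  have h5 : (1 : ℝ) ≤ (G.children a).card := h2.trans (by exact_mod_cast h4)
  set S := ∑ u ∈ V.knownChildren a, V.gain α v u with hS
  have hS0 : 0 ≤ S := Finset.sum_nonneg fun u _ => V.gain_nonneg α v u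
  -- Once explored, the target has at least the gain which its known children pass on; before, its
  -- gain was 0. So the total gain grows by at least this amount, and `h3` compares the two
  -- denominators.
  have h6 : α * (S / (G.children a).card) ≤ V'.gain α v a := by
    rw [hV'.gain_eq h0 h1 ht, hS,
      ← hV.sum_children han fun u hu => V.gain_eq_zero α v hu, IdGraph.childAvg]
    have : α * ((∑ z ∈ G.children a, V.gain α v z) / (G.children a).card)
        ≤ α * ((∑ z ∈ G.children a, V'.gain α v z) / (G.children a).card) := by
      gcongr with z hz
      exact gain_mono h0 h1 hV hV' h z
    refine this.trans (le_add_of_nonneg_left ?_)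
    split_ifs <;> norm_num
  have h7 : V.gainSum α v + V'.gain α v a ≤ V'.gainSum α v := by
    unfold gainSum
    calc _ ≤ ∑ u ∈ V.explored, V'.gain α v u + V'.gain α v a := by
          gcongr with u hu
          exact gain_mono h0 h1 hV hV' h u
      _ = ∑ u ∈ insert a V.explored, V'.gain α v u := by
          rw [Finset.sum_insert hae, add_comm]
      _ ≤ _ := Finset.sum_le_sum_of_subset_of_nonneg (Finset.insert_subset ht h)
          fun u _ _ => V'.gain_nonneg α v u
  rw [avgGain, ← hS]
  calc α * (S / (V.knownChildren a).card)
      ≤ U * (α * (S / (G.children a).card)) := by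
        rw [IdGraph.outdegree] at h3
        have : S / (V.knownChildren a).card ≤ U * (S / (G.children a).card) := by
          rw [div_le_iff₀ (by linarith), mul_div_assoc', div_mul_eq_mul_div,
            le_div_iff₀ (by linarith)]
          nlinarith
        nlinarith
    _ ≤ U * (V'.gainSum α v - V.gainSum α v) := by
        gcongr
        linarith

end View.Sees
end

/-! ### The search, and its reduction to a process on histories and positions. -/

noncomputable section

/-- The parents and the children of all nodes, as far as they are known. -/
abbrev Info := ℕ → Finset ℕ × Finset ℕ

def IdGraph.info (G : IdGraph) : Info := fun u => (G.parents u, G.children u)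

/-- What is known about the nodes in `H`. -/
def Info.view (I : Info) (H : Finset ℕ) : View where
  explored := H
  -- Entries outside H are erased so that the view depends only on the values of I on H, as
  -- `view_congr` needs.
  parents := fun u => if u ∈ H then (I u).1 else ∅
  children := fun u => if u ∈ H then (I u).2 else ∅

theorem Info.view_congr {I J : Info} {H : Finset ℕ} (h : ∀ u ∈ H, I u = J u) :
    I.view H = J.view H := by
  unfold Info.view
  congr 1 <;> ext u : 1 <;> split_ifs with hu <;> simp [h, hu]

theorem IdGraph.sees_view (G : IdGraph) {H : Finset ℕ} (h : H ⊆ G.nodes) :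
    (G.info.view H).Sees G where
  subset := h
  parents_eq _ hu := if_pos hu
  children_eq _ hu := if_pos hu

/-- The outcome of the rounds of a search: a round yields a node distributed according to PageRank
and an independent, uniformly distributed node. -/
structure Tally where
  view : View
  rounds : ℕ
  /-- The sum of the normalized scores. -/
  hits : ℝ
  /-- The sum of the normalization factors. -/
  mass : ℝ
  /-- The sum of the normalized scores, or of their distances to the maximal score in rounds in
  which a component of the graph is explored completely. -/
  noise : ℝ

namespace Tally

variable (T : Tally) (α : ℝ) (v : ℕ)

/-- The normalized score. -/
def hit (w : ℕ) (c : Finset ℕ) (u : ℕ) : ℝ := T.view.score α v w c u / T.view.range α v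

-- The hit and the normalization use the view from before the round. Hence the normalization is
-- predictable, and the scores remain unbiased given the past.
open Classical in
def next (I : Info) (w u : ℕ) : Tally where
  view := I.view (insert w (insert u (insert (T.view.target α v) T.view.explored)))
  rounds := T.rounds + 1
  hits := T.hits + T.hit α v w (I w).2 u
  mass := T.mass + 1 / T.view.range α v
  noise := T.noise + if T.view.frontier = ∅ then 1 - T.hit α v w (I w).2 u
    else T.hit α v w (I w).2 u

end Tally

namespace Info

variable (I : Info) (α : ℝ) (v : ℕ)

/-- The tally after the rounds in a list (the last round comes first). -/
def tally : List (ℕ × ℕ) → Tally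
  | [] => ⟨I.view {v}, 0, 0, 0, 0⟩
  | r :: h => (tally h).next α v I r.1 r.2

def explored (h : List (ℕ × ℕ)) : Finset ℕ := (I.tally α v h).view.explored

theorem explored_nil : I.explored α v [] = {v} := rfl

theorem explored_cons (r : ℕ × ℕ) (h : List (ℕ × ℕ)) :
    I.explored α v (r :: h) = insert r.1 (insert r.2
      (insert ((I.tally α v h).view.target α v) (I.explored α v h))) := rfl

theorem explored_subset_cons (r : ℕ × ℕ) (h : List (ℕ × ℕ)) :
    I.explored α v h ⊆ I.explored α v (r :: h) := by
  intro u hu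
  simp [explored_cons, hu]

theorem tally_view (h : List (ℕ × ℕ)) : (I.tally α v h).view = I.view (I.explored α v h) := by
  cases h <;> rfl

theorem tally_rounds (h : List (ℕ × ℕ)) : (I.tally α v h).rounds = h.length := by
  induction h with
  | nil => rfl
  | cons r h ih => simp [tally, Tally.next, ih]

variable {I α v}

/-- The partial information held by the search determines the same tally as the full information of
the graph, so the analysis can work with `G.info` throughout. -/
theorem tally_congr {J : Info} {h : List (ℕ × ℕ)} (hIJ : ∀ u ∈ I.explored α v h, J u = I u) :
    J.tally α v h = I.tally α v h := by
  induction h with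
  | nil =>
    rw [explored_nil] at hIJ
    simp only [tally]
    rw [view_congr hIJ]
  | cons r h ih =>
    have ih := ih fun u hu => hIJ u (I.explored_subset_cons α v r h hu)
    have hr : J r.1 = I r.1 := hIJ _ (by simp [explored_cons])
    have hv := view_congr hIJ
    rw [explored_cons] at hv
    unfold tally Tally.next
    rw [ih, hr]
    congr 1

theorem mem_explored (h : List (ℕ × ℕ)) : v ∈ I.explored α v h := by
  induction h with
  | nil => simp [explored_nil]
  | cons r h ih => exact I.explored_subset_cons α v r h ih

end Info

/-- The states of a search for the score of `v`: the rounds so far are `h`, the surfer is at `x`.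
In each step we get random nodes `u` and `y`, and explore `u`, the target, and `x`. With
probability `1 - α` the round ends, and a new one starts at `y`. -/
inductive SearchState where
  | boot (v : ℕ)
  | seed (v : ℕ) (I : Info)
  | idle (v : ℕ) (h : List (ℕ × ℕ)) (I : Info) (x : ℕ)
  | drawn (v : ℕ) (h : List (ℕ × ℕ)) (I : Info) (x u : ℕ)
  | exploreDrawn (v : ℕ) (h : List (ℕ × ℕ)) (I : Info) (x u y : ℕ)
  | exploreTarget (v : ℕ) (h : List (ℕ × ℕ)) (I : Info) (x u y : ℕ)
  | move (v : ℕ) (h : List (ℕ × ℕ)) (I : Info) (x u y : ℕ)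

open Classical in
/-- The search which halts as soon as `verdict` yields a number. -/
@[reducible] def search (α : ℝ) (h0 : 0 ≤ α) (h1 : α ≤ 1) (verdict : ℕ → Tally → Option ℝ) :
    QueryAlgorithm where
  State := SearchState
  start v := PMF.pure (.boot v)
  act
    | .boot v => .neighbourhood v
    | .seed _ _ => .randomNode
    | .idle v h I _ => (verdict v (I.tally α v h)).elim .randomNode .output
    | .drawn .. => .randomNode
    | .exploreDrawn _ _ _ _ u _ => .neighbourhood u
    | .exploreTarget v h I _ _ _ => .neighbourhood ((I.tally α v h).view.target α v)
    | .move _ _ _ x _ _ => .neighbourhood x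
  onRandomNode s w := match s with
    | .seed v I => PMF.pure (.idle v [] I w)
    | .idle v h I x => PMF.pure (.drawn v h I x w)
    | .drawn v h I x u => PMF.pure (.exploreDrawn v h I x u w)
    | s => PMF.pure s
  onNeighbourhood s p c := match s with
    | .boot v => PMF.pure (.seed v (Function.update (fun _ => (∅, ∅)) v (p, c)))
    | .exploreDrawn v h I x u y =>
        PMF.pure (.exploreTarget v h (Function.update I u (p, c)) x u y)
    | .exploreTarget v h I x u y => PMF.pure (.move v h
        (Function.update I ((I.tally α v h).view.target α v) (p, c)) x u y)
    | .move v h I x u y =>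
        (PMF.coin α h0 h1).bind fun b =>
          -- A step that does not end the round leaves the history unchanged: its explorations do
          -- not enter the tally, which thus depends on the completed rounds alone.
          if b then
            if hc : c.Nonempty then
              (PMF.uniformOfFinset c hc).map fun z => .idle v h (Function.update I x (p, c)) z
            else PMF.pure (.idle v h (Function.update I x (p, c)) y)
          else PMF.pure (.idle v ((x, u) :: h) (Function.update I x (p, c)) y)
    | s => PMF.pure s

namespace search

variable {α : ℝ} {h0 : 0 ≤ α} {h1 : α ≤ 1} {verdict : ℕ → Tally → Option ℝ} {G : IdGraph}

/-- The configurations between two steps of the surfer. -/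
structure Ready (α : ℝ) (G : IdGraph) (v : ℕ) (h : List (ℕ × ℕ)) (x : ℕ)
    (c : SearchState × Finset ℕ) : Prop where
  pos_mem : x ∈ G.nodes
  explored_subset : G.info.explored α v h ⊆ G.nodes
  state : ∃ I : Info, c.1 = .idle v h I x ∧ ∀ u ∈ G.info.explored α v h, I u = G.info u
  pos_known : x ∈ c.2
  known : ∀ u ∈ G.info.explored α v h, u ∈ c.2 ∧ G.parents u ⊆ c.2 ∧ G.children u ⊆ c.2

open Classical in
/-- The expectation of `φ` after a step of the surfer. -/
def succExpect (α : ℝ) (verdict : ℕ → Tally → Option ℝ) (G : IdGraph) (v : ℕ)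
    (φ : List (ℕ × ℕ) → ℕ → ℝ≥0∞) (h : List (ℕ × ℕ)) (x : ℕ) : ℝ≥0∞ :=
  if verdict v (G.info.tally α v h) = none then
    (PMF.uniformOfFinset G.nodes G.nonempty).expect fun u =>
      (PMF.uniformOfFinset G.nodes G.nonempty).expect fun y =>
        ENNReal.ofReal α * (if hc : (G.children x).Nonempty then
            (PMF.uniformOfFinset (G.children x) hc).expect fun z => φ h z
          else φ h y)
        + ENNReal.ofReal (1 - α) * φ ((x, u) :: h) y
  else φ h x

/-- A step of the surfer costs two random nodes and three neighbourhoods. -/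
def fiveSteps (A : QueryAlgorithm) (G : IdGraph) (c : A.State × Finset ℕ) :
    PMF (A.State × Finset ℕ) :=
  ((((A.step G c).bind (A.step G)).bind (A.step G)).bind (A.step G)).bind (A.step G)

theorem run_add_five (A : QueryAlgorithm) (G : IdGraph) (v q : ℕ) :
    A.run G v (q + 5) = (A.run G v q).bind (fiveSteps A G) := by
  simp only [QueryAlgorithm.run, PMF.bind_bind]
  congr 1
  ext c : 1
  simp only [fiveSteps, PMF.bind_bind]

theorem fiveSteps_of_output {A : QueryAlgorithm} {G : IdGraph} {c : A.State × Finset ℕ} {r : ℝ}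
    (h : A.act c.1 = .output r) : fiveSteps A G c = PMF.pure c := by
  have : A.step G c = PMF.pure c := by simp [QueryAlgorithm.step, h]
  simp [fiveSteps, this]

theorem act_idle (v : ℕ) (h : List (ℕ × ℕ)) (I : Info) (x : ℕ) :
    (search α h0 h1 verdict).act (.idle v h I x)
      = (verdict v (I.tally α v h)).elim .randomNode .output := rfl

theorem step_idle {v : ℕ} {h : List (ℕ × ℕ)} {I : Info} {x : ℕ} {K : Finset ℕ}
    (hn : verdict v (I.tally α v h) = none) :
    (search α h0 h1 verdict).step G (.idle v h I x, K)
      = (PMF.uniformOfFinset G.nodes G.nonempty).bind fun u =>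
          PMF.pure (.drawn v h I x u, insert u K) := by
  simp only [QueryAlgorithm.step, hn, Option.elim_none, PMF.pure_map]

theorem step_drawn {v : ℕ} {h : List (ℕ × ℕ)} {I : Info} {x u : ℕ} {K : Finset ℕ} :
    (search α h0 h1 verdict).step G (.drawn v h I x u, K)
      = (PMF.uniformOfFinset G.nodes G.nonempty).bind fun y =>
          PMF.pure (.exploreDrawn v h I x u y, insert y K) := by
  simp only [QueryAlgorithm.step, search, PMF.pure_map]

theorem step_exploreDrawn {v : ℕ} {h : List (ℕ × ℕ)} {I : Info} {x u y : ℕ} {K : Finset ℕ}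
    (hu : u ∈ K) :
    (search α h0 h1 verdict).step G (.exploreDrawn v h I x u y, K)
      = PMF.pure (.exploreTarget v h (Function.update I u (G.info u)) x u y,
          K ∪ G.parents u ∪ G.children u) := by
  simp only [QueryAlgorithm.step, search, PMF.pure_map, hu, if_true, IdGraph.info]

theorem step_exploreTarget {v : ℕ} {h : List (ℕ × ℕ)} {I : Info} {x u y a : ℕ} {K : Finset ℕ}
    (ha : (I.tally α v h).view.target α v = a) (haK : a ∈ K) :
    (search α h0 h1 verdict).step G (.exploreTarget v h I x u y, K)
      = PMF.pure (.move v h (Function.update I a (G.info a)) x u y,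
          K ∪ G.parents a ∪ G.children a) := by
  simp only [QueryAlgorithm.step, search, PMF.pure_map, ha, haK, if_true, IdGraph.info]

theorem step_move {v : ℕ} {h : List (ℕ × ℕ)} {I : Info} {x u y : ℕ} {K : Finset ℕ}
    (hx : x ∈ K) :
    (search α h0 h1 verdict).step G (.move v h I x u y, K)
      = (PMF.coin α h0 h1).bind fun b =>
          if b then
            if hc : (G.children x).Nonempty then
              (PMF.uniformOfFinset (G.children x) hc).bind fun z =>
                PMF.pure (.idle v h (Function.update I x (G.info x)) z,
                  K ∪ G.parents x ∪ G.children x)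
            else PMF.pure (.idle v h (Function.update I x (G.info x)) y,
              K ∪ G.parents x ∪ G.children x)
          else PMF.pure (.idle v ((x, u) :: h) (Function.update I x (G.info x)) y,
            K ∪ G.parents x ∪ G.children x) := by
  simp only [QueryAlgorithm.step, search, hx, if_true, IdGraph.info, PMF.map_bind]
  congr 1
  ext b : 1
  cases b
  · simp [PMF.pure_map]
  · by_cases hc : (G.children x).Nonempty
    · simp only [hc, dif_pos, if_true, PMF.map_comp]
      rfl
    · simp [hc, PMF.pure_map]

theorem fiveSteps_eq {v : ℕ} {h : List (ℕ × ℕ)} {x : ℕ} {I : Info} {K : Finset ℕ}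
    (hr : Ready α G v h x (.idle v h I x, K))
    (hn : verdict v (G.info.tally α v h) = none) :
    ∃ (I' : ℕ → Info) (K' : ℕ → ℕ → Finset ℕ),
      (∀ u ∈ G.nodes, ∀ y ∈ G.nodes, G.info.explored α v ((x, u) :: h) ⊆ G.nodes ∧
        y ∈ K' u y ∧ G.children x ⊆ K' u y ∧
        ∀ w ∈ G.info.explored α v ((x, u) :: h), I' u w = G.info w ∧
          w ∈ K' u y ∧ G.parents w ⊆ K' u y ∧ G.children w ⊆ K' u y) ∧
      fiveSteps (search α h0 h1 verdict) G (.idle v h I x, K)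
        = (PMF.uniformOfFinset G.nodes G.nonempty).bind fun u =>
          (PMF.uniformOfFinset G.nodes G.nonempty).bind fun y =>
          (PMF.coin α h0 h1).bind fun b =>
          if b then
            if hc : (G.children x).Nonempty then
              (PMF.uniformOfFinset (G.children x) hc).bind fun z =>
                PMF.pure (.idle v h (I' u) z, K' u y)
            else PMF.pure (.idle v h (I' u) y, K' u y)
          else PMF.pure (.idle v ((x, u) :: h) (I' u) y, K' u y) := by
  obtain ⟨hx, hsub, ⟨I₀, hI₀, hI⟩, hxK, hK⟩ := hr
  obtain ⟨rfl⟩ : I = I₀ := by simpa using hI₀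
  set H := G.info.explored α v h with hH
  set a := (G.info.tally α v h).view.target α v with ha
  have hvH : v ∈ H := Info.mem_explored h
  have hS : (G.info.tally α v h).view.Sees G := by
    rw [Info.tally_view]
    exact G.sees_view hsub
  have haN : a ∈ G.nodes := hS.target_mem (hsub hvH)
  -- The target may be queried: it is v, or a neighbour of an explored node and thus part of an
  -- earlier answer.
  have haK : a ∈ K := by
    by_cases hf : (G.info.tally α v h).view.frontier = ∅
    · have : a = v := by simp [ha, View.target, hf]
      rw [this]
      exact (hK v hvH).1
    · have h2 := (G.info.tally α v h).view.target_mem α v hf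
      obtain ⟨w, hw, hw2⟩ := Finset.mem_biUnion.1 (Finset.mem_sdiff.1 h2).1
      rw [hS.parents_eq w hw, hS.children_eq w hw] at hw2
      rcases Finset.mem_union.1 hw2 with h3 | h3
      · exact (hK w hw).2.1 h3
      · exact (hK w hw).2.2 h3
  set I1 : ℕ → Info := fun u => Function.update I u (G.info u) with hI1
  set I2 : ℕ → Info := fun u => Function.update (I1 u) a (G.info a) with hI2
  set I3 : ℕ → Info := fun u => Function.update (I2 u) x (G.info x) with hI3
  have hI1' : ∀ u, ∀ w ∈ H, I1 u w = G.info w := by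
    intro u w hw
    by_cases hwu : w = u
    · subst hwu; simp [hI1]
    · simp [hI1, hwu, hI w hw]
  have hI2' : ∀ u w, w = u ∨ w = a ∨ w ∈ H → I2 u w = G.info w := by
    intro u w hw
    by_cases hwa : w = a
    · subst hwa; simp [hI2]
    · simp only [hI2, Function.update_of_ne hwa]
      rcases hw with rfl | hw | hw
      · simp [hI1]
      · exact absurd hw hwa
      · exact hI1' u w hw
  set K' : ℕ → ℕ → Finset ℕ := fun u y =>
    insert y (insert u K) ∪ G.parents u ∪ G.children u ∪ G.parents a ∪ G.children a
      ∪ G.parents x ∪ G.children x with hK'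
  have hKK' : ∀ u y, K ⊆ K' u y := by
    intro u y w hw
    simp [hK', hw]
  refine ⟨I3, K', ?_, ?_⟩
  · intro u hu y _
    refine ⟨?_, by simp [hK'], fun w hw => by simp [hK', hw], ?_⟩
    · rw [Info.explored_cons]
      refine Finset.insert_subset hx (Finset.insert_subset hu (Finset.insert_subset haN hsub))
    · intro w hw
      rw [Info.explored_cons] at hw
      simp only [Finset.mem_insert, ← ha, ← hH] at hw
      refine ⟨?_, ?_⟩
      · by_cases hwx : w = x
        · subst hwx; simp [hI3]
        · simp only [hI3, Function.update_of_ne hwx]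
          exact hI2' u w (by tauto)
      · have hP : ∀ w', w' = u ∨ w' = a ∨ w' = x → G.parents w' ⊆ K' u y := by
          rintro w' (rfl | rfl | rfl) b hb <;> simp [hK', hb]
        have hC : ∀ w', w' = u ∨ w' = a ∨ w' = x → G.children w' ⊆ K' u y := by
          rintro w' (rfl | rfl | rfl) b hb <;> simp [hK', hb]
        rcases hw with hw | hw | hw | hw
        · exact ⟨hKK' u y (hw ▸ hxK), hP w (by tauto), hC w (by tauto)⟩
        · exact ⟨by simp [hK', hw], hP w (by tauto), hC w (by tauto)⟩
        · exact ⟨hKK' u y (hw ▸ haK), hP w (by tauto), hC w (by tauto)⟩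
        · exact ⟨hKK' u y (hK w hw).1, (hK w hw).2.1.trans (hKK' u y),
            (hK w hw).2.2.trans (hKK' u y)⟩
  · have hn' : verdict v (I.tally α v h) = none := by
      rw [Info.tally_congr hI]
      exact hn
    rw [fiveSteps, step_idle hn']
    simp only [PMF.bind_bind, PMF.pure_bind]
    refine congrArg _ (funext fun u => ?_)
    rw [step_drawn]
    simp only [PMF.bind_bind, PMF.pure_bind]
    refine congrArg _ (funext fun y => ?_)
    rw [step_exploreDrawn (by simp), PMF.pure_bind,
      step_exploreTarget (a := a) (by rw [Info.tally_congr (hI1' u)]) (by simp [haK]),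
      PMF.pure_bind, step_move (by simp [hxK])]

/-- Functions of history and position alone see a Markov chain; the internal information and the set
of known nodes no longer matter. -/
theorem expect_fiveSteps {v : ℕ} {h : List (ℕ × ℕ)} {x : ℕ} {c : SearchState × Finset ℕ}
    (hr : Ready α G v h x c) {Φ : SearchState × Finset ℕ → ℝ≥0∞}
    {φ : List (ℕ × ℕ) → ℕ → ℝ≥0∞} (hΦ : ∀ v h I x K, Φ (.idle v h I x, K) = φ h x) :
    (fiveSteps (search α h0 h1 verdict) G c).expect Φ = succExpect α verdict G v φ h x := by
  obtain ⟨s, K⟩ := c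
  obtain ⟨I, hs, hI⟩ := hr.state
  obtain rfl : s = .idle v h I x := hs
  unfold succExpect
  by_cases hn : verdict v (G.info.tally α v h) = none
  · rw [if_pos hn]
    obtain ⟨I', K', -, h3⟩ := fiveSteps_eq (h0 := h0) (h1 := h1) hr hn
    rw [h3]
    simp only [PMF.expect_bind]
    congr 1
    ext u : 1
    congr 1
    ext y : 1
    rw [PMF.expect_coin]
    simp only [if_true, Bool.false_eq_true, if_false, PMF.expect_pure, hΦ]
    by_cases hc : (G.children x).Nonempty
    · simp only [hc, dif_pos, PMF.expect_bind, PMF.expect_pure, hΦ]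
    · simp only [hc, dif_neg, not_false_eq_true, PMF.expect_pure, hΦ]
  · obtain ⟨r, hr'⟩ := Option.ne_none_iff_exists'.1 hn
    rw [if_neg hn, fiveSteps_of_output (r := r), PMF.expect_pure, hΦ]
    rw [act_idle, Info.tally_congr hI, hr']
    rfl

theorem ready_fiveSteps {v : ℕ} {h : List (ℕ × ℕ)} {x : ℕ} {c c' : SearchState × Finset ℕ}
    (hr : Ready α G v h x c) (hc : c' ∈ (fiveSteps (search α h0 h1 verdict) G c).support) :
    ∃ h' x', Ready α G v h' x' c' := by
  obtain ⟨s, K⟩ := c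
  obtain ⟨I, hs, hI⟩ := hr.state
  obtain rfl : s = .idle v h I x := hs
  by_cases hn : verdict v (G.info.tally α v h) = none
  · obtain ⟨I', K', h2, h3⟩ := fiveSteps_eq (h0 := h0) (h1 := h1) hr hn
    rw [h3] at hc
    simp only [PMF.mem_support_bind_iff, PMF.mem_support_uniformOfFinset_iff] at hc
    obtain ⟨u, hu, y, hy, b, -, hb⟩ := hc
    obtain ⟨h4, h5, h6, h7⟩ := h2 u hu y hy
    have h8 := fun w hw => h7 w (G.info.explored_subset_cons α v (x, u) h hw)
    cases b
    · simp only [Bool.false_eq_true, if_false, PMF.mem_support_pure_iff] at hb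
      subst hb
      exact ⟨(x, u) :: h, y, hy, h4, ⟨I' u, rfl, fun w hw => (h7 w hw).1⟩, h5,
        fun w hw => (h7 w hw).2⟩
    · simp only [if_true] at hb
      by_cases hch : (G.children x).Nonempty
      · simp only [hch, dif_pos, PMF.mem_support_bind_iff, PMF.mem_support_uniformOfFinset_iff,
          PMF.mem_support_pure_iff] at hb
        obtain ⟨z, hz, rfl⟩ := hb
        exact ⟨h, z, G.children_subset x hz, hr.explored_subset,
          ⟨I' u, rfl, fun w hw => (h8 w hw).1⟩, h6 hz, fun w hw => (h8 w hw).2⟩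
      · simp only [hch, dif_neg, not_false_eq_true, PMF.mem_support_pure_iff] at hb
        subst hb
        exact ⟨h, y, hy, hr.explored_subset,
          ⟨I' u, rfl, fun w hw => (h8 w hw).1⟩, h5, fun w hw => (h8 w hw).2⟩
  · obtain ⟨r, hr'⟩ := Option.ne_none_iff_exists'.1 hn
    rw [fiveSteps_of_output (r := r), PMF.mem_support_pure_iff] at hc
    · exact ⟨h, x, hc ▸ hr⟩
    · rw [act_idle, Info.tally_congr hI, hr']
      rfl

theorem run_two (v : ℕ) :
    ∃ (I : Info) (K : ℕ → Finset ℕ), (∀ x, v ∈ G.nodes → x ∈ G.nodes →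
        Ready α G v [] x (.idle v [] I x, K x)) ∧
      (search α h0 h1 verdict).run G v 2
        = (PMF.uniformOfFinset G.nodes G.nonempty).bind fun x =>
          PMF.pure (.idle v [] I x, K x) := by
  refine ⟨Function.update (fun _ => (∅, ∅)) v (G.info v),
    fun x => insert x ({v} ∪ G.parents v ∪ G.children v), ?_, ?_⟩
  · intro x hv hx
    refine ⟨hx, by simpa [Info.explored_nil] using hv, ⟨_, rfl, ?_⟩, by simp, ?_⟩
    · simp [Info.explored_nil]
    · intro u hu
      obtain rfl : u = v := by simpa [Info.explored_nil] using hu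
      refine ⟨by simp, fun w hw => by simp [hw], fun w hw => by simp [hw]⟩
  · simp only [QueryAlgorithm.run, QueryAlgorithm.step, search, PMF.pure_map, PMF.pure_bind,
      Finset.mem_singleton, if_true, IdGraph.info]

theorem ready_run {v : ℕ} (hv : v ∈ G.nodes) (t : ℕ) :
    ∀ c ∈ ((search α h0 h1 verdict).run G v (2 + 5 * t)).support,
      ∃ h x, Ready α G v h x c := by
  induction t with
  | zero =>
    intro c hc
    obtain ⟨I, K, h2, h3⟩ := run_two (α := α) (h0 := h0) (h1 := h1) (verdict := verdict)
      (G := G) v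
    rw [mul_zero, add_zero, h3] at hc
    simp only [PMF.mem_support_bind_iff, PMF.mem_support_uniformOfFinset_iff,
      PMF.mem_support_pure_iff] at hc
    obtain ⟨x, hx, rfl⟩ := hc
    exact ⟨[], x, h2 x hv hx⟩
  | succ t ih =>
    intro c hc
    rw [show 2 + 5 * (t + 1) = 2 + 5 * t + 5 by ring, run_add_five,
      PMF.mem_support_bind_iff] at hc
    obtain ⟨c₀, hc₀, hc⟩ := hc
    obtain ⟨h, x, hr⟩ := ih c₀ hc₀
    exact ready_fiveSteps hr hc

/-- The history and the position of the surfer. -/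
def track (φ : List (ℕ × ℕ) → ℕ → ℝ≥0∞) : SearchState × Finset ℕ → ℝ≥0∞
  | (.idle _ h _ x, _) => φ h x
  | _ => 0

/-- Iterate the one-step inequality. The first two queries explore v and put the surfer at a uniform
node, whence the average over x. -/
theorem expect_run_le {v : ℕ} (hv : v ∈ G.nodes) {φ : List (ℕ × ℕ) → ℕ → ℝ≥0∞} {ρ : ℝ≥0∞}
    (hφ : ∀ h, ∀ x ∈ G.nodes, G.info.explored α v h ⊆ G.nodes →
      succExpect α verdict G v φ h x ≤ ρ * φ h x) (t : ℕ) :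
    ((search α h0 h1 verdict).run G v (2 + 5 * t)).expect (track φ)
      ≤ ρ ^ t * (PMF.uniformOfFinset G.nodes G.nonempty).expect fun x => φ [] x := by
  induction t with
  | zero =>
    obtain ⟨I, K, h2, h3⟩ := run_two (α := α) (h0 := h0) (h1 := h1) (verdict := verdict)
      (G := G) v
    rw [mul_zero, add_zero, h3, PMF.expect_bind]
    simp [PMF.expect_pure, track]
  | succ t ih =>
    rw [show 2 + 5 * (t + 1) = 2 + 5 * t + 5 by ring, run_add_five, PMF.expect_bind]
    calc _ ≤ ((search α h0 h1 verdict).run G v (2 + 5 * t)).expect fun c => ρ * track φ c := by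
          refine PMF.expect_mono fun c hc => ?_
          obtain ⟨h, x, hr⟩ := ready_run hv t c hc
          have h4 : track φ c = φ h x := by
            obtain ⟨s, K⟩ := c
            obtain ⟨I, hs, -⟩ := hr.state
            obtain rfl : s = .idle v h I x := hs
            rfl
          rw [expect_fiveSteps (φ := φ) hr fun _ _ _ _ _ => rfl, h4]
          exact hφ h x hr.pos_mem hr.explored_subset
      _ ≤ _ := by
          rw [PMF.expect_const_mul, pow_succ', mul_assoc]
          gcongr

end search

namespace QueryAlgorithm

variable (A : QueryAlgorithm) (G : IdGraph)

theorem outputProb_le_succ (v q : ℕ) (S : Set ℝ) :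
    A.outputProb G v q S ≤ A.outputProb G v (q + 1) S := by
  unfold outputProb
  rw [PMF.toOuterMeasure_eq_expect, PMF.toOuterMeasure_eq_expect, run, PMF.expect_bind]
  refine PMF.expect_mono fun c _ => ?_
  by_cases hc : c ∈ {c : A.State × Finset ℕ | ∃ x ∈ S, A.act c.1 = QueryAction.output x}
  · obtain ⟨x, -, hx⟩ := id hc
    have : A.step G c = PMF.pure c := by simp [step, hx]
    rw [this, PMF.expect_pure]
  · simp [hc]

theorem outputProb_mono (v : ℕ) (S : Set ℝ) : Monotone fun q => A.outputProb G v q S :=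
  monotone_nat_of_le_succ fun q => A.outputProb_le_succ G v q S

end QueryAlgorithm
end

/-! ### Supermartingale bounds for the history of the search. -/

noncomputable section

namespace search

variable {α : ℝ} {h0 : 0 ≤ α} {h1 : α ≤ 1} {verdict : ℕ → Tally → Option ℝ} {G : IdGraph}

theorem explored_cons_subset {v : ℕ} {h : List (ℕ × ℕ)} {w u : ℕ}
    (hsub : G.info.explored α v h ⊆ G.nodes) (hw : w ∈ G.nodes) (hu : u ∈ G.nodes) :
    G.info.explored α v ((w, u) :: h) ⊆ G.nodes := by
  rw [Info.explored_cons]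
  have hS : (G.info.tally α v h).view.Sees G := by
    rw [Info.tally_view]
    exact G.sees_view hsub
  exact Finset.insert_subset hw (Finset.insert_subset hu
    (Finset.insert_subset (hS.target_mem (hsub (Info.mem_explored h))) hsub))

/-- The node y serves both as destination from a dangling node and as start of the next round. At
most one of these uses occurs in a step, so y is uniform in either case. -/
theorem succExpect_ofReal (h0 : 0 ≤ α) (h1 : α ≤ 1) {v : ℕ} {h : List (ℕ × ℕ)} {x : ℕ}
    {f : List (ℕ × ℕ) → ℕ → ℝ}
    (hn : verdict v (G.info.tally α v h) = none) (hf : ∀ y ∈ G.nodes, 0 ≤ f h y)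
    (hf' : ∀ u ∈ G.nodes, ∀ y ∈ G.nodes, 0 ≤ f ((x, u) :: h) y) :
    succExpect α verdict G v (fun h x => ENNReal.ofReal (f h x)) h x
      = ENNReal.ofReal (α * G.stepAvg (f h) x
          + (1 - α) * G.avg fun u => G.avg (f ((x, u) :: h))) := by
  have h2 : 0 ≤ 1 - α := by linarith
  set m : ℕ → ℝ := fun y => if (G.children x).Nonempty then
    (∑ z ∈ G.children x, f h z) / (G.children x).card else f h y with hm
  have hm0 : ∀ y ∈ G.nodes, 0 ≤ m y := by
    intro y hy
    simp only [hm]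
    split_ifs
    · exact div_nonneg (Finset.sum_nonneg fun z hz => hf z (G.children_subset x hz))
        (Nat.cast_nonneg _)
    · exact hf y hy
  have h3 : ∀ y, (if hc : (G.children x).Nonempty then
      (PMF.uniformOfFinset (G.children x) hc).expect fun z => ENNReal.ofReal (f h z)
      else ENNReal.ofReal (f h y)) = ENNReal.ofReal (m y) := by
    intro y
    simp only [hm]
    split_ifs with hc
    · exact PMF.expect_uniformOfFinset_ofReal _ _ _ fun z hz => hf z (G.children_subset x hz)
    · rfl
  have h4 : G.avg m = G.stepAvg (f h) x := by
    simp only [hm, IdGraph.stepAvg, IdGraph.outdegree]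
    by_cases hc : G.children x = ∅
    · simp [hc]
    · simp only [Finset.nonempty_iff_ne_empty, ne_eq, hc, not_false_eq_true, if_true, if_false]
      exact G.avg_const _
  have h5 : ∀ u ∈ G.nodes, 0 ≤ G.avg fun y => α * m y + (1 - α) * f ((x, u) :: h) y := by
    intro u hu
    refine div_nonneg (Finset.sum_nonneg fun y hy => ?_) (Nat.cast_nonneg _)
    have := hm0 y hy
    have := hf' u hu y hy
    positivity
  have h6 : ∀ u ∈ G.nodes, ((PMF.uniformOfFinset G.nodes G.nonempty).expect fun y =>
      ENNReal.ofReal α * (if hc : (G.children x).Nonempty then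
      (PMF.uniformOfFinset (G.children x) hc).expect fun z => ENNReal.ofReal (f h z)
      else ENNReal.ofReal (f h y)) + ENNReal.ofReal (1 - α) * ENNReal.ofReal (f ((x, u) :: h) y))
      = ENNReal.ofReal (G.avg fun y => α * m y + (1 - α) * f ((x, u) :: h) y) := by
    intro u hu
    rw [IdGraph.avg, IdGraph.size, ← PMF.expect_uniformOfFinset_ofReal _ G.nonempty]
    · refine PMF.expect_congr fun y hy => ?_
      rw [PMF.mem_support_uniformOfFinset_iff] at hy
      have := hm0 y hy
      have := hf' u hu y hy
      rw [h3, ← ENNReal.ofReal_mul h0, ← ENNReal.ofReal_mul h2,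
        ← ENNReal.ofReal_add (by positivity) (by positivity)]
    · intro y hy
      have := hm0 y hy
      have := hf' u hu y hy
      positivity
  unfold succExpect
  rw [if_pos hn, PMF.expect_congr fun u hu =>
    h6 u (by rwa [PMF.mem_support_uniformOfFinset_iff] at hu),
    PMF.expect_uniformOfFinset_ofReal _ _ _ h5]
  congr 1
  change G.avg _ = _
  simp only [IdGraph.avg_add, IdGraph.avg_mul, IdGraph.avg_const, h4]

/-- The product of predictable weights. -/
def weightProd (w : List (ℕ × ℕ) → ℕ → ℕ → ℝ) : List (ℕ × ℕ) → ℝ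
  | [] => 1
  | r :: h => w h r.1 r.2 * weightProd w h

/-- The configurations with a history for which `p` holds. -/
def event (α : ℝ) (G : IdGraph) (v : ℕ) (p : List (ℕ × ℕ) → Prop) :
    Set (SearchState × Finset ℕ) :=
  {c | ∃ h x, Ready α G v h x c ∧ p h}

theorem track_of_ready {v : ℕ} {h : List (ℕ × ℕ)} {x : ℕ} {c : SearchState × Finset ℕ}
    (hr : Ready α G v h x c) (φ : List (ℕ × ℕ) → ℕ → ℝ≥0∞) : track φ c = φ h x := by
  obtain ⟨s, K⟩ := c
  obtain ⟨I, hs, -⟩ := hr.state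
  obtain rfl : s = .idle v h I x := hs
  rfl

/-- A bound for the probability of an event on which a supermartingale is large. -/
theorem event_le {v : ℕ} (hv : v ∈ G.nodes) {f : List (ℕ × ℕ) → ℕ → ℝ} {ρ b : ℝ} (hρ : 0 ≤ ρ)
    (hb : 0 < b)
    (hf : ∀ h, ∀ x ∈ G.nodes, G.info.explored α v h ⊆ G.nodes →
      succExpect α verdict G v (fun h x => ENNReal.ofReal (f h x)) h x
        ≤ ENNReal.ofReal ρ * ENNReal.ofReal (f h x))
    (hnil : ∀ x ∈ G.nodes, 0 ≤ f [] x) (hnil' : G.avg (f []) ≤ 1)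
    {p : List (ℕ × ℕ) → Prop}
    (hp : ∀ h, ∀ x ∈ G.nodes, G.info.explored α v h ⊆ G.nodes → p h → b ≤ f h x) (t : ℕ) :
    ((search α h0 h1 verdict).run G v (2 + 5 * t)).toOuterMeasure (event α G v p)
      ≤ ENNReal.ofReal (ρ ^ t / b) := by
  rw [PMF.toOuterMeasure_eq_expect]
  refine PMF.expect_indicator_le (φ := track fun h x => ENNReal.ofReal (f h x))
    (a := ENNReal.ofReal (1 / b)) ?_ ?_
  · rintro c - ⟨h, x, hr, hph⟩
    rw [track_of_ready hr, ← ENNReal.ofReal_mul (by positivity), ENNReal.one_le_ofReal]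
    have := hp h x hr.pos_mem hr.explored_subset hph
    rw [one_div, inv_mul_eq_div, one_le_div hb]
    exact this
  · have h2 := expect_run_le (h0 := h0) (h1 := h1) hv hf t
    have h3 : ((PMF.uniformOfFinset G.nodes G.nonempty).expect
        fun x => ENNReal.ofReal (f [] x)) ≤ 1 := by
      rw [PMF.expect_uniformOfFinset_ofReal _ _ _ hnil, ENNReal.ofReal_le_one]
      exact hnil'
    calc _ ≤ ENNReal.ofReal (1 / b) * (ENNReal.ofReal ρ ^ t * 1) := by
          gcongr
          exact h2.trans (by gcongr)
      _ = _ := by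
          rw [mul_one, ← ENNReal.ofReal_pow hρ, ← ENNReal.ofReal_mul (by positivity)]
          congr 1
          ring

/-- The product of predictable weights with conditional expectation at most one is unlikely to be
large. -/
theorem event_weight_le (hα1 : α < 1) {v : ℕ} (hv : v ∈ G.nodes)
    {w : List (ℕ × ℕ) → ℕ → ℕ → ℝ} {c b : ℝ} (hc : 0 < c) (hb : 0 < b)
    (hw : ∀ h, ∀ x ∈ G.nodes, ∀ u ∈ G.nodes, G.info.explored α v h ⊆ G.nodes → c ≤ w h x u)
    (hmean : ∀ h, G.info.explored α v h ⊆ G.nodes →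
      ∑ x ∈ G.nodes, G.rank α x * G.avg (w h x) ≤ 1)
    (hpos : ∀ h, 0 ≤ weightProd w h)
    {p : List (ℕ × ℕ) → Prop}
    (hp : ∀ h, G.info.explored α v h ⊆ G.nodes → p h → b ≤ weightProd w h) (t : ℕ) :
    ((search α h0 h1 verdict).run G v (2 + 5 * t)).toOuterMeasure (event α G v p)
      ≤ ENNReal.ofReal (1 / (c * b)) := by
  -- F h x is the expected weight of the current round, given that the surfer is at x.
  have hF : ∀ h, ∃ F : ℕ → ℝ, G.info.explored α v h ⊆ G.nodes →
      (∀ x ∈ G.nodes, c ≤ F x ∧ F x = (1 - α) * G.avg (w h x) + α * G.stepAvg F x) ∧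
      G.avg F = ∑ x ∈ G.nodes, G.rank α x * G.avg (w h x) := by
    intro h
    by_cases hsub : G.info.explored α v h ⊆ G.nodes
    · obtain ⟨F, hF⟩ := G.exists_walk_value h0 hα1 (φ := fun x => G.avg (w h x)) (c := c)
        fun x hx => by
          rw [← G.avg_const c]
          exact G.avg_mono fun u hu => hw h x hx u hu hsub
      exact ⟨F, fun _ => hF⟩
    · exact ⟨0, fun h => absurd h hsub⟩
  choose F hF using hF
  have hF0 : ∀ h, G.info.explored α v h ⊆ G.nodes → ∀ x ∈ G.nodes, 0 ≤ F h x :=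
    fun h hsub x hx => hc.le.trans ((hF h hsub).1 x hx).1
  have hsubnil : G.info.explored α v [] ⊆ G.nodes := by simpa [Info.explored_nil] using hv
  rw [show 1 / (c * b) = 1 ^ t / (c * b) by rw [one_pow]]
  -- Within a round the factor F is harmonic. When the round ends it becomes the weight, and the F
  -- of the next round has average at most 1. The bound F ≥ c accounts for the unfinished round.
  refine event_le (f := fun h x => weightProd w h * F h x) hv zero_le_one (by positivity)
    ?_ ?_ ?_ ?_ t
  · intro h x hx hsub
    rw [ENNReal.ofReal_one, one_mul]
    by_cases hn : verdict v (G.info.tally α v h) = none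
    · rw [succExpect_ofReal h0 h1 hn]
      · refine ENNReal.ofReal_le_ofReal ?_
        simp only [IdGraph.avg_mul, IdGraph.stepAvg_mul]
        have h2 : (G.avg fun u => weightProd w ((x, u) :: h) * G.avg (F ((x, u) :: h)))
            ≤ weightProd w h * G.avg (w h x) := by
          rw [← G.avg_mul]
          refine G.avg_mono fun u hu => ?_
          have hsub' := explored_cons_subset hsub hx hu
          have h3 := (hF _ hsub').2.trans_le (hmean _ hsub')
          calc _ ≤ weightProd w ((x, u) :: h) * 1 := by
                gcongr
                exact hpos _
            _ = weightProd w h * w h x u := by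
                rw [mul_one, weightProd, mul_comm]
        have h3 := ((hF h hsub).1 x hx).2
        calc _ ≤ α * (weightProd w h * G.stepAvg (F h) x)
              + (1 - α) * (weightProd w h * G.avg (w h x)) := by gcongr
          _ = weightProd w h * ((1 - α) * G.avg (w h x) + α * G.stepAvg (F h) x) := by ring
          _ = _ := by rw [← h3]
      · exact fun y hy => mul_nonneg (hpos h) (hF0 h hsub y hy)
      · exact fun u hu y hy => mul_nonneg (hpos _)
          (hF0 _ (explored_cons_subset hsub hx hu) y hy)
    · rw [succExpect, if_neg hn]
  · exact fun x hx => mul_nonneg (hpos _) (hF0 _ hsubnil x hx)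
  · simp only [weightProd, one_mul]
    exact (hF _ hsubnil).2.trans_le (hmean _ hsubnil)
  · intro h x hx hsub hph
    rw [mul_comm c b]
    exact mul_le_mul (hp h hsub hph) ((hF h hsub).1 x hx).1 hc.le (hpos h)

/-- It is unlikely that there are few rounds in many steps. -/
theorem event_rounds_le {v : ℕ} (hv : v ∈ G.nodes) (m t : ℕ) :
    ((search α h0 h1 verdict).run G v (2 + 5 * t)).toOuterMeasure
      (event α G v fun h => verdict v (G.info.tally α v h) = none ∧ h.length ≤ m)
      ≤ ENNReal.ofReal (((1 + α) / 2) ^ t * 2 ^ m) := by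
  classical
  -- Each step before halting contracts the expectation by at least α + (1 - α) / 2 = (1 + α) / 2.
  -- The indicator is needed since a halted search makes no further rounds.
  set f : List (ℕ × ℕ) → ℕ → ℝ := fun h _ =>
    if verdict v (G.info.tally α v h) = none then (1 / 2) ^ h.length else 0 with hf
  have hf0 : ∀ h x, 0 ≤ f h x := by
    intro h x
    simp only [hf]
    split_ifs <;> positivity
  have hf1 : ∀ h x, f h x ≤ (1 / 2) ^ h.length := by
    intro h x
    simp only [hf]
    split_ifs
    · exact le_rfl
    · positivity
  have h2 : ((1 + α) / 2) ^ t * 2 ^ m = ((1 + α) / 2) ^ t / (1 / 2 : ℝ) ^ m := by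
    rw [one_div, inv_pow, div_inv_eq_mul]
  rw [h2]
  refine event_le (f := f) hv (by linarith) (by positivity) ?_ (fun x _ => hf0 _ x) ?_ ?_ t
  · intro h x hx hsub
    by_cases hn : verdict v (G.info.tally α v h) = none
    · rw [succExpect_ofReal h0 h1 hn (fun y _ => hf0 h y) (fun u _ y _ => hf0 _ y),
        ← ENNReal.ofReal_mul (by linarith)]
      refine ENNReal.ofReal_le_ofReal ?_
      have h3 : f h = fun _ => (1 / 2) ^ h.length := by
        ext y
        simp [hf, hn]
      have h4 : (G.avg fun u => G.avg (f ((x, u) :: h))) ≤ (1 / 2) ^ (h.length + 1) := by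
        rw [← G.avg_const ((1 / 2) ^ (h.length + 1))]
        refine G.avg_mono fun u _ => ?_
        rw [← G.avg_const ((1 / 2) ^ (h.length + 1))]
        exact G.avg_mono fun y _ => hf1 _ y
      rw [h3, G.stepAvg_const]
      have h5 : 0 ≤ 1 - α := by linarith
      calc _ ≤ α * (1 / 2) ^ h.length + (1 - α) * (1 / 2) ^ (h.length + 1) := by gcongr
        _ = _ := by ring
    · rw [succExpect, if_neg hn]
      simp [hf, hn]
  · rw [← G.avg_const 1]
    refine G.avg_mono fun x _ => (hf1 [] x).trans ?_
    simp
  · rintro h x - - ⟨hn, hm⟩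
    simp only [hf, hn, if_true]
    exact pow_le_pow_of_le_one (by norm_num) (by norm_num) hm

end search
end

/-! ### Exponential inequalities, exploration by sampling, and deviations of the hits. -/

noncomputable section

theorem exp_sub_sq_le {μ : ℝ} (h1 : -(1 / 2) ≤ μ) (h2 : μ ≤ 1 / 2) :
    Real.exp (μ - μ ^ 2) ≤ 1 + μ := by
  rcases le_total 0 μ with h | h
  · have h3 : |μ - μ ^ 2| ≤ 1 := by
      rw [abs_le]
      constructor <;> nlinarith
    have h4 := (abs_le.1 (Real.abs_exp_sub_one_sub_id_le h3)).2
    have h5 : (μ - μ ^ 2) ^ 2 ≤ μ ^ 2 := by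
      apply pow_le_pow_left₀ <;> nlinarith
    linarith
  · obtain ⟨ν, rfl⟩ : ∃ ν, μ = -ν := ⟨-μ, by ring⟩
    have h4 : 0 ≤ ν := by linarith
    have h5 := Real.quadratic_le_exp_of_nonneg (x := ν + ν ^ 2) (by positivity)
    have h6 : 1 ≤ (1 - ν) * Real.exp (ν + ν ^ 2) := by
      calc (1 : ℝ) ≤ (1 - ν) * (1 + (ν + ν ^ 2) + (ν + ν ^ 2) ^ 2 / 2) := by
            have h8 : 0 ≤ (1 - ν) * (1 + ν) ^ 2 / 2 - ν := by
              nlinarith [mul_nonneg h4 h4, mul_nonneg h4 (show 0 ≤ 1 / 2 - ν by linarith)]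
            have h9 := mul_nonneg (mul_nonneg h4 h4) h8
            nlinarith
        _ ≤ _ := by
            gcongr
            linarith
    rw [show -ν - (-ν) ^ 2 = -(ν + ν ^ 2) by ring, Real.exp_neg,
      inv_le_iff_one_le_mul₀ (Real.exp_pos _)]
    linarith

/-- The graph of a convex function on [0, 1] lies below its chord. -/
theorem exp_mul_le {s z : ℝ} (h0 : 0 ≤ z) (h1 : z ≤ 1) :
    Real.exp (s * z) ≤ 1 + (Real.exp s - 1) * z := by
  have h := convexOn_exp.2 (Set.mem_univ 0) (Set.mem_univ s) (show 0 ≤ 1 - z by linarith) h0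
    (by ring)
  simp only [smul_eq_mul, mul_zero, zero_add, Real.exp_zero, mul_one] at h
  rw [mul_comm s]
  linarith

/-- A Bernstein bound in terms of the variable instead of its variance. -/
theorem exp_sub_sq_mul_le {μ z : ℝ} (h1 : -(1 / 2) ≤ μ) (h2 : μ ≤ 1 / 2) (h3 : 0 ≤ z)
    (h4 : z ≤ 1) : Real.exp (μ * z - μ ^ 2 * z) ≤ 1 + μ * z := by
  rw [← sub_mul]
  refine (exp_mul_le h3 h4).trans ?_
  have := exp_sub_sq_le h1 h2
  nlinarith

namespace Tally

/-- Either quantity can normalize the deviation: the hits serve when the mass is large, the noise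
when the graph is small. -/
def noiseOf (T : Tally) (f : Bool) : ℝ := if f then T.noise else T.hits

end Tally

namespace search

variable {α : ℝ} {h0 : 0 ≤ α} {h1 : α ≤ 1} {verdict : ℕ → Tally → Option ℝ} {G : IdGraph}

/-- The history has its last round first, so a suffix consists of early rounds. Weights that are 1
from round N on allow statements about the first N rounds at any later time. -/
theorem weightProd_suffix {w : List (ℕ × ℕ) → ℕ → ℕ → ℝ} {N : ℕ}
    (hw : ∀ h x u, N ≤ h.length → w h x u = 1) {h' h : List (ℕ × ℕ)} (hs : h' <:+ h)
    (hN : N ≤ h'.length) : weightProd w h = weightProd w h' := by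
  induction h with
  | nil => rw [List.suffix_nil.1 hs]
  | cons r h ih =>
    rcases List.suffix_cons_iff.1 hs with rfl | hs
    · rfl
    · rw [weightProd, hw h _ _ (hN.trans hs.length_le), one_mul, ih hs]

theorem weightProd_nonneg {w : List (ℕ × ℕ) → ℕ → ℕ → ℝ} (hw : ∀ h x u, 0 ≤ w h x u)
    (h : List (ℕ × ℕ)) : 0 ≤ weightProd w h := by
  induction h with
  | nil => exact zero_le_one
  | cons r h ih => exact mul_nonneg (hw _ _ _) ih

/-- It is unlikely that few nodes of `D` are explored in the first `N` rounds. -/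
theorem event_explored_le (hα1 : α < 1) {v : ℕ} (hv : v ∈ G.nodes) {D : Finset ℕ}
    (hD : D ⊆ G.nodes) {k : ℕ} (hk : 2 * k ≤ D.card + 2) (N t : ℕ) :
    ((search α h0 h1 verdict).run G v (2 + 5 * t)).toOuterMeasure
      (event α G v fun h => ∃ h', h' <:+ h ∧ h'.length = N ∧
        (D ∩ G.info.explored α v h').card < k)
      ≤ ENNReal.ofReal (2 * 2 ^ k * Real.exp (-(N * D.card / (4 * G.size)))) := by
  classical
  have hn : (0 : ℝ) < G.size := by exact_mod_cast G.size_pos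
  have hDn : (D.card : ℝ) ≤ G.size := by exact_mod_cast Finset.card_le_card hD
  -- While fewer than k nodes of D are explored, at least half of D is not, by `hk`. Then halving
  -- the weight at each hit of a new node of D costs at least y on average, which the factor 1 / (1
  -- - y) compensates.
  set y : ℝ := D.card / (4 * G.size) with hy
  have hy0 : 0 ≤ y := by positivity
  have hy1 : y ≤ 1 / 4 := by
    rw [hy, div_le_iff₀ (by positivity)]
    linarith
  have hy2 : 0 < 1 - y := by linarith
  set w : List (ℕ × ℕ) → ℕ → ℕ → ℝ := fun h _ u =>
    if h.length < N ∧ (D ∩ G.info.explored α v h).card < k then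
      (if u ∈ D \ G.info.explored α v h then 1 / 2 else 1) / (1 - y) else 1 with hw
  have hwlow : ∀ h x u, 1 / 2 ≤ w h x u := by
    intro h x u
    simp only [hw]
    split_ifs
    · rw [le_div_iff₀ hy2]
      linarith
    · rw [le_div_iff₀ hy2]
      linarith
    · norm_num
  have hw0 : ∀ h x u, 0 ≤ w h x u := fun h x u => le_trans (by norm_num) (hwlow h x u)
  have hprod : ∀ h, h.length ≤ N → (D ∩ G.info.explored α v h).card < k →
      (1 / 2 : ℝ) ^ (D ∩ G.info.explored α v h).card * Real.exp (y * h.length)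
        ≤ weightProd w h := by
    intro h
    induction h with
    | nil =>
      intro _ _
      simp only [List.length_nil, Nat.cast_zero, mul_zero, Real.exp_zero, mul_one, weightProd]
      exact pow_le_one₀ (by norm_num) (by norm_num)
    | cons r h ih =>
      intro hN hcard
      have hsub := G.info.explored_subset_cons α v r h
      have hsub' : D ∩ G.info.explored α v h ⊆ D ∩ G.info.explored α v (r :: h) :=
        Finset.inter_subset_inter_left hsub
      have hc := Finset.card_le_card hsub'
      have hN' : h.length < N := by simpa using hN
      have ih := ih hN'.le (hc.trans_lt hcard)
      have h2 : (1 / 2 : ℝ) ^ (D ∩ G.info.explored α v (r :: h)).card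
          ≤ (if r.2 ∈ D \ G.info.explored α v h then 1 / 2 else 1)
            * (1 / 2) ^ (D ∩ G.info.explored α v h).card := by
        split_ifs with hu
        · rw [← pow_succ']
          refine pow_le_pow_of_le_one (by norm_num) (by norm_num) ?_
          rw [Finset.mem_sdiff] at hu
          have h3 : insert r.2 (D ∩ G.info.explored α v h)
              ⊆ D ∩ G.info.explored α v (r :: h) := by
            refine Finset.insert_subset ?_ hsub'
            simp [hu.1, Info.explored_cons]
          have h4 := Finset.card_le_card h3
          rwa [Finset.card_insert_of_notMem (by simp [hu.2])] at h4
        · rw [one_mul]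
          exact pow_le_pow_of_le_one (by norm_num) (by norm_num) hc
      have h3 : Real.exp y ≤ 1 / (1 - y) := by
        rw [le_div_iff₀ hy2]
        have := Real.add_one_le_exp (-y)
        calc Real.exp y * (1 - y) ≤ Real.exp y * Real.exp (-y) := by
              gcongr
              linarith
          _ = 1 := by rw [← Real.exp_add]; simp
      rw [weightProd]
      have h5 : w h r.1 r.2 = (if r.2 ∈ D \ G.info.explored α v h then 1 / 2 else 1)
          * (1 / (1 - y)) := by
        simp only [hw]
        rw [if_pos ⟨hN', hc.trans_lt hcard⟩]
        ring
      rw [h5]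
      have h6 : (0 : ℝ) ≤ if r.2 ∈ D \ G.info.explored α v h then 1 / 2 else 1 := by
        split_ifs <;> norm_num
      calc _ = (1 / 2 : ℝ) ^ (D ∩ G.info.explored α v (r :: h)).card
            * (Real.exp y * Real.exp (y * h.length)) := by
            rw [← Real.exp_add, List.length_cons]
            push_cast
            ring_nf
        _ ≤ ((if r.2 ∈ D \ G.info.explored α v h then 1 / 2 else 1)
            * (1 / 2) ^ (D ∩ G.info.explored α v h).card)
            * (1 / (1 - y) * Real.exp (y * h.length)) := by gcongr
        _ = ((if r.2 ∈ D \ G.info.explored α v h then 1 / 2 else 1) * (1 / (1 - y)))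
            * ((1 / 2) ^ (D ∩ G.info.explored α v h).card * Real.exp (y * h.length)) := by ring
        _ ≤ _ := by gcongr
  have hfin : 2 * 2 ^ k * Real.exp (-(N * D.card / (4 * G.size)))
      = 1 / (1 / 2 * ((1 / 2 : ℝ) ^ k * Real.exp (y * N))) := by
    rw [show -(N * D.card / (4 * G.size)) = -(y * N) by rw [hy]; ring, Real.exp_neg]
    have := Real.exp_pos (y * N)
    rw [one_div_pow]
    field_simp
  rw [hfin]
  refine event_weight_le (w := w) hα1 hv (by norm_num) (by positivity)
    (fun h x _ u _ _ => hwlow h x u) ?_ (weightProd_nonneg hw0) ?_ t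
  · intro h hsub
    have h2 : ∀ x, G.avg (w h x) ≤ 1 := by
      intro x
      simp only [hw]
      split_ifs with hc
      · have h3 : G.avg (fun u => (if u ∈ D \ G.info.explored α v h then (1 / 2 : ℝ) else 1)
            / (1 - y)) = (1 - (D \ G.info.explored α v h).card / (2 * G.size)) / (1 - y) := by
          have h4 : ∀ u, (if u ∈ D \ G.info.explored α v h then (1 / 2 : ℝ) else 1) / (1 - y)
              = (1 / (1 - y)) * (1 + (-1 / 2) *
                if u ∈ D \ G.info.explored α v h then 1 else 0) := by
            intro u
            split_ifs <;> ring
          simp only [h4, IdGraph.avg_mul, IdGraph.avg_add, IdGraph.avg_const]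
          have h5 : G.avg (fun u => if u ∈ D \ G.info.explored α v h then 1 else 0)
              = (D \ G.info.explored α v h).card / G.size := by
            unfold IdGraph.avg
            rw [Finset.sum_ite_mem, Finset.inter_eq_right.2 (Finset.sdiff_subset.trans hD)]
            simp
          rw [h5]
          field_simp
          ring
        rw [h3, div_le_one hy2, hy, sub_le_sub_iff_left, div_le_div_iff₀ (by positivity)
          (by positivity)]
        have h4 := Finset.card_sdiff_add_card_inter D (G.info.explored α v h)
        have h5 : D.card ≤ 2 * (D \ G.info.explored α v h).card := by
          have := hc.2
          omega
        have h6 : (D.card : ℝ) ≤ 2 * (D \ G.info.explored α v h).card := by exact_mod_cast h5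
        nlinarith
      · exact (G.avg_const 1).le
    calc _ ≤ ∑ x ∈ G.nodes, G.rank α x * 1 := by
          gcongr with x hx
          · exact G.rank_nonneg h0 hα1 x
          · exact h2 x
      _ = 1 := by simpa using G.sum_rank h0 hα1
  · rintro h hsub ⟨h', hs, hl, hc⟩
    rw [weightProd_suffix (N := N) (fun h x u hN => ?_) hs hl.ge]
    · refine le_trans ?_ (hprod h' hl.le hc)
      rw [hl]
      gcongr ?_ * _
      exact pow_le_pow_of_le_one (by norm_num) (by norm_num) hc.le
    · simp only [hw]
      rw [if_neg fun h => absurd h.1 (by omega)]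

theorem sees_tally {v : ℕ} {h : List (ℕ × ℕ)} (hsub : G.info.explored α v h ⊆ G.nodes) :
    (G.info.tally α v h).view.Sees G := by
  rw [Info.tally_view]
  exact G.sees_view hsub

theorem hit_nonneg (h0 : 0 ≤ α) (hα1 : α < 1) {v : ℕ} (h : List (ℕ × ℕ)) (x : ℕ)
    (c : Finset ℕ) (u : ℕ) : 0 ≤ (G.info.tally α v h).hit α v x c u :=
  div_nonneg (View.score_nonneg _ v h0 hα1 x c u)
    (View.range_pos _ v h0 hα1 (Info.mem_explored h)).le

theorem hit_le_one (h0 : 0 ≤ α) (hα1 : α < 1) {v : ℕ} {h : List (ℕ × ℕ)}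
    (hsub : G.info.explored α v h ⊆ G.nodes) {x : ℕ} (hx : x ∈ G.nodes) (u : ℕ) :
    (G.info.tally α v h).hit α v x (G.children x) u ≤ 1 := by
  have h2 : v ∈ (G.info.tally α v h).view.explored := Info.mem_explored h
  rw [Tally.hit, div_le_one (View.range_pos _ v h0 hα1 h2)]
  exact (sees_tally hsub).score_le_range h0 hα1 h2 hx

theorem mean_hit (h0 : 0 ≤ α) (hα1 : α < 1) {v : ℕ} {h : List (ℕ × ℕ)}
    (hsub : G.info.explored α v h ⊆ G.nodes) :
    ∑ x ∈ G.nodes, G.rank α x * G.avg (fun u => (G.info.tally α v h).hit α v x (G.children x) u)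
      = G.rank α v * (1 / (G.info.tally α v h).view.range α v) := by
  rw [← (sees_tally hsub).mean_score h0 hα1 (Info.mem_explored h), Finset.sum_mul]
  refine Finset.sum_congr rfl fun x _ => ?_
  simp only [Tally.hit, div_eq_inv_mul, IdGraph.avg_mul, mul_one]
  ring

theorem mean_hit_le_one (h0 : 0 ≤ α) (hα1 : α < 1) {v : ℕ} {h : List (ℕ × ℕ)}
    (hsub : G.info.explored α v h ⊆ G.nodes) :
    G.rank α v * (1 / (G.info.tally α v h).view.range α v) ≤ 1 := by
  rw [← mean_hit h0 hα1 hsub, ← G.sum_rank h0 hα1]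
  refine Finset.sum_le_sum fun x hx => mul_le_of_le_one_right (G.rank_nonneg h0 hα1 x) ?_
  rw [← G.avg_const 1]
  exact G.avg_mono fun u _ => hit_le_one h0 hα1 hsub hx u

theorem mean_le (h0 : 0 ≤ α) (hα1 : α < 1) {φ : ℕ → ℕ → ℝ} {ψ : ℕ → ℕ → ℝ}
    (h : ∀ x ∈ G.nodes, ∀ u ∈ G.nodes, φ x u ≤ ψ x u) :
    ∑ x ∈ G.nodes, G.rank α x * G.avg (φ x) ≤ ∑ x ∈ G.nodes, G.rank α x * G.avg (ψ x) := by
  refine Finset.sum_le_sum fun x hx => mul_le_mul_of_nonneg_left ?_ (G.rank_nonneg h0 hα1 x)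
  exact G.avg_mono fun u hu => h x hx u hu

theorem mean_affine (h0 : 0 ≤ α) (hα1 : α < 1) (a b : ℝ) (φ : ℕ → ℕ → ℝ) :
    ∑ x ∈ G.nodes, G.rank α x * G.avg (fun u => a + b * φ x u)
      = a + b * ∑ x ∈ G.nodes, G.rank α x * G.avg (φ x) := by
  simp only [IdGraph.avg_add, IdGraph.avg_const, IdGraph.avg_mul, mul_add,
    Finset.sum_add_distrib]
  rw [← Finset.sum_mul, G.sum_rank h0 hα1, one_mul, Finset.mul_sum]
  congr 1
  exact Finset.sum_congr rfl fun x _ => by ring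

open Classical in
/-- The noise of a round. -/
def roundNoise (α : ℝ) (G : IdGraph) (v : ℕ) (f : Bool) (h : List (ℕ × ℕ)) (x u : ℕ) : ℝ :=
  if f = true ∧ (G.info.tally α v h).view.frontier = ∅ then
    1 - (G.info.tally α v h).hit α v x (G.children x) u
  else (G.info.tally α v h).hit α v x (G.children x) u

/-- The weight of a round in the estimate of the deviation of the hits from their mean. -/
def deviationWeight (α : ℝ) (G : IdGraph) (v : ℕ) (f : Bool) (μ : ℝ) (h : List (ℕ × ℕ))
    (x u : ℕ) : ℝ :=
  Real.exp (μ * ((G.info.tally α v h).hit α v x (G.children x) u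
    - G.rank α v * (1 / (G.info.tally α v h).view.range α v)) - μ ^ 2 * roundNoise α G v f h x u)

/-- The product telescopes, since hits, mass and noise are sums over the rounds. -/
theorem weightProd_deviationWeight (v : ℕ) (f : Bool) (μ : ℝ) (h : List (ℕ × ℕ)) :
    weightProd (deviationWeight α G v f μ) h
      = Real.exp (μ * ((G.info.tally α v h).hits - G.rank α v * (G.info.tally α v h).mass)
        - μ ^ 2 * (G.info.tally α v h).noiseOf f) := by
  induction h with
  | nil => cases f <;> simp [weightProd, Info.tally, Tally.noiseOf]
  | cons r h ih =>
    rw [weightProd, ih, deviationWeight, ← Real.exp_add]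
    congr 1
    have h2 : (G.info.tally α v (r :: h)).noiseOf f
        = (G.info.tally α v h).noiseOf f + roundNoise α G v f h r.1 r.2 := by
      unfold roundNoise
      cases f <;> simp [Tally.noiseOf, Info.tally, Tally.next, IdGraph.info]
    rw [h2]
    simp only [Info.tally, Tally.next, IdGraph.info]
    ring

/-- The Bernstein bound is applied to μ and the hit or, in closed rounds when the flag is set, to -μ
and one minus the hit. The mean cancels by 1 + x ≤ exp x. -/
theorem mean_deviationWeight_le (h0 : 0 ≤ α) (hα1 : α < 1) {v : ℕ} (f : Bool) {μ : ℝ}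
    (hμ1 : -(1 / 2) ≤ μ) (hμ2 : μ ≤ 1 / 2) {h : List (ℕ × ℕ)}
    (hsub : G.info.explored α v h ⊆ G.nodes) :
    ∑ x ∈ G.nodes, G.rank α x * G.avg (deviationWeight α G v f μ h x) ≤ 1 := by
  set m := G.rank α v * (1 / (G.info.tally α v h).view.range α v) with hm
  set z : ℕ → ℕ → ℝ := fun x u => (G.info.tally α v h).hit α v x (G.children x) u with hz
  have hz0 : ∀ x u, 0 ≤ z x u := fun x u => hit_nonneg h0 hα1 h x _ u
  have hz1 : ∀ x ∈ G.nodes, ∀ u, z x u ≤ 1 := fun x hx u => hit_le_one h0 hα1 hsub hx u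
  have hmean : ∑ x ∈ G.nodes, G.rank α x * G.avg (z x) = m := mean_hit h0 hα1 hsub
  by_cases hf : f = true ∧ (G.info.tally α v h).view.frontier = ∅
  · calc _ ≤ ∑ x ∈ G.nodes, G.rank α x * G.avg (fun u =>
          Real.exp (μ * (1 - m)) * (1 - μ) + (Real.exp (μ * (1 - m)) * μ) * z x u) := by
          refine mean_le h0 hα1 fun x hx u _ => ?_
          have h2 := exp_sub_sq_mul_le (μ := -μ) (z := 1 - z x u) (by linarith) (by linarith)
            (by linarith [hz1 x hx u]) (by linarith [hz0 x u])
          rw [deviationWeight, roundNoise, if_pos hf,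
            show μ * ((G.info.tally α v h).hit α v x (G.children x) u
              - G.rank α v * (1 / (G.info.tally α v h).view.range α v))
              - μ ^ 2 * (1 - (G.info.tally α v h).hit α v x (G.children x) u)
              = μ * (1 - m) + (-μ * (1 - z x u) - (-μ) ^ 2 * (1 - z x u)) by
              simp only [hz, hm]; ring, Real.exp_add]
          calc _ ≤ Real.exp (μ * (1 - m)) * (1 + -μ * (1 - z x u)) := by gcongr
            _ = _ := by ring
      _ = Real.exp (μ * (1 - m)) * (1 - μ * (1 - m)) := by
          rw [mean_affine h0 hα1, hmean]
          ring
      _ ≤ Real.exp (μ * (1 - m)) * Real.exp (-(μ * (1 - m))) := by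
          gcongr
          linarith [Real.add_one_le_exp (-(μ * (1 - m)))]
      _ = 1 := by rw [← Real.exp_add]; simp
  · calc _ ≤ ∑ x ∈ G.nodes, G.rank α x * G.avg (fun u =>
          Real.exp (-(μ * m)) + (Real.exp (-(μ * m)) * μ) * z x u) := by
          refine mean_le h0 hα1 fun x hx u _ => ?_
          have h2 := exp_sub_sq_mul_le (μ := μ) (z := z x u) (by linarith) (by linarith)
            (hz0 x u) (hz1 x hx u)
          rw [deviationWeight, roundNoise, if_neg hf,
            show μ * ((G.info.tally α v h).hit α v x (G.children x) u
              - G.rank α v * (1 / (G.info.tally α v h).view.range α v))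
              - μ ^ 2 * ((G.info.tally α v h).hit α v x (G.children x) u)
              = -(μ * m) + (μ * z x u - μ ^ 2 * z x u) by
              simp only [hz, hm]; ring, Real.exp_add]
          calc _ ≤ Real.exp (-(μ * m)) * (1 + μ * z x u) := by gcongr
            _ = _ := by ring
      _ = Real.exp (-(μ * m)) * (1 + μ * m) := by
          rw [mean_affine h0 hα1, hmean]
          ring
      _ ≤ Real.exp (-(μ * m)) * Real.exp (μ * m) := by
          gcongr
          linarith [Real.add_one_le_exp (μ * m)]
      _ = 1 := by rw [← Real.exp_add]; simp

theorem event_deviation_le_aux (hα1 : α < 1) {v : ℕ} (hv : v ∈ G.nodes) (f : Bool) {μ : ℝ}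
    (hμ1 : -(1 / 2) ≤ μ) (hμ2 : μ ≤ 1 / 2) (L : ℝ) (t : ℕ) :
    ((search α h0 h1 verdict).run G v (2 + 5 * t)).toOuterMeasure
      (event α G v fun h => L ≤
        μ * ((G.info.tally α v h).hits - G.rank α v * (G.info.tally α v h).mass)
        - μ ^ 2 * (G.info.tally α v h).noiseOf f)
      ≤ ENNReal.ofReal (Real.exp (1 - L)) := by
  -- A single weight is at least exp (-1), because its exponent is at least -1/2 - 1/4.
  have h2 : Real.exp (1 - L) = 1 / (Real.exp (-1) * Real.exp L) := by
    rw [← Real.exp_add, one_div, ← Real.exp_neg]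
    congr 1
    ring
  rw [h2]
  refine event_weight_le (w := deviationWeight α G v f μ) hα1 hv (Real.exp_pos _)
    (Real.exp_pos _) ?_ (fun h hsub => mean_deviationWeight_le h0 hα1 f hμ1 hμ2 hsub)
    (weightProd_nonneg fun h x u => (Real.exp_pos _).le) ?_ t
  · intro h x hx u _ hsub
    rw [deviationWeight, Real.exp_le_exp]
    have h3 := hit_nonneg h0 hα1 (G := G) (v := v) h x (G.children x) u
    have h4 := hit_le_one h0 hα1 hsub hx u
    have h5 := mean_hit_le_one h0 hα1 hsub
    have h6 : 0 ≤ G.rank α v * (1 / (G.info.tally α v h).view.range α v) :=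
      mul_nonneg (G.rank_nonneg h0 hα1 v) (one_div_nonneg.2
        (View.range_pos _ v h0 hα1 (Info.mem_explored h)).le)
    have h7 : roundNoise α G v f h x u ≤ 1 := by
      unfold roundNoise
      split_ifs <;> linarith
    have h8 : 0 ≤ roundNoise α G v f h x u := by
      unfold roundNoise
      split_ifs <;> linarith
    have h9 : μ ^ 2 ≤ 1 / 4 := by nlinarith
    have h10 : |μ * ((G.info.tally α v h).hit α v x (G.children x) u
        - G.rank α v * (1 / (G.info.tally α v h).view.range α v))| ≤ 1 / 2 * 1 := by
      rw [abs_mul]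
      exact mul_le_mul (abs_le.2 ⟨hμ1, hμ2⟩) (abs_le.2 ⟨by linarith, by linarith⟩)
        (abs_nonneg _) (by norm_num)
    have h11 := (abs_le.1 h10).1
    have h12 : μ ^ 2 * roundNoise α G v f h x u ≤ 1 / 4 * 1 :=
      mul_le_mul h9 h7 h8 (by norm_num)
    linarith
  · intro h _ hL
    rw [weightProd_deviationWeight, Real.exp_le_exp]
    exact hL

/-- A large deviation of the hits from their mean is unlikely. -/
theorem event_deviation_le (hα1 : α < 1) {v : ℕ} (hv : v ∈ G.nodes) (J : ℕ) (L : ℝ) (t : ℕ) :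
    ((search α h0 h1 verdict).run G v (2 + 5 * t)).toOuterMeasure
      (event α G v fun h => ∃ j ∈ Finset.Icc 2 J, ∃ f,
        (G.info.tally α v h).noiseOf f / j + L * j
          < |(G.info.tally α v h).hits - G.rank α v * (G.info.tally α v h).mass|)
      ≤ ENNReal.ofReal (4 * J * Real.exp (1 - L)) := by
  -- Union bound over the scales μ = ± 1 / j and the two kinds of noise; the last flag is the sign.
  set p : ℕ × Bool × Bool → List (ℕ × ℕ) → Prop := fun i h => L ≤
    (if i.2.2 then 1 / (i.1 : ℝ) else -(1 / i.1))
      * ((G.info.tally α v h).hits - G.rank α v * (G.info.tally α v h).mass)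
        - (if i.2.2 then 1 / (i.1 : ℝ) else -(1 / i.1)) ^ 2
          * (G.info.tally α v h).noiseOf i.2.1 with hp
  have hsub : (event α G v fun h => ∃ j ∈ Finset.Icc 2 J, ∃ f,
        (G.info.tally α v h).noiseOf f / j + L * j
          < |(G.info.tally α v h).hits - G.rank α v * (G.info.tally α v h).mass|)
      ⊆ ⋃ i ∈ (Finset.Icc 2 J) ×ˢ (Finset.univ : Finset (Bool × Bool)), event α G v (p i) := by
    rintro c ⟨h, x, hr, j, hj, f, hlt⟩
    have hj0 : (0 : ℝ) < j := by
      have := (Finset.mem_Icc.1 hj).1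
      exact_mod_cast (by omega : 0 < j)
    have key : ∀ d : ℝ, (G.info.tally α v h).noiseOf f / j + L * j < d →
        L ≤ 1 / (j : ℝ) * d - (1 / (j : ℝ)) ^ 2 * (G.info.tally α v h).noiseOf f := by
      intro d hd
      have h2 : L * j ≤ d - (G.info.tally α v h).noiseOf f / j := by linarith
      calc L = 1 / (j : ℝ) * (L * j) := by field_simp
        _ ≤ 1 / (j : ℝ) * (d - (G.info.tally α v h).noiseOf f / j) := by gcongr
        _ = _ := by ring
    simp only [Set.mem_iUnion]
    rcases lt_abs.1 hlt with hd | hd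
    · exact ⟨(j, f, true), by simp [Finset.mem_Icc.1 hj], h, x, hr, by simpa [hp] using key _ hd⟩
    · refine ⟨(j, f, false), by simp [Finset.mem_Icc.1 hj], h, x, hr, ?_⟩
      have := key _ hd
      simp only [hp, Bool.false_eq_true, if_false]
      linarith
  refine (MeasureTheory.measure_mono hsub).trans
    ((MeasureTheory.measure_biUnion_finset_le _ _).trans ?_)
  have hle : ∀ i ∈ (Finset.Icc 2 J) ×ˢ (Finset.univ : Finset (Bool × Bool)),
      ((search α h0 h1 verdict).run G v (2 + 5 * t)).toOuterMeasure (event α G v (p i))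
        ≤ ENNReal.ofReal (Real.exp (1 - L)) := by
    rintro ⟨j, f, s⟩ hi
    have hj : 2 ≤ j := by simpa using (Finset.mem_Icc.1 (Finset.mem_product.1 hi).1).1
    have hj' : (2 : ℝ) ≤ j := by exact_mod_cast hj
    have h2 : 1 / (j : ℝ) ≤ 1 / 2 := by gcongr
    have h3 : 0 ≤ 1 / (j : ℝ) := by positivity
    refine event_deviation_le_aux hα1 hv f ?_ ?_ L t
    · split_ifs <;> linarith
    · split_ifs <;> linarith
  refine (Finset.sum_le_sum hle).trans ?_
  rw [Finset.sum_const, Finset.card_product, Nat.card_Icc, nsmul_eq_mul,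
    show (Finset.univ : Finset (Bool × Bool)).card = 4 from rfl,
    ENNReal.ofReal_mul (by positivity)]
  gcongr
  rw [← ENNReal.ofReal_natCast]
  refine ENNReal.ofReal_le_ofReal ?_
  have : (J + 1 - 2) * 4 ≤ 4 * J := by omega
  exact_mod_cast this

end search
end

/-! ### The stopping rule: growth of the mass and sufficient conditions for halting. -/

noncomputable section

open Classical in
/-- The rule of the search: `L` is the confidence level, `J` the number of scales, and `m` and `k`
determine when a graph is considered as completely explored. -/
def rule (α ε L : ℝ) (J m k : ℕ) (v : ℕ) (T : Tally) : Option ℝ :=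
  if ∃ j ∈ Finset.Icc 2 J, ∃ f, T.noiseOf f / j + L * j ≤ ε / 2 * T.hits then
    some (T.hits / T.mass)
  else if m ≤ T.rounds ∧ T.view.explored.card ≤ k then
    some (T.view.gainSum α v / T.view.lifeSum α)
  else none

namespace search

variable {α : ℝ} {G : IdGraph} {v : ℕ}

theorem explored_suffix {h' h : List (ℕ × ℕ)} (hs : h' <:+ h) :
    G.info.explored α v h' ⊆ G.info.explored α v h := by
  induction h with
  | nil => rw [List.suffix_nil.1 hs]
  | cons r h ih =>
    rcases List.suffix_cons_iff.1 hs with rfl | hs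
    · exact subset_rfl
    · exact (ih hs).trans (G.info.explored_subset_cons α v r h)

theorem tally_cons (r : ℕ × ℕ) (h : List (ℕ × ℕ)) :
    G.info.tally α v (r :: h) = (G.info.tally α v h).next α v G.info r.1 r.2 := rfl

section

variable (h0 : 0 ≤ α) (hα1 : α < 1)

include h0 hα1

theorem hits_noise_nonneg {h : List (ℕ × ℕ)} (hsub : G.info.explored α v h ⊆ G.nodes) :
    0 ≤ (G.info.tally α v h).hits ∧ 0 ≤ (G.info.tally α v h).noise := by
  induction h with
  | nil => simp [Info.tally]
  | cons r h ih =>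
    have hsub' := (G.info.explored_subset_cons α v r h).trans hsub
    obtain ⟨h2, h3⟩ := ih hsub'
    have h4 := hit_nonneg h0 hα1 (G := G) (v := v) h r.1 (G.children r.1) r.2
    have h5 := hit_le_one h0 hα1 hsub' (x := r.1) (hsub (by simp [Info.explored_cons])) r.2
    rw [tally_cons]
    simp only [Tally.next, IdGraph.info] at h2 h3 h4 h5 ⊢
    refine ⟨by linarith, add_nonneg h3 ?_⟩
    split_ifs <;> linarith

theorem noiseOf_nonneg {h : List (ℕ × ℕ)} (hsub : G.info.explored α v h ⊆ G.nodes) (f : Bool) :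
    0 ≤ (G.info.tally α v h).noiseOf f := by
  have := hits_noise_nonneg h0 hα1 hsub
  cases f <;> simp [Tally.noiseOf, this]

/-- Every range is at most 2 / (1 - α); this linear growth is what the first query bound rests on.
-/
theorem le_mass (h : List (ℕ × ℕ)) :
    (h.length : ℝ) * ((1 - α) / 2) ≤ (G.info.tally α v h).mass := by
  induction h with
  | nil => simp [Info.tally]
  | cons r h ih =>
    have hv : v ∈ (G.info.tally α v h).view.explored := Info.mem_explored h
    have h2 := View.range_le_const _ v h0 hα1 hv
    have h3 := View.range_pos _ v h0 hα1 hv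
    have h4 : (1 - α) / 2 ≤ 1 / (G.info.tally α v h).view.range α v := by
      rw [le_div_iff₀ h3]
      have h5 : 0 < 1 - α := by linarith
      calc _ ≤ (1 - α) / 2 * (2 / (1 - α)) := by gcongr
        _ = 1 := by field_simp
    rw [tally_cons]
    simp only [Tally.next, List.length_cons]
    push_cast
    linarith

/-- Noise is paid for by newly explored nodes. Without frontier, the hit is 1 unless the surfer ends
at a new node; with a frontier, the target is new, and noise and hits lie in [0, 1]. -/
theorem noise_round_le {h : List (ℕ × ℕ)} {x u : ℕ}
    (hsub : G.info.explored α v ((x, u) :: h) ⊆ G.nodes) :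
    roundNoise α G v true h x u + (G.info.explored α v h).card
        ≤ (G.info.explored α v ((x, u) :: h)).card ∧
      1 - (G.info.tally α v h).hit α v x (G.children x) u + (G.info.explored α v h).card
        ≤ (G.info.explored α v ((x, u) :: h)).card := by
  have hsub' := (G.info.explored_subset_cons α v (x, u) h).trans hsub
  have h4 := hit_nonneg h0 hα1 (G := G) (v := v) h x (G.children x) u
  have h5 := hit_le_one h0 hα1 hsub' (x := x) (hsub (by simp [Info.explored_cons])) u
  have hmono := Finset.card_le_card (G.info.explored_subset_cons α v (x, u) h)
  have key : ∀ w ∈ G.info.explored α v ((x, u) :: h), w ∉ G.info.explored α v h →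
      (1 : ℝ) + (G.info.explored α v h).card ≤ (G.info.explored α v ((x, u) :: h)).card := by
    intro w hw hw'
    have h6 := Finset.card_le_card
      (Finset.insert_subset hw (G.info.explored_subset_cons α v (x, u) h))
    rw [Finset.card_insert_of_notMem hw'] at h6
    have h7 : ((G.info.explored α v h).card + 1 : ℝ)
      ≤ (G.info.explored α v ((x, u) :: h)).card := by exact_mod_cast h6
    linarith
  have hmono' : ((G.info.explored α v h).card : ℝ)
    ≤ (G.info.explored α v ((x, u) :: h)).card := by exact_mod_cast hmono
  unfold roundNoise
  by_cases hf : (G.info.tally α v h).view.frontier = ∅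
  · rw [if_pos ⟨rfl, hf⟩]
    by_cases hx : x ∈ G.info.explored α v h
    · have hv : v ∈ (G.info.tally α v h).view.explored := Info.mem_explored h
      have h6 : (G.info.tally α v h).hit α v x (G.children x) u = 1 := by
        have h7 := View.range_pos _ v h0 hα1 hv
        have hx' : x ∈ (G.info.tally α v h).view.explored := hx
        rw [View.range, if_pos hf] at h7
        rw [Tally.hit, View.score, View.range, if_pos hf, if_pos hf, if_pos hx']
        exact div_self h7.ne'
      rw [h6]
      constructor <;> linarith
    · have := key x (by simp [Info.explored_cons]) hx
      constructor <;> linarith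
  · rw [if_neg fun h => hf h.2]
    have h6 := (G.info.tally α v h).view.target_mem α v hf
    have := key _ (by simp [Info.explored_cons])
      ((G.info.tally α v h).view.frontier_disjoint h6)
    constructor <;> linarith

/-- Summing over the rounds: the noise is at most n, and all but at most n rounds' worth of hits are
scored. -/
theorem noise_le_card {h : List (ℕ × ℕ)} (hsub : G.info.explored α v h ⊆ G.nodes) :
    (G.info.tally α v h).noise ≤ (G.info.explored α v h).card ∧
      (h.length : ℝ) ≤ (G.info.tally α v h).hits + (G.info.explored α v h).card := by
  induction h with
  | nil => simp [Info.tally]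
  | cons r h ih =>
    have hsub' := (G.info.explored_subset_cons α v r h).trans hsub
    obtain ⟨h2, h3⟩ := ih hsub'
    obtain ⟨h4, h5⟩ := noise_round_le h0 hα1 (x := r.1) (u := r.2) hsub
    unfold roundNoise at h4
    simp only [true_and] at h4
    rw [tally_cons]
    simp only [Tally.next, List.length_cons]
    push_cast
    constructor
    · change _ + (if _ then 1 - (G.info.tally α v h).hit α v r.1 (G.children r.1) r.2 else
        (G.info.tally α v h).hit α v r.1 (G.children r.1) r.2) ≤ _
      linarith
    · change _ ≤ _ + (G.info.tally α v h).hit α v r.1 (G.children r.1) r.2 + _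
      linarith

/-- The mass grows quadratically: the sum of the ranges is bounded since exploring the targets
increases the total gain. -/
theorem sq_le_mass_mul {U : ℝ} (hU : 0 ≤ U) {h' h : List (ℕ × ℕ)} (hs : h' <:+ h)
    (hsub : G.info.explored α v h ⊆ G.nodes)
    (hdeg : ∀ w ∈ G.nodes, (G.outdegree w : ℝ)
      ≤ U * max 1 ((G.children w ∩ G.info.explored α v h').card : ℝ)) :
    ((h.length : ℝ) - h'.length) ^ 2 ≤ (G.info.tally α v h).mass
      * ((U + ((h.length : ℝ) - h'.length) / (G.info.explored α v h').card)
        * (G.size * G.rank α v / (1 - α))) := by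
  set g : List (ℕ × ℕ) → ℝ := fun h => (G.info.tally α v h).view.gainSum α v with hg
  set B := G.size * G.rank α v / (1 - α) with hB
  have hgB : ∀ h, G.info.explored α v h ⊆ G.nodes → g h ≤ B := fun h hsub =>
    (sees_tally hsub).gainSum_le h0 hα1 (Info.mem_explored h)
  have hg0 : ∀ h, 0 ≤ g h := fun h => View.gainSum_nonneg _ α v
  have hs0 : (0 : ℝ) < (G.info.explored α v h').card := by
    exact_mod_cast Finset.card_pos.2 ⟨v, Info.mem_explored h'⟩
  -- R and M are the sums of the ranges and of their reciprocals over the rounds after h'. The gain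
  -- differences telescope, and the last inequality is Cauchy–Schwarz, proved by induction.
  have key : ∃ R M : ℝ, 0 ≤ R ∧ 0 ≤ M ∧ M ≤ (G.info.tally α v h).mass ∧
      R ≤ U * (g h - g h')
        + ((h.length : ℝ) - h'.length) * (B / (G.info.explored α v h').card) ∧
      ((h.length : ℝ) - h'.length) ^ 2 ≤ M * R := by
    induction h with
    | nil =>
      rw [List.suffix_nil.1 hs]
      exact ⟨0, 0, le_rfl, le_rfl, by simp [Info.tally], by simp, by simp⟩
    | cons r h ih =>
      rcases List.suffix_cons_iff.1 hs with rfl | hs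
      · refine ⟨0, 0, le_rfl, le_rfl, ?_, by simp, by simp⟩
        refine le_trans ?_ (le_mass h0 hα1 _)
        have : 0 < 1 - α := by linarith
        positivity
      · have hsub' := (G.info.explored_subset_cons α v r h).trans hsub
        obtain ⟨R, M, hR, hM, hMm, hRle, hle⟩ := ih hs hsub'
        have hv : v ∈ (G.info.tally α v h).view.explored := Info.mem_explored h
        set ra := (G.info.tally α v h).view.range α v with hra
        have hr0 : 0 < ra := View.range_pos _ v h0 hα1 hv
        have hr1 : ra ≤ U * (g (r :: h) - g h) + B / (G.info.explored α v h').card := by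
          refine (View.range_le _ v h0 hα1 hv).trans (add_le_add ?_ ?_)
          · refine View.Sees.frontierGain_le h0 hα1 (sees_tally hsub') (sees_tally hsub)
              (G.info.explored_subset_cons α v r h) ?_ hU ?_
            · change _ ∈ G.info.explored α v (r :: h)
              simp [Info.explored_cons]
            · intro w hw
              refine (hdeg w hw).trans ?_
              gcongr
              exact explored_suffix hs
          · have h3 : (G.info.explored α v h').card ≤ (G.info.explored α v h).card :=
              Finset.card_le_card (explored_suffix hs)
            have h4 := hgB h hsub'
            have h5 := hg0 h
            change g h / ((G.info.explored α v h).card : ℝ) ≤ _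
            gcongr
            exact h5.trans h4
        refine ⟨R + ra, M + 1 / ra, by positivity, by positivity, ?_, ?_, ?_⟩
        · rw [tally_cons]
          exact add_le_add hMm le_rfl
        · rw [List.length_cons]
          push_cast
          linarith
        · rw [List.length_cons]
          push_cast
          have hlen : (h'.length : ℝ) ≤ h.length := by exact_mod_cast hs.length_le
          set d := (h.length : ℝ) - h'.length with hd
          have hd0 : 0 ≤ d := by linarith
          -- AM-GM: the product of the two summands is M * R, which is at least d ^ 2.
          have h3 : 2 * d ≤ M * ra + R / ra := by
            refine abs_le_of_sq_le_sq' ?_ (by positivity) |>.2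
            have h4 : (M * ra) * (R / ra) = M * R := by field_simp
            nlinarith [sq_nonneg (M * ra - R / ra)]
          calc ((h.length : ℝ) + 1 - h'.length) ^ 2 = d ^ 2 + 2 * d + 1 := by rw [hd]; ring
            _ ≤ M * R + (M * ra + R / ra) + 1 := by linarith
            _ = (M + 1 / ra) * (R + ra) := by
                field_simp
                ring
  obtain ⟨R, M, hR, hM, hMm, hRle, hle⟩ := key
  have hlen : (h'.length : ℝ) ≤ h.length := by exact_mod_cast hs.length_le
  refine hle.trans (mul_le_mul hMm (hRle.trans ?_) hR (hM.trans hMm))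
  have h3 : g h - g h' ≤ B := by linarith [hgB h hsub, hg0 h']
  calc _ ≤ U * B + ((h.length : ℝ) - h'.length) * (B / (G.info.explored α v h').card) := by
        gcongr
    _ = _ := by ring

end

section

variable {ε L : ℝ} {J m k : ℕ} {T : Tally}

/-- When the rule fires, the deviation is at most ε / 2 times the hits; so P * mass is within this
relative error of the hits, and inverting costs a factor 2 as ε ≤ 1. -/
theorem rule_rank {P : ℝ} (hP : 0 < P) (hε0 : 0 < ε) (hε1 : ε ≤ 1) (hL : 0 < L)
    (hnoise : ∀ f, 0 ≤ T.noiseOf f)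
    (hdev : ∀ j ∈ Finset.Icc 2 J, ∀ f, |T.hits - P * T.mass| ≤ T.noiseOf f / j + L * j)
    (hr : ∃ j ∈ Finset.Icc 2 J, ∃ f, T.noiseOf f / j + L * j ≤ ε / 2 * T.hits) :
    T.hits / T.mass ∈ Set.Icc ((1 - ε) * P) ((1 + ε) * P) := by
  obtain ⟨j, hj, f, hle⟩ := hr
  have hj0 : (0 : ℝ) < j := by
    have := (Finset.mem_Icc.1 hj).1
    exact_mod_cast (by omega : 0 < j)
  have h2 := abs_le.1 ((hdev j hj f).trans hle)
  have h3 : 0 < T.noiseOf f / j + L * j := by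
    have := hnoise f
    positivity
  have hA : 0 < T.hits := by
    by_contra hA
    nlinarith
  have hPB : 0 < P * T.mass := by nlinarith
  have hB : 0 < T.mass := by
    by_contra hB
    nlinarith
  constructor
  · rw [le_div_iff₀ hB]
    nlinarith
  · rw [div_le_iff₀ hB]
    nlinarith [mul_pos hε0 hA]

/-- At scale j ≈ 8 / ε, with the hits as noise, the deviation is at most (ε / 8) hits + 9 L / ε.
This forces hits ≥ 24 L / ε², and then the same quantity is at most (ε / 2) hits. -/
theorem rule_of_mass {P : ℝ} (hε0 : 0 < ε) (hε1 : ε ≤ 1) (hL : 0 < L) (hJ : 8 / ε + 1 ≤ J)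
    (hdev : ∀ j ∈ Finset.Icc 2 J, ∀ f, |T.hits - P * T.mass| ≤ T.noiseOf f / j + L * j)
    (hA : 0 ≤ T.hits) (hm : 36 * L / ε ^ 2 ≤ P * T.mass) :
    ∃ j ∈ Finset.Icc 2 J, ∃ f, T.noiseOf f / j + L * j ≤ ε / 2 * T.hits := by
  set j := ⌈8 / ε⌉₊ with hj
  have h1 : 8 / ε ≤ j := Nat.le_ceil _
  have h2 : (j : ℝ) ≤ 9 / ε := by
    have h3 := (Nat.ceil_lt_add_one (show 0 ≤ 8 / ε by positivity)).le
    have h4 : 1 ≤ 1 / ε := by rwa [le_div_iff₀ hε0, one_mul]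
    calc (j : ℝ) ≤ 8 / ε + 1 := h3
      _ ≤ 8 / ε + 1 / ε := by gcongr
      _ = 9 / ε := by ring
  have h8 : 8 ≤ 8 / ε := by rw [le_div_iff₀ hε0]; linarith
  have hjm : j ∈ Finset.Icc 2 J := by
    rw [Finset.mem_Icc]
    constructor
    · have : (2 : ℝ) ≤ j := by linarith
      exact_mod_cast this
    · have : (j : ℝ) ≤ J := (Nat.ceil_lt_add_one (show 0 ≤ 8 / ε by positivity)).le.trans hJ
      exact_mod_cast this
  have h3 := (abs_le.1 (hdev j hjm false)).1
  have h4 : T.noiseOf false = T.hits := rfl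
  rw [h4] at h3
  have h5 : T.hits / j ≤ ε / 8 * T.hits := by
    calc T.hits / j ≤ T.hits / (8 / ε) := by gcongr
      _ = _ := by field_simp
  have h6 : L * j ≤ 9 * (L / ε) := by
    calc L * j ≤ L * (9 / ε) := by gcongr
      _ = _ := by ring
  set y := L / ε with hy
  have h7 : 36 * L / ε ^ 2 = 36 * (y / ε) := by rw [hy]; field_simp
  have hy0 : 0 < y := by positivity
  have h9 : y ≤ y / ε := by rw [le_div_iff₀ hε0]; nlinarith
  have h10 : 24 * (y / ε) ≤ T.hits := by
    rw [h7] at hm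
    nlinarith
  refine ⟨j, hjm, false, ?_⟩
  rw [h4]
  have h11 : 24 * y ≤ ε * T.hits := by
    calc 24 * y = ε * (24 * (y / ε)) := by field_simp
      _ ≤ _ := by gcongr
  linarith

/-- With noise at most n the optimal scale is j ≈ √(n / L), at which both terms are of order √(n L).
-/
theorem rule_of_noise {n N : ℝ} (hε0 : 0 < ε) (hL : 0 < L) (hLn : L ≤ n)
    (hn : n ≤ L / ε ^ 2) (hJ : 3 / ε ≤ J) (hnoise : T.noise ≤ n) (hits : N ≤ T.hits + n)
    (hN : 16 * (n * L / ε ^ 2) ≤ N ^ 2 / 16) (hN0 : 0 ≤ N) :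
    ∃ j ∈ Finset.Icc 2 J, ∃ f, T.noiseOf f / j + L * j ≤ ε / 2 * T.hits := by
  have hn0 : 0 < n := hL.trans_le hLn
  set s := Real.sqrt (n / L) with hs
  have hs2 : s ^ 2 = n / L := Real.sq_sqrt (by positivity)
  have hnL : n = L * s ^ 2 := by rw [hs2]; field_simp
  have hs1 : 1 ≤ s := by
    rw [hs, Real.one_le_sqrt, one_le_div hL]
    exact hLn
  have hs3 : s ≤ 1 / ε := by
    refine abs_le_of_sq_le_sq' ?_ (by positivity) |>.2
    rw [hs2, div_le_iff₀ hL]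
    calc n ≤ L / ε ^ 2 := hn
      _ = _ := by ring
  have hsε : s * ε ≤ 1 := by rwa [le_div_iff₀ hε0] at hs3
  -- The extra 1 ensures 2 ≤ j.
  set j := ⌈s⌉₊ + 1 with hj
  have h1 : s ≤ j := by
    rw [hj]
    push_cast
    linarith [Nat.le_ceil s]
  have h2 : (j : ℝ) ≤ 3 * s := by
    rw [hj]
    push_cast
    linarith [(Nat.ceil_lt_add_one (show 0 ≤ s by linarith)).le]
  have hjm : j ∈ Finset.Icc 2 J := by
    rw [Finset.mem_Icc]
    constructor
    · have : 1 ≤ ⌈s⌉₊ := Nat.one_le_ceil_iff.2 (by linarith)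
      omega
    · have : (j : ℝ) ≤ J := by
        calc (j : ℝ) ≤ 3 * s := h2
          _ ≤ 3 * (1 / ε) := by gcongr
          _ = 3 / ε := by ring
          _ ≤ J := hJ
      exact_mod_cast this
  have h3 : 16 * (L * s) ≤ ε * N := by
    refine abs_le_of_sq_le_sq' ?_ (by positivity) |>.2
    have h4 : 256 * (n * L) ≤ ε ^ 2 * N ^ 2 := by
      have : n * L = ε ^ 2 * (n * L / ε ^ 2) := by field_simp
      rw [this]
      have : 0 < ε ^ 2 := by positivity
      nlinarith
    calc (16 * (L * s)) ^ 2 = 256 * (n * L) := by rw [hnL]; ring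
      _ ≤ _ := by rw [mul_pow]; exact h4
  have h5 : 2 * n ≤ N := by
    have h6 : ε * n ≤ L * s := by
      rw [hnL]
      calc ε * (L * s ^ 2) = (s * ε) * (L * s) := by ring
        _ ≤ 1 * (L * s) := by gcongr
        _ = _ := one_mul _
    have h7 : ε * (2 * n) ≤ ε * N := by nlinarith
    exact le_of_mul_le_mul_left h7 hε0
  refine ⟨j, hjm, true, ?_⟩
  have h8 : T.noiseOf true = T.noise := rfl
  rw [h8]
  have h9 : T.noise / j ≤ L * s := by
    rw [div_le_iff₀ (by linarith)]
    calc T.noise ≤ L * s ^ 2 := hnoise.trans hnL.le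
      _ = L * s * s := by ring
      _ ≤ L * s * j := by gcongr
  have h10 : L * j ≤ 3 * (L * s) := by nlinarith
  have h11 : N / 2 ≤ T.hits := by linarith
  nlinarith

end

end search
end

/-! ### Failure probabilities, and halting after sufficiently many rounds. -/

noncomputable section

theorem two_pow_le_exp (k : ℕ) : (2 : ℝ) ^ k ≤ Real.exp k := by
  rw [← Real.exp_one_pow]
  gcongr
  linarith [Real.add_one_le_exp 1]

theorem exp_neg_le_two_pow (k : ℕ) : Real.exp (-k) ≤ 1 / 2 ^ k := by
  rw [Real.exp_neg, ← one_div]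
  gcongr
  exact two_pow_le_exp k

/-- The confidence level for the accuracy `ε`. -/
def level (ε : ℝ) : ℝ := 2 * Real.log (1 / ε) + 12

theorem level_ge {ε : ℝ} (hε0 : 0 < ε) (hε1 : ε ≤ 1) : 12 ≤ level ε := by
  have : 0 ≤ Real.log (1 / ε) := Real.log_nonneg (by rwa [le_div_iff₀ hε0, one_mul])
  unfold level
  linarith

/-- The factor ε² pays for the union bound over about 16 / ε scales and still leaves ε. -/
theorem exp_sub_level {ε : ℝ} (hε0 : 0 < ε) (x : ℝ) :
    Real.exp (x - level ε) = ε ^ 2 * Real.exp (x - 12) := by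
  have h : x - level ε = 2 * Real.log ε + (x - 12) := by
    rw [level, one_div, Real.log_inv]
    ring
  rw [h, Real.exp_add, two_mul, Real.exp_add, Real.exp_log hε0, sq]

theorem exp_neg_level_le {ε : ℝ} (hε0 : 0 < ε) (hε1 : ε ≤ 1) :
    8 * Real.exp (-level ε) ≤ ε / 8 := by
  have h := exp_sub_level hε0 0
  have h2 := exp_neg_le_two_pow 12
  push_cast at h2
  rw [zero_sub, zero_sub] at h
  rw [h]
  have h3 : ε ^ 2 ≤ ε := by nlinarith
  calc 8 * (ε ^ 2 * Real.exp (-12)) ≤ 8 * (ε * (1 / 2 ^ 12)) := by gcongr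
    _ ≤ ε / 8 := by linarith

namespace search

variable {α : ℝ} {h0 : 0 ≤ α} {h1 : α ≤ 1} {verdict : ℕ → Tally → Option ℝ} {G : IdGraph}

theorem exists_suffix {β : Type*} {h : List β} {N : ℕ} (hN : N ≤ h.length) :
    ∃ h', h' <:+ h ∧ h'.length = N :=
  ⟨h.drop (h.length - N), List.drop_suffix _ _, by rw [List.length_drop]; omega⟩

/-- It is unlikely that few nodes, but not all, are explored in many rounds. -/
theorem event_incomplete_le (hα1 : α < 1) {v : ℕ} (hv : v ∈ G.nodes) {k : ℕ} (hk : 1 ≤ k)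
    (t : ℕ) :
    ((search α h0 h1 verdict).run G v (2 + 5 * t)).toOuterMeasure
      (event α G v fun h => 16 * k ^ 2 ≤ h.length ∧ (G.info.explored α v h).card ≤ k ∧
        G.info.explored α v h ≠ G.nodes) ≤ ENNReal.ofReal (8 * Real.exp (-k)) := by
  have hk' : (1 : ℝ) ≤ k := by exact_mod_cast hk
  -- In a graph of at least 2 k nodes, exploring at most k is unlikely. The bound is applied with k
  -- + 1 since its event is strict.
  rcases le_total (2 * k) G.size with hn | hn
  · have h2 := event_explored_le (h0 := h0) (h1 := h1) (verdict := verdict) hα1 hv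
      (D := G.nodes) subset_rfl (k := k + 1) (by change _ ≤ G.size + 2; omega) (16 * k ^ 2) t
    refine (MeasureTheory.measure_mono ?_).trans (h2.trans (ENNReal.ofReal_le_ofReal ?_))
    · rintro c ⟨h, x, hr, hl, hc, -⟩
      obtain ⟨h', hs, hl'⟩ := exists_suffix hl
      refine ⟨h, x, hr, h', hs, hl', ?_⟩
      have h3 := Finset.card_le_card (explored_suffix (α := α) (G := G) (v := v) hs)
      have h4 := Finset.card_le_card
        (Finset.inter_subset_right (s₁ := G.nodes) (s₂ := G.info.explored α v h'))
      omega
    · have hn0 : (0 : ℝ) < G.size := by exact_mod_cast G.size_pos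
      have h3 : ((16 * k ^ 2 : ℕ) : ℝ) * G.nodes.card / (4 * G.size) = 4 * (k : ℝ) ^ 2 := by
        change ((16 * k ^ 2 : ℕ) : ℝ) * G.size / (4 * G.size) = _
        push_cast
        field_simp
        ring
      rw [h3]
      calc 2 * 2 ^ (k + 1) * Real.exp (-(4 * (k : ℝ) ^ 2))
          = 4 * (2 ^ k * Real.exp (-(4 * (k : ℝ) ^ 2))) := by ring
        _ ≤ 4 * (Real.exp k * Real.exp (-(4 * (k : ℝ) ^ 2))) := by
            gcongr
            exact two_pow_le_exp k
        _ = 4 * Real.exp (k - 4 * (k : ℝ) ^ 2) := by rw [← Real.exp_add]; ring_nf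
        _ ≤ 4 * Real.exp (-k) := by
            gcongr
            nlinarith
        _ ≤ 8 * Real.exp (-k) := by linarith [Real.exp_pos (-(k : ℝ))]
  -- In a graph of at most 2 k nodes, a union bound over the possibly missing node works: it is
  -- drawn with probability at least 1 / (2 k) in each of the 16 k ^ 2 rounds.
  · have hsub : (event α G v fun h => 16 * k ^ 2 ≤ h.length ∧ (G.info.explored α v h).card ≤ k ∧
        G.info.explored α v h ≠ G.nodes) ⊆ ⋃ u ∈ G.nodes, event α G v fun h =>
          ∃ h', h' <:+ h ∧ h'.length = 16 * k ^ 2 ∧ ({u} ∩ G.info.explored α v h').card < 1 := by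
      rintro c ⟨h, x, hr, hl, -, hne⟩
      obtain ⟨u, hu, hu'⟩ : ∃ u ∈ G.nodes, u ∉ G.info.explored α v h := by
        by_contra! hcon
        exact hne (subset_antisymm hr.explored_subset hcon)
      obtain ⟨h', hs, hl'⟩ := exists_suffix hl
      simp only [Set.mem_iUnion]
      refine ⟨u, hu, h, x, hr, h', hs, hl', ?_⟩
      rw [Nat.lt_one_iff, Finset.card_eq_zero, Finset.singleton_inter_of_notMem]
      exact fun h => hu' (explored_suffix hs h)
    refine (MeasureTheory.measure_mono hsub).trans
      ((MeasureTheory.measure_biUnion_finset_le _ _).trans ?_)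
    have hn0 : (0 : ℝ) < G.size := by exact_mod_cast G.size_pos
    have hn' : (G.size : ℝ) ≤ 2 * k := by exact_mod_cast hn
    have h2 : ∀ u ∈ G.nodes, ((search α h0 h1 verdict).run G v (2 + 5 * t)).toOuterMeasure
        (event α G v fun h => ∃ h', h' <:+ h ∧ h'.length = 16 * k ^ 2 ∧
          ({u} ∩ G.info.explored α v h').card < 1) ≤ ENNReal.ofReal (4 * Real.exp (-(2 * k))) := by
      intro u hu
      refine (event_explored_le hα1 hv (D := {u}) (by simpa using hu) (k := 1) (by simp)
        (16 * k ^ 2) t).trans (ENNReal.ofReal_le_ofReal ?_)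
      rw [Finset.card_singleton]
      have h3 : 2 * (k : ℝ) ≤ ((16 * k ^ 2 : ℕ) : ℝ) * (1 : ℕ) / (4 * G.size) := by
        rw [le_div_iff₀ (by positivity)]
        push_cast
        nlinarith
      calc 2 * 2 ^ 1 * Real.exp (-(((16 * k ^ 2 : ℕ) : ℝ) * (1 : ℕ) / (4 * G.size)))
          ≤ 2 * 2 ^ 1 * Real.exp (-(2 * k)) := by gcongr
        _ = _ := by norm_num
    refine (Finset.sum_le_sum h2).trans ?_
    rw [Finset.sum_const, nsmul_eq_mul, ← ENNReal.ofReal_natCast,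
      ← ENNReal.ofReal_mul (Nat.cast_nonneg _)]
    refine ENNReal.ofReal_le_ofReal ?_
    change (G.size : ℝ) * _ ≤ _
    have h3 : (k : ℝ) ≤ Real.exp k := by linarith [Real.add_one_le_exp (k : ℝ)]
    calc (G.size : ℝ) * (4 * Real.exp (-(2 * k))) ≤ (2 * Real.exp k) * (4 * Real.exp (-(2 * k))) := by
          gcongr
          linarith
      _ = 8 * (Real.exp k * Real.exp (-(2 * k))) := by ring
      _ = 8 * Real.exp (-k) := by
          rw [← Real.exp_add]
          ring_nf

/-- It is unlikely that few nodes are explored. -/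
theorem event_few_le (hα1 : α < 1) {v : ℕ} (hv : v ∈ G.nodes) (N t : ℕ) :
    ((search α h0 h1 verdict).run G v (2 + 5 * t)).toOuterMeasure
      (event α G v fun h => ∃ h', h' <:+ h ∧ h'.length = N ∧
        (G.info.explored α v h').card < min (N / 8) (G.size / 2 + 1))
      ≤ ENNReal.ofReal (2 * Real.exp (-(N / 8))) := by
  -- The number n / 2 + 1 is the largest threshold for which half of the nodes are still unexplored
  -- below it.
  have h2 := event_explored_le (h0 := h0) (h1 := h1) (verdict := verdict) hα1 hv
      (D := G.nodes) subset_rfl (k := min (N / 8) (G.size / 2 + 1))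
      (by change _ ≤ G.size + 2; omega) N t
  refine (MeasureTheory.measure_mono ?_).trans (h2.trans (ENNReal.ofReal_le_ofReal ?_))
  · rintro c ⟨h, x, hr, h', hs, hl, hc⟩
    refine ⟨h, x, hr, h', hs, hl, ?_⟩
    exact (Finset.card_le_card Finset.inter_subset_right).trans_lt hc
  · have hn0 : (0 : ℝ) < G.size := by exact_mod_cast G.size_pos
    have h3 : (N : ℝ) * G.nodes.card / (4 * G.size) = N / 4 := by
      change (N : ℝ) * G.size / (4 * G.size) = _
      field_simp
    have h4 : ((min (N / 8) (G.size / 2 + 1) : ℕ) : ℝ) ≤ N / 8 := by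
      calc ((min (N / 8) (G.size / 2 + 1) : ℕ) : ℝ) ≤ ((N / 8 : ℕ) : ℝ) := by
            exact_mod_cast min_le_left _ _
        _ ≤ N / 8 := by exact_mod_cast Nat.cast_div_le (α := ℝ)
    rw [h3, mul_assoc]
    calc _ ≤ 2 * (Real.exp (min (N / 8) (G.size / 2 + 1) : ℕ) * Real.exp (-(N / 4))) := by
          gcongr
          exact two_pow_le_exp _
      _ = 2 * Real.exp (((min (N / 8) (G.size / 2 + 1) : ℕ) : ℝ) - N / 4) := by
          rw [← Real.exp_add]
          ring_nf
      _ ≤ _ := by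
          gcongr
          linarith

/-- It is unlikely that the outdegree of a node is much larger than its number of explored
children. -/
theorem event_degree_le (hα1 : α < 1) {v : ℕ} (hv : v ∈ G.nodes) {N : ℕ} (hN : 0 < N) {q U : ℝ}
    (hq : 4 ≤ q) (hU2 : 2 ≤ U) (hU : 8 * (G.size / N) * q ≤ U) (t : ℕ) :
    ((search α h0 h1 verdict).run G v (2 + 5 * t)).toOuterMeasure
      (event α G v fun h => ∃ h', h' <:+ h ∧ h'.length = N ∧ ∃ w ∈ G.nodes,
        U * max 1 ((G.children w ∩ G.info.explored α v h').card : ℝ) < G.outdegree w)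
      ≤ ENNReal.ofReal (G.size * (2 * Real.exp (-q))) := by
  have hn0 : (0 : ℝ) < G.size := by exact_mod_cast G.size_pos
  have hN0 : (0 : ℝ) < N := by exact_mod_cast hN
  have hU0 : 0 < U := by linarith
  classical
  -- Nodes of outdegree at most U satisfy the condition trivially because of the maximum with 1.
  set D : Finset ℕ := G.nodes.filter fun w => U < G.outdegree w with hD
  have hsub : (event α G v fun h => ∃ h', h' <:+ h ∧ h'.length = N ∧ ∃ w ∈ G.nodes,
        U * max 1 ((G.children w ∩ G.info.explored α v h').card : ℝ) < G.outdegree w)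
      ⊆ ⋃ w ∈ D, event α G v fun h => ∃ h', h' <:+ h ∧ h'.length = N ∧
        (G.children w ∩ G.info.explored α v h').card < ⌈(G.outdegree w : ℝ) / U⌉₊ := by
    rintro c ⟨h, x, hr, h', hs, hl, w, hw, hlt⟩
    simp only [Set.mem_iUnion]
    refine ⟨w, ?_, h, x, hr, h', hs, hl, ?_⟩
    · rw [hD, Finset.mem_filter]
      refine ⟨hw, lt_of_le_of_lt ?_ hlt⟩
      exact le_mul_of_one_le_right hU0.le (le_max_left _ _)
    · rw [Nat.lt_ceil, lt_div_iff₀ hU0]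
      refine lt_of_le_of_lt ?_ hlt
      rw [mul_comm]
      gcongr
      exact le_max_right _ _
  refine (MeasureTheory.measure_mono hsub).trans
    ((MeasureTheory.measure_biUnion_finset_le _ _).trans ?_)
  have h2 : ∀ w ∈ D, ((search α h0 h1 verdict).run G v (2 + 5 * t)).toOuterMeasure
      (event α G v fun h => ∃ h', h' <:+ h ∧ h'.length = N ∧
        (G.children w ∩ G.info.explored α v h').card < ⌈(G.outdegree w : ℝ) / U⌉₊)
      ≤ ENNReal.ofReal (2 * Real.exp (-q)) := by
    intro w hw
    obtain ⟨-, hwU⟩ := Finset.mem_filter.1 hw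
    set d : ℝ := (G.outdegree w : ℝ) with hd
    have hd0 : 0 < d := hU0.trans hwU
    have hceil : (⌈d / U⌉₊ : ℝ) ≤ d / U + 1 := (Nat.ceil_lt_add_one (by positivity)).le
    have hdU : 1 ≤ d / U := by rw [le_div_iff₀ hU0]; linarith
    have hdU2 : d / U ≤ d / 2 := by gcongr
    have hk : 2 * ⌈d / U⌉₊ ≤ (G.children w).card + 2 := by
      have : 2 * (⌈d / U⌉₊ : ℝ) ≤ G.outdegree w + 2 := by linarith
      exact_mod_cast this
    refine (event_explored_le hα1 hv (G.children_subset w) hk N t).trans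
      (ENNReal.ofReal_le_ofReal ?_)
    have h3 : d / U * q ≤ N * d / (8 * G.size) := by
      rw [div_mul_eq_mul_div, div_le_div_iff₀ hU0 (by positivity)]
      have h4 : 8 * G.size * q ≤ N * U := by
        calc 8 * G.size * q = N * (8 * (G.size / N) * q) := by field_simp
          _ ≤ N * U := by gcongr
      nlinarith
    have h5 : N * ((G.children w).card : ℝ) / (4 * G.size) = 2 * (N * d / (8 * G.size)) := by
      change N * d / (4 * G.size) = _
      field_simp
      ring
    rw [h5, mul_assoc]
    calc _ ≤ 2 * (Real.exp ⌈d / U⌉₊ * Real.exp (-(2 * (N * d / (8 * G.size))))) := by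
          gcongr
          exact two_pow_le_exp _
      _ = 2 * Real.exp (⌈d / U⌉₊ - 2 * (N * d / (8 * G.size))) := by
          rw [← Real.exp_add]
          ring_nf
      _ ≤ 2 * Real.exp (-q) := by
          gcongr
          nlinarith
  refine (Finset.sum_le_sum h2).trans ?_
  rw [Finset.sum_const, nsmul_eq_mul, ← ENNReal.ofReal_natCast,
    ← ENNReal.ofReal_mul (Nat.cast_nonneg _)]
  refine ENNReal.ofReal_le_ofReal ?_
  have h3 : (D.card : ℝ) ≤ G.size := by exact_mod_cast Finset.card_le_card (Finset.filter_subset _ _)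
  gcongr

/-- The rule of the search for the accuracy `ε`. -/
def ruleOf (α ε : ℝ) : ℕ → Tally → Option ℝ :=
  rule α ε (level ε) ⌈16 / ε⌉₊ (16 * ⌈level ε⌉₊ ^ 2) ⌈level ε⌉₊

/-- The hits are close to their mean, at all scales. -/
def Regular (α ε : ℝ) (G : IdGraph) (v : ℕ) (h : List (ℕ × ℕ)) : Prop :=
  ∀ j ∈ Finset.Icc 2 ⌈16 / ε⌉₊, ∀ f,
    |(G.info.tally α v h).hits - G.rank α v * (G.info.tally α v h).mass|
      ≤ (G.info.tally α v h).noiseOf f / j + level ε * j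

theorem event_not_regular_le (hα1 : α < 1) {v : ℕ} (hv : v ∈ G.nodes) {ε : ℝ} (hε0 : 0 < ε)
    (hε1 : ε ≤ 1) (t : ℕ) :
    ((search α h0 h1 verdict).run G v (2 + 5 * t)).toOuterMeasure
      (event α G v fun h => ¬ Regular α ε G v h) ≤ ENNReal.ofReal (ε / 8) := by
  have h2 := event_deviation_le (h0 := h0) (h1 := h1) (verdict := verdict) hα1 hv ⌈16 / ε⌉₊
    (level ε) t
  unfold Regular
  push Not
  refine h2.trans (ENNReal.ofReal_le_ofReal ?_)
  have h3 : (⌈16 / ε⌉₊ : ℝ) ≤ 17 / ε := by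
    have h3 := (Nat.ceil_lt_add_one (show 0 ≤ 16 / ε by positivity)).le
    have h4 : 1 ≤ 1 / ε := by rwa [le_div_iff₀ hε0, one_mul]
    calc (⌈16 / ε⌉₊ : ℝ) ≤ 16 / ε + 1 := h3
      _ ≤ 16 / ε + 1 / ε := by gcongr
      _ = 17 / ε := by ring
  have h5 := exp_neg_le_two_pow 11
  push_cast at h5
  rw [exp_sub_level hε0, show (1 : ℝ) - 12 = -11 by norm_num]
  calc _ ≤ 4 * (17 / ε) * (ε ^ 2 * (1 / 2 ^ 11)) := by gcongr
    _ = ε * (68 / 2 ^ 11) := by field_simp; norm_num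
    _ ≤ ε / 8 := by linarith

/-- It is unlikely that the output of the search is not accurate. -/
theorem event_wrong_le (hα1 : α < 1) {v : ℕ} (hv : v ∈ G.nodes) {ε : ℝ} (hε0 : 0 < ε)
    (hε1 : ε ≤ 1) (t : ℕ) :
    ((search α h0 h1 (ruleOf α ε)).run G v (2 + 5 * t)).toOuterMeasure
      (event α G v fun h => ∃ r, ruleOf α ε v (G.info.tally α v h) = some r ∧
        r ∉ Set.Icc ((1 - ε) * G.rank α v) ((1 + ε) * G.rank α v)) ≤ ENNReal.ofReal (ε / 4) := by
  have hL := level_ge hε0 hε1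
  have hk : 1 ≤ ⌈level ε⌉₊ := Nat.one_le_ceil_iff.2 (by linarith)
  have hP := G.rank_pos h0 hα1 hv
  have hsub : (event α G v fun h => ∃ r, ruleOf α ε v (G.info.tally α v h) = some r ∧
        r ∉ Set.Icc ((1 - ε) * G.rank α v) ((1 + ε) * G.rank α v))
      ⊆ (event α G v fun h => ¬ Regular α ε G v h) ∪
        event α G v fun h => 16 * ⌈level ε⌉₊ ^ 2 ≤ h.length ∧
          (G.info.explored α v h).card ≤ ⌈level ε⌉₊ ∧ G.info.explored α v h ≠ G.nodes := by
    rintro c ⟨h, x, hr, r, hrule, hnot⟩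
    by_cases hreg : Regular α ε G v h
    · right
      refine ⟨h, x, hr, ?_⟩
      unfold ruleOf rule at hrule
      split_ifs at hrule with h2 h3
      · obtain rfl := Option.some.inj hrule
        exact absurd (rule_rank hP hε0 hε1 (by linarith)
          (noiseOf_nonneg h0 hα1 hr.explored_subset) hreg h2) hnot
      · obtain rfl := Option.some.inj hrule
        rw [Info.tally_rounds] at h3
        refine ⟨h3.1, h3.2, fun hall => hnot ?_⟩
        rw [(sees_tally hr.explored_subset).closed_score h0 hα1 (Info.mem_explored h) hall]
        constructor <;> nlinarith
    · exact Or.inl ⟨h, x, hr, hreg⟩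
  refine (MeasureTheory.measure_mono hsub).trans ((MeasureTheory.measure_union_le _ _).trans ?_)
  refine (add_le_add (event_not_regular_le hα1 hv hε0 hε1 t)
    (event_incomplete_le hα1 hv hk t)).trans ?_
  have h2 : 8 * Real.exp (-(⌈level ε⌉₊ : ℝ)) ≤ ε / 8 := by
    refine le_trans ?_ (exp_neg_level_le hε0 hε1)
    gcongr
    exact Nat.le_ceil _
  rw [← ENNReal.ofReal_add (by positivity) (by positivity)]
  exact ENNReal.ofReal_le_ofReal (by linarith)

set_option maxHeartbeats 800000 in
/-- The rule applies after sufficiently many rounds. -/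
theorem ruleOf_ne_none (h0 : 0 ≤ α) (hα1 : α < 1) {v : ℕ} (hv : v ∈ G.nodes) {ε : ℝ}
    (hε0 : 0 < ε) (hε1 : ε ≤ 1)
    {h : List (ℕ × ℕ)} (hsub : G.info.explored α v h ⊆ G.nodes) (hreg : Regular α ε G v h)
    {N : ℕ} (hN : 16 * ⌈level ε⌉₊ ^ 2 ≤ N) (hl : 2 * N ≤ h.length) {K U : ℝ}
    (hK : 1152 / (1 - α) ≤ K)
    (hcase : 36 * (level ε / ε ^ 2) ≤ G.rank α v * (N * (1 - α)) ∨ (0 ≤ U ∧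
      (∀ h', h' <:+ h → h'.length = N →
        min (N / 8) (G.size / 2 + 1) ≤ (G.info.explored α v h').card ∧ ∀ w ∈ G.nodes,
        (G.outdegree w : ℝ) ≤ U * max 1 ((G.children w ∩ G.info.explored α v h').card : ℝ)) ∧
      K ^ 2 * (G.size * (level ε / ε ^ 2)) ≤ N ^ 2 ∧
      72 * (G.size * U * (level ε / ε ^ 2)) ≤ (1 - α) * N ^ 2)) :
    ruleOf α ε v (G.info.tally α v h) ≠ none := by
  have hL := level_ge hε0 hε1
  have hβ : 0 < 1 - α := by linarith
  have hn0 : (0 : ℝ) < G.size := by exact_mod_cast G.size_pos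
  have hP := G.rank_pos h0 hα1 hv
  have hl' : 2 * (N : ℝ) ≤ h.length := by exact_mod_cast hl
  have hk1 : 12 ≤ ⌈level ε⌉₊ := by
    have : (12 : ℝ) ≤ ⌈level ε⌉₊ := hL.trans (Nat.le_ceil _)
    exact_mod_cast this
  have hN16 : 16 ≤ N := by nlinarith
  have hN0 : (16 : ℝ) ≤ N := by exact_mod_cast hN16
  set Y := level ε / ε ^ 2 with hY
  have hY0 : 0 < Y := by positivity
  have hJ1 : 16 / ε ≤ ⌈16 / ε⌉₊ := Nat.le_ceil _
  have h1ε : 1 ≤ 1 / ε := by rwa [le_div_iff₀ hε0, one_mul]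
  have hJε : 16 / ε = 16 * (1 / ε) := by ring
  intro hnone
  have hno : ¬ ∃ j ∈ Finset.Icc 2 ⌈16 / ε⌉₊, ∃ f, (G.info.tally α v h).noiseOf f / j + level ε * j
      ≤ ε / 2 * (G.info.tally α v h).hits := by
    intro h2
    rw [ruleOf, rule, if_pos h2] at hnone
    exact absurd hnone (by simp)
  have hno2 : ⌈level ε⌉₊ < (G.info.explored α v h).card := by
    by_contra! h2
    rw [ruleOf, rule, if_neg hno, Info.tally_rounds, if_pos ⟨by omega, h2⟩] at hnone
    exact absurd hnone (by simp)
  have hmass : G.rank α v * (G.info.tally α v h).mass < 36 * Y := by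
    by_contra! h2
    refine hno (rule_of_mass hε0 hε1 (by linarith) ?_ hreg (hits_noise_nonneg h0 hα1 hsub).1 ?_)
    · have : 8 / ε = 8 * (1 / ε) := by ring
      linarith
    · rwa [mul_div_assoc]
  rcases hcase with hcase | ⟨hU, hsuf, hKN, hUN⟩
  · have h2 := le_mass h0 hα1 (G := G) (v := v) h
    have h3 : (N : ℝ) * (1 - α) ≤ (G.info.tally α v h).mass := by nlinarith
    have h4 := mul_le_mul_of_nonneg_left h3 hP.le
    linarith
  -- As the second branch of the rule does not fire either, the graph has enough nodes for
  -- `rule_of_noise`.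
  have hnL : level ε ≤ G.size := by
    have h2 := Finset.card_le_card hsub
    have h3 : ⌈level ε⌉₊ ≤ G.size := hno2.le.trans h2
    exact (Nat.le_ceil _).trans (by exact_mod_cast h3)
  have hK1 : 1152 ≤ K := by
    refine le_trans ?_ hK
    rw [le_div_iff₀ hβ]
    linarith
  -- In a small graph the noise is at most n. In a large one the first N rounds provide the explored
  -- nodes, and the later rounds the mass.
  rcases le_total (G.size : ℝ) Y with hnY | hnY
  · have hcard : ((G.info.explored α v h).card : ℝ) ≤ G.size := by
      exact_mod_cast Finset.card_le_card hsub
    obtain ⟨h2, h3⟩ := noise_le_card h0 hα1 hsub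
    refine hno (rule_of_noise (n := G.size) (N := h.length) hε0 (by linarith) hnL hnY ?_
      (h2.trans hcard) (by linarith) ?_ (Nat.cast_nonneg _))
    · have : 3 / ε = 3 * (1 / ε) := by ring
      linarith
    · rw [mul_div_assoc, ← hY]
      have h4 : (256 : ℝ) ≤ K ^ 2 := by nlinarith
      have h5 : 256 * (G.size * Y) ≤ K ^ 2 * (G.size * Y) := by gcongr
      have h6 : (N : ℝ) ^ 2 ≤ (h.length : ℝ) ^ 2 := by
        gcongr
        linarith
      linarith
  · obtain ⟨h', hs, hlen⟩ := exists_suffix (h := h) (N := N) (by omega)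
    obtain ⟨hcard, hdeg⟩ := hsuf h' hs hlen
    have hsq := sq_le_mass_mul h0 hα1 hU hs hsub hdeg
    rw [hlen] at hsq
    set d : ℝ := h.length - N with hd
    have hdN : (N : ℝ) ≤ d := by linarith
    have hd0 : 0 < d := by linarith
    set s : ℝ := ((G.info.explored α v h').card : ℝ) with hs'
    have hs0 : 0 < s := by
      rw [hs']
      exact_mod_cast Finset.card_pos.2 ⟨v, Info.mem_explored h'⟩
    have hKβ : 1152 ≤ K * (1 - α) := by rwa [div_le_iff₀ hβ] at hK
    -- The terms U and d / s are each to account for half of the bound 36 Y on P * mass, hence 72 =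
    -- 2 * 36; and 1152 = 16 * 72 absorbs the loss N ≤ 16 s from rounding N / 8 down.
    have hsd : 72 * (G.size * Y) ≤ (1 - α) * d * s := by
      rcases le_total (N / 8) (G.size / 2 + 1) with hmin | hmin
      · rw [min_eq_left hmin] at hcard
        have h2 : (N : ℝ) ≤ 16 * s := by
          have h3 : N ≤ 16 * (G.info.explored α v h').card := by omega
          rw [hs']
          exact_mod_cast h3
        have h4 : K * (1152 * (G.size * Y)) ≤ K * ((1 - α) * (N : ℝ) ^ 2) := by
          calc K * (1152 * (G.size * Y)) ≤ K * ((K * (1 - α)) * (G.size * Y)) := by gcongr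
            _ = (1 - α) * (K ^ 2 * (G.size * Y)) := by ring
            _ ≤ (1 - α) * N ^ 2 := by gcongr
            _ ≤ K * ((1 - α) * (N : ℝ) ^ 2) := by
                refine le_mul_of_one_le_left (by positivity) (by linarith)
        have h5 := le_of_mul_le_mul_left h4 (by linarith)
        have h6 : (N : ℝ) * N ≤ d * (16 * s) := by gcongr
        have h7 : (1 - α) * ((N : ℝ) * N) ≤ (1 - α) * (d * (16 * s)) := by gcongr
        nlinarith
      · rw [min_eq_right hmin] at hcard
        have h2 : (G.size : ℝ) ≤ 2 * s := by
          have h3 : G.size ≤ 2 * (G.info.explored α v h').card := by omega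
          rw [hs']
          exact_mod_cast h3
        have h4 : K * Y ≤ N := by
          refine abs_le_of_sq_le_sq' ?_ (by positivity) |>.2
          calc (K * Y) ^ 2 = K ^ 2 * (Y * Y) := by ring
            _ ≤ K ^ 2 * (G.size * Y) := by gcongr
            _ ≤ N ^ 2 := hKN
        have h5 : 1152 * Y ≤ (1 - α) * d := by
          calc 1152 * Y ≤ K * (1 - α) * Y := by gcongr
            _ = (1 - α) * (K * Y) := by ring
            _ ≤ (1 - α) * d := by gcongr; linarith
        calc 72 * (G.size * Y) ≤ 72 * ((2 * s) * Y) := by gcongr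
          _ ≤ 1152 * Y * s := by nlinarith [mul_pos hs0 hY0]
          _ ≤ (1 - α) * d * s := by gcongr
    have hUd : 72 * (G.size * U * Y) ≤ (1 - α) * d ^ 2 := by
      refine hUN.trans ?_
      gcongr
    have h2 : (1 - α) * d ^ 2
        ≤ G.rank α v * (G.info.tally α v h).mass * (G.size * (U + d / s)) := by
      calc (1 - α) * d ^ 2 ≤ (1 - α) * ((G.info.tally α v h).mass
            * ((U + d / s) * (G.size * G.rank α v / (1 - α)))) := by gcongr
        _ = _ := by field_simp
    have h3 : G.rank α v * (G.info.tally α v h).mass * (G.size * (U + d / s))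
        < 36 * Y * (G.size * (U + d / s)) := by
      have : 0 < d / s := by positivity
      gcongr
    have h4 : 72 * (G.size * Y) * (d / s) ≤ (1 - α) * d ^ 2 := by
      calc 72 * (G.size * Y) * (d / s) ≤ (1 - α) * d * s * (d / s) := by gcongr
        _ = _ := by field_simp
    have h5 : 36 * Y * (G.size * (U + d / s))
        = (72 * (G.size * U * Y) + 72 * (G.size * Y) * (d / s)) / 2 := by ring
    linarith

end search
end

/-! ### Accuracy of the search in terms of its number of rounds. -/

noncomputable section

namespace search

variable {α : ℝ} {h0 : 0 ≤ α} {h1 : α ≤ 1} {G : IdGraph}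

/-- It is unlikely that the search has not halted after sufficiently many queries. -/
theorem event_none_le (hα1 : α < 1) {v : ℕ} (hv : v ∈ G.nodes) {ε : ℝ} (hε0 : 0 < ε)
    (hε1 : ε ≤ 1) {N t : ℕ} (hN : 16 * ⌈level ε⌉₊ ^ 2 ≤ N)
    (ht : ((1 + α) / 2) ^ t * 2 ^ (2 * N) ≤ ε / 8)
    (hcase : 36 * (level ε / ε ^ 2) ≤ G.rank α v * (N * (1 - α)) ∨ ∃ U : ℝ, 0 ≤ U ∧
      (1152 / (1 - α)) ^ 2 * (G.size * (level ε / ε ^ 2)) ≤ N ^ 2 ∧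
      72 * (G.size * U * (level ε / ε ^ 2)) ≤ (1 - α) * N ^ 2 ∧
      ((search α h0 h1 (ruleOf α ε)).run G v (2 + 5 * t)).toOuterMeasure
        (event α G v fun h => ∃ h', h' <:+ h ∧ h'.length = N ∧ ∃ w ∈ G.nodes,
          U * max 1 ((G.children w ∩ G.info.explored α v h').card : ℝ) < G.outdegree w)
        ≤ ENNReal.ofReal (ε / 8)) :
    ((search α h0 h1 (ruleOf α ε)).run G v (2 + 5 * t)).toOuterMeasure
      (event α G v fun h => ruleOf α ε v (G.info.tally α v h) = none)
      ≤ ENNReal.ofReal (ε / 2) := by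
  have hreg := event_not_regular_le (h0 := h0) (h1 := h1) (verdict := ruleOf α ε) hα1 hv hε0 hε1 t
  have hround := (event_rounds_le (h0 := h0) (h1 := h1) (verdict := ruleOf α ε) hv (2 * N) t).trans
    (ENNReal.ofReal_le_ofReal ht)
  have hfew := event_few_le (h0 := h0) (h1 := h1) (verdict := ruleOf α ε) hα1 hv N t
  have hL := level_ge hε0 hε1
  have hNL : 8 * level ε ≤ N := by
    have h2 := Nat.le_ceil (level ε)
    have h3 : (16 : ℝ) * (⌈level ε⌉₊ : ℝ) ^ 2 ≤ N := by exact_mod_cast hN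
    nlinarith
  have hfew' : 2 * Real.exp (-(N / 8)) ≤ ε / 8 := by
    refine le_trans ?_ (exp_neg_level_le hε0 hε1)
    gcongr
    · norm_num
    · linarith
  have hfew := hfew.trans (ENNReal.ofReal_le_ofReal hfew')
  -- Four causes of failure: too few rounds, irregular hits, too few explored nodes, badly sampled
  -- children.
  have hsum : ENNReal.ofReal (ε / 8) + ENNReal.ofReal (ε / 8)
      + (ENNReal.ofReal (ε / 8) + ENNReal.ofReal (ε / 8)) = ENNReal.ofReal (ε / 2) := by
    rw [← ENNReal.ofReal_add (by positivity) (by positivity),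
      ← ENNReal.ofReal_add (by positivity) (by positivity)]
    ring_nf
  rcases hcase with hcase | ⟨U, hU, hK, hUN, hdeg⟩
  · refine (MeasureTheory.measure_mono ?_).trans ((MeasureTheory.measure_union_le _ _).trans
      ((add_le_add hround hreg).trans (hsum ▸ le_self_add)))
    rintro c ⟨h, x, hr, hnone⟩
    by_contra hc
    simp only [Set.mem_union, not_or] at hc
    have hl : 2 * N ≤ h.length := by
      by_contra! hlt
      exact hc.1 ⟨h, x, hr, hnone, hlt.le⟩
    have hg : Regular α ε G v h := by
      by_contra hg
      exact hc.2 ⟨h, x, hr, hg⟩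
    exact ruleOf_ne_none (U := 0) h0 hα1 hv hε0 hε1 hr.explored_subset hg hN hl le_rfl
      (Or.inl hcase) hnone
  · refine (MeasureTheory.measure_mono ?_).trans ((MeasureTheory.measure_union_le
      (_ ∪ _) (_ ∪ _)).trans ((add_le_add ((MeasureTheory.measure_union_le _ _).trans
        (add_le_add hround hreg)) ((MeasureTheory.measure_union_le _ _).trans
        (add_le_add hfew hdeg))).trans hsum.le))
    rintro c ⟨h, x, hr, hnone⟩
    by_contra hc
    simp only [Set.mem_union, not_or] at hc
    obtain ⟨⟨hc1, hc2⟩, hc3, hc4⟩ := hc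
    have hl : 2 * N ≤ h.length := by
      by_contra! hlt
      exact hc1 ⟨h, x, hr, hnone, hlt.le⟩
    have hg : Regular α ε G v h := by
      by_contra hg
      exact hc2 ⟨h, x, hr, hg⟩
    refine ruleOf_ne_none (U := U) h0 hα1 hv hε0 hε1 hr.explored_subset hg hN hl le_rfl
      (Or.inr ⟨hU, fun h' hs hlen => ⟨?_, fun w hw => ?_⟩, hK, hUN⟩) hnone
    · by_contra! hlt
      exact hc3 ⟨h, x, hr, h', hs, hlen, hlt⟩
    · by_contra! hlt
      exact hc4 ⟨h, x, hr, h', hs, hlen, w, hw, hlt⟩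

/-- If it is likely that the search has halted, then it is likely that its output is accurate. -/
theorem le_outputProb (hα1 : α < 1) {v : ℕ} (hv : v ∈ G.nodes) {ε : ℝ} (hε0 : 0 < ε)
    (hε1 : ε ≤ 1) {t : ℕ}
    (hnone : ((search α h0 h1 (ruleOf α ε)).run G v (2 + 5 * t)).toOuterMeasure
      (event α G v fun h => ruleOf α ε v (G.info.tally α v h) = none)
      ≤ ENNReal.ofReal (ε / 2)) :
    ENNReal.ofReal (1 - ε) ≤ (search α h0 h1 (ruleOf α ε)).outputProb G v (2 + 5 * t)
      (Set.Icc ((1 - ε) * G.rank α v) ((1 + ε) * G.rank α v)) := by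
  have hwrong := event_wrong_le (h0 := h0) (h1 := h1) hα1 hv hε0 hε1 t
  set p := (search α h0 h1 (ruleOf α ε)).run G v (2 + 5 * t) with hp
  set S := Set.Icc ((1 - ε) * G.rank α v) ((1 + ε) * G.rank α v) with hS
  set E : Set (SearchState × Finset ℕ) :=
    event α G v fun h => ruleOf α ε v (G.info.tally α v h) = none with hE
  set F : Set (SearchState × Finset ℕ) :=
    event α G v fun h => ∃ r, ruleOf α ε v (G.info.tally α v h) = some r ∧ r ∉ S with hF
  set O : Set (SearchState × Finset ℕ) :=
    {c | ∃ x ∈ S, (search α h0 h1 (ruleOf α ε)).act c.1 = QueryAction.output x} with hO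
  change _ ≤ p.toOuterMeasure O
  have htotal : 1 ≤ p.toOuterMeasure O + (p.toOuterMeasure E + p.toOuterMeasure F) := by
    simp only [PMF.toOuterMeasure_eq_expect]
    rw [← PMF.expect_add, ← PMF.expect_add, ← PMF.expect_one p]
    refine PMF.expect_mono fun c hc => ?_
    obtain ⟨h, x, hr⟩ := ready_run hv t c hc
    obtain ⟨I, hs, hI⟩ := hr.state
    rcases hrule : ruleOf α ε v (G.info.tally α v h) with _ | r
    · have hm : c ∈ E := ⟨h, x, hr, hrule⟩
      rw [Set.indicator_of_mem hm, Pi.one_apply]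
      exact le_self_add.trans le_add_self
    · by_cases hrS : r ∈ S
      · have hm : c ∈ O := by
          refine ⟨r, hrS, ?_⟩
          rw [hs, act_idle, Info.tally_congr hI, hrule]
          rfl
        rw [Set.indicator_of_mem hm, Pi.one_apply]
        exact le_self_add
      · have hm : c ∈ F := ⟨h, x, hr, r, hrule, hrS⟩
        rw [Set.indicator_of_mem hm, Pi.one_apply]
        exact le_add_self.trans le_add_self
  have hbad : p.toOuterMeasure E + p.toOuterMeasure F ≤ ENNReal.ofReal ε := by
    refine (add_le_add hnone hwrong).trans ?_
    rw [← ENNReal.ofReal_add (by positivity) (by positivity)]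
    exact ENNReal.ofReal_le_ofReal (by linarith)
  rw [ENNReal.ofReal_sub _ hε0.le, ENNReal.ofReal_one]
  exact tsub_le_iff_right.2 (htotal.trans (by gcongr))

/-- The search is accurate if its number of queries is large compared to the number `N` of rounds
in which the rule is met. -/
theorem le_outputProb_of_rounds (hα1 : α < 1) {v : ℕ} (hv : v ∈ G.nodes) {ε : ℝ} (hε0 : 0 < ε)
    (hε1 : ε ≤ 1) {N t : ℕ} (hN : 16 * ⌈level ε⌉₊ ^ 2 ≤ N)
    (ht : ((1 + α) / 2) ^ t * 2 ^ (2 * N) ≤ ε / 8) {γ : ℕ} (hγ : 1 ≤ γ)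
    (hdeg : ∀ w ∈ G.nodes, G.outdegree w ≤ γ)
    (hcase : 36 * (level ε / ε ^ 2) ≤ G.rank α v * (N * (1 - α)) ∨
      ((1152 / (1 - α)) ^ 2 * (G.size * (level ε / ε ^ 2)) ≤ N ^ 2 ∧
        1152 / (1 - α) * (G.size ^ 2 * (Real.log G.size + level ε) * (level ε / ε ^ 2))
          ≤ N ^ 3) ∨
      (1152 / (1 - α)) ^ 2 * (G.size * γ * (level ε / ε ^ 2)) ≤ N ^ 2) :
    ENNReal.ofReal (1 - ε) ≤ (search α h0 h1 (ruleOf α ε)).outputProb G v (2 + 5 * t)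
      (Set.Icc ((1 - ε) * G.rank α v) ((1 + ε) * G.rank α v)) := by
  refine le_outputProb hα1 hv hε0 hε1 (event_none_le hα1 hv hε0 hε1 hN ht ?_)
  have hL := level_ge hε0 hε1
  have hβ : 0 < 1 - α := by linarith
  have hn1 : (1 : ℝ) ≤ G.size := by exact_mod_cast G.size_pos
  have hn0 : (0 : ℝ) < G.size := by linarith
  have hY : 0 < level ε / ε ^ 2 := by positivity
  set Y := level ε / ε ^ 2 with hY'
  set K := 1152 / (1 - α) with hK
  have hKβ : K * (1 - α) = 1152 := by rw [hK]; field_simp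
  have hK1 : 1152 ≤ K := by rw [hK, le_div_iff₀ hβ]; linarith
  have hKK : ∀ {a : ℝ}, 0 ≤ a → K ^ 2 * a ≤ (N : ℝ) ^ 2 → 288 * a ≤ (1 - α) * N ^ 2 := by
    intro a ha h
    calc 288 * a ≤ 1152 * 1152 * a := by gcongr; norm_num
      _ ≤ K * (1 - α) * K * a := by rw [hKβ]; gcongr
      _ = (1 - α) * (K ^ 2 * a) := by ring
      _ ≤ _ := by gcongr
  rcases hcase with hcase | ⟨hcase, hcube⟩ | hcase
  · exact Or.inl hcase
  · right
    have hN0 : 0 < N := by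
      have : 1 ≤ ⌈level ε⌉₊ := Nat.one_le_ceil_iff.2 (by linarith)
      have : 0 < ⌈level ε⌉₊ ^ 2 := by positivity
      omega
    have hN0' : (0 : ℝ) < N := by exact_mod_cast hN0
    have hlog : 0 ≤ Real.log G.size := Real.log_nonneg hn1
    set q := Real.log G.size + level ε with hq
    have hq0 : 0 < q := by linarith
    -- This U is what sampling guarantees. The log n in q pays for the union bound over the nodes.
    refine ⟨2 + 8 * (G.size / N) * q, by positivity, hcase, ?_, ?_⟩
    · have h2 := hKK (by positivity) hcase
      have h3 : 1152 * (G.size ^ 2 * q * Y) ≤ (1 - α) * N ^ 3 := by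
        rw [← hKβ]
        calc K * (1 - α) * (G.size ^ 2 * q * Y) = (1 - α) * (K * (G.size ^ 2 * q * Y)) := by ring
          _ ≤ _ := by gcongr
      have h4 : 1152 * (G.size ^ 2 * q * Y) / N ≤ (1 - α) * N ^ 2 := by
        rw [div_le_iff₀ hN0']
        linarith
      calc 72 * (G.size * (2 + 8 * (G.size / N) * q) * Y)
          = (288 * (G.size * Y)) / 2 + (1152 * (G.size ^ 2 * q * Y) / N) / 2 := by
            field_simp
            ring
        _ ≤ _ := by linarith
    · refine (event_degree_le hα1 hv hN0 (q := q) (by linarith) ?_ ?_ t).trans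
        (ENNReal.ofReal_le_ofReal ?_)
      · have : 0 ≤ 8 * (G.size / N) * q := by positivity
        linarith
      · linarith
      · rw [hq, neg_add, Real.exp_add, Real.exp_neg (Real.log _), Real.exp_log hn0]
        refine le_trans ?_ (exp_neg_level_le hε0 hε1)
        calc (G.size : ℝ) * (2 * ((G.size : ℝ)⁻¹ * Real.exp (-level ε)))
            = 2 * Real.exp (-level ε) := by field_simp
          _ ≤ _ := by gcongr; norm_num
  · right
    have hγ' : (1 : ℝ) ≤ γ := by exact_mod_cast hγ
    -- With U = γ the event of a violated outdegree condition is empty.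
    refine ⟨γ, Nat.cast_nonneg _, le_trans ?_ hcase, ?_, ?_⟩
    · gcongr
      exact le_mul_of_one_le_right hn0.le hγ'
    · have h2 := hKK (by positivity) hcase
      have : 0 < G.size * γ * Y := by positivity
      linarith
    · refine (MeasureTheory.measure_mono_null (t := ∅) ?_ MeasureTheory.measure_empty).trans_le
        bot_le
      rintro c ⟨h, x, -, h', -, -, w, hw, hlt⟩
      refine absurd hlt (not_lt.2 ?_)
      calc (G.outdegree w : ℝ) ≤ γ := by exact_mod_cast hdeg w hw
        _ ≤ _ := le_mul_of_one_le_right (Nat.cast_nonneg _) (le_max_left _ _)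

end search

end

/-! ### Comparison of the number of rounds with the query bounds. -/

noncomputable section

/-- The dependence on the size of the second query bound. -/
theorem sizeFactor_bounds {n : ℝ} (hn : 2 ≤ n) {y : ℝ}
    (hy : y = n ^ (2 / 3 : ℝ) * Real.log n ^ (1 / 3 : ℝ)) :
    1 ≤ y ∧ n ≤ 4 * y ^ 2 ∧ y ^ 3 = n ^ 2 * Real.log n ∧ 1 / 2 ≤ Real.log n := by
  have hlog : 1 / 2 ≤ Real.log n := by
    have := Real.log_two_gt_d9
    have := Real.log_le_log (by norm_num) hn
    linarith
  have hn0 : 0 ≤ n := by linarith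
  have hy0 : 0 ≤ y := by rw [hy]; positivity
  have hy3 : y ^ 3 = n ^ 2 * Real.log n := by
    rw [hy, mul_pow, ← Real.rpow_mul_natCast hn0, ← Real.rpow_mul_natCast (by linarith)]
    norm_num
  refine ⟨?_, ?_, hy3, hlog⟩
  · by_contra! h
    have h2 : y ^ 3 ≤ 1 := pow_le_one₀ hy0 h.le
    nlinarith
  · by_contra! h
    have h2 : (4 * y ^ 2) ^ 3 < n ^ 3 := by gcongr
    have h3 : (n ^ 2 * (1 / 2)) ^ 2 ≤ (y ^ 3) ^ 2 := by
      rw [hy3]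
      gcongr
    have h4 : 2 * n ^ 3 ≤ n * n ^ 3 := by gcongr
    nlinarith [pow_nonneg hn0 3]

/-- The third query bound without real powers. -/
theorem degreeFactor_bounds {n g : ℝ} (hn : 1 ≤ n) (hg : 1 ≤ g) {z : ℝ}
    (hz : z = n ^ (1 / 2 : ℝ) * g ^ (1 / 2 : ℝ)) : 1 ≤ z ∧ z ^ 2 = n * g := by
  have hn0 : 0 ≤ n := by linarith
  have hg0 : 0 ≤ g := by linarith
  have hz0 : 0 ≤ z := by rw [hz]; positivity
  have hz2 : z ^ 2 = n * g := by
    rw [hz, mul_pow, ← Real.rpow_mul_natCast hn0, ← Real.rpow_mul_natCast hg0]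
    norm_num
  refine ⟨?_, hz2⟩
  nlinarith

/-- Powers of ℓ = log (1 / ε) are dominated by 1 / ε, so the squared confidence level fits into the
common factor of the second and third query bound. -/
theorem sqrt_log_bounds {E ℓ s : ℝ} (hE : E = Real.exp ℓ) (hs0 : 0 < s) (hs : s ^ 2 = ℓ) :
    1 ≤ E ∧ s ≤ E ∧ ℓ ^ 2 ≤ 3 * (E * s) := by
  have hℓ : 0 < ℓ := by rw [← hs]; positivity
  have h2 := Real.quadratic_le_exp_of_nonneg hℓ.le
  rw [← hE] at h2
  have h3 : 1 ≤ E := by nlinarith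
  refine ⟨h3, by nlinarith, ?_⟩
  have h4 : s ^ 3 ≤ 3 * E := by
    have h5 : s ^ 3 ≤ 1 + s ^ 4 := by nlinarith [sq_nonneg (s ^ 2 - s), sq_nonneg (s - 1)]
    have h6 : s ^ 4 = ℓ ^ 2 := by rw [← hs]; ring
    nlinarith
  calc ℓ ^ 2 = s ^ 3 * s := by rw [← hs]; ring
    _ ≤ 3 * E * s := by gcongr
    _ = _ := by ring

/-- A number of rounds of the order of the minimum of the query bounds is a number of rounds in
which the rule is met. -/
theorem rounds_of_min_le {E s s₀ L c β K C p n g lg y z N : ℝ} (hs₀ : 0 < s₀) (hsle : s₀ ≤ s)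
    (hE1 : 1 ≤ E) (hsE : s ≤ E) (hβ : 0 < β) (hK : 0 < K) (hc : 1 ≤ c) (hp0 : 0 < p) (hp1 : p ≤ 1)
    (hL0 : 0 < L) (hLc : L ≤ c * s ^ 2) (hLsq : 16 * (L + 1) ^ 2 ≤ 48 * c ^ 2 * (E * s))
    (hn : 0 ≤ n) (hg : 0 ≤ g)
    (hy1 : 1 ≤ y) (hy2 : n ≤ 4 * y ^ 2) (hy3 : y ^ 3 = n ^ 2 * lg) (hlg : 1 / 2 ≤ lg)
    (hz1 : 1 ≤ z) (hz2 : z ^ 2 = n * g)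
    (h1 : 48 * c ^ 2 ≤ C) (h2 : 48 * c ^ 2 ≤ C * s₀) (h3 : 36 * c ≤ C * β) (h4 : 2 * K * c ≤ C)
    (h5 : K * c * (1 / s₀ + 2 * c) ≤ C)
    (hN : C * min ((E * s) ^ 2 / p) (min (E * s * y) (E * s * z)) ≤ N) :
    16 * (L + 1) ^ 2 ≤ C * min ((E * s) ^ 2 / p) (min (E * s * y) (E * s * z)) ∧
      (36 * (L * E ^ 2) ≤ p * (N * β) ∨
      (K ^ 2 * (n * (L * E ^ 2)) ≤ N ^ 2 ∧ K * (n ^ 2 * (lg + L) * (L * E ^ 2)) ≤ N ^ 3) ∨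
      K ^ 2 * (n * g * (L * E ^ 2)) ≤ N ^ 2) := by
  have hs0 : 0 < s := hs₀.trans_le hsle
  have hE0 : 0 < E := by linarith
  have hc0 : 0 < c := by linarith
  have hC1 : 1 ≤ C := by nlinarith
  have hC0 : 0 < C := by linarith
  obtain ⟨r, hr⟩ : ∃ r, r = E * s := ⟨_, rfl⟩
  have hr0 : 0 < r := by rw [hr]; positivity
  have hsr : s ≤ r := by rw [hr]; exact le_mul_of_one_le_left hs0.le hE1
  have hLr : L * E ^ 2 ≤ c * r ^ 2 := by
    calc L * E ^ 2 ≤ c * s ^ 2 * E ^ 2 := by gcongr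
      _ = _ := by rw [hr]; ring
  rw [← hr] at hN hLsq ⊢
  constructor
  · refine hLsq.trans ?_
    rcases min_choice (r ^ 2 / p) (min (r * y) (r * z)) with h | h <;> rw [h]
    · have hp : r * r ≤ r ^ 2 / p := by
        rw [le_div_iff₀ hp0, ← sq]
        exact mul_le_of_le_one_right (by positivity) hp1
      calc 48 * c ^ 2 * r ≤ C * s₀ * r := by gcongr
        _ = C * (s₀ * r) := by ring
        _ ≤ C * (r * r) := by gcongr; linarith
        _ ≤ C * (r ^ 2 / p) := by gcongr
    · calc 48 * c ^ 2 * r ≤ C * r := by gcongr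
        _ ≤ C * min (r * y) (r * z) := by
          refine mul_le_mul_of_nonneg_left (le_min ?_ ?_) hC0.le
          · exact le_mul_of_one_le_right hr0.le hy1
          · exact le_mul_of_one_le_right hr0.le hz1
  have hKc : ∀ {a b : ℝ}, 0 ≤ a → C * (r * b) ≤ N → 0 ≤ b → a ≤ 4 * b ^ 2 →
      K ^ 2 * (a * (L * E ^ 2)) ≤ N ^ 2 := by
    intro a b ha hb hb0 hab
    calc K ^ 2 * (a * (L * E ^ 2)) ≤ K ^ 2 * ((4 * b ^ 2) * (c * r ^ 2)) := by gcongr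
      _ = 4 * K ^ 2 * (1 * c) * (r * b) ^ 2 := by ring
      _ ≤ 4 * K ^ 2 * (c * c) * (r * b) ^ 2 := by gcongr
      _ = (2 * K * c * (r * b)) ^ 2 := by ring
      _ ≤ (C * (r * b)) ^ 2 := by gcongr
      _ ≤ N ^ 2 := by gcongr
  rcases min_choice (r ^ 2 / p) (min (r * y) (r * z)) with h | h <;> rw [h] at hN
  · left
    calc 36 * (L * E ^ 2) ≤ 36 * (c * r ^ 2) := by gcongr
      _ = 36 * c * r ^ 2 := by ring
      _ ≤ C * β * r ^ 2 := by gcongr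
      _ = p * (C * (r ^ 2 / p) * β) := by field_simp
      _ ≤ p * (N * β) := by gcongr
  · rcases min_choice (r * y) (r * z) with h | h <;> rw [h] at hN
    · right; left
      refine ⟨hKc hn hN (by linarith) hy2, ?_⟩
      -- The cube of the second bound has r ^ 3 where L * E ^ 2 uses only r ^ 2; the spare r absorbs
      -- the level L in lg + L.
      have hq : lg + L ≤ lg * ((1 / s₀ + 2 * c) * r) := by
        have h6 : 1 ≤ 1 / s₀ * r := by
          rw [one_div_mul_eq_div, one_le_div hs₀]
          linarith
        have h7 : L ≤ c * r := by
          refine hLc.trans ?_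
          rw [sq, hr]
          gcongr
        have h8 : lg * 1 ≤ lg * (1 / s₀ * r) := by gcongr
        have h9 : 1 / 2 * (2 * (c * r)) ≤ lg * (2 * (c * r)) := by gcongr
        calc lg + L ≤ lg * (1 / s₀ * r) + lg * (2 * (c * r)) := by linarith
          _ = _ := by ring
      calc K * (n ^ 2 * (lg + L) * (L * E ^ 2))
          ≤ K * (n ^ 2 * (lg * ((1 / s₀ + 2 * c) * r)) * (c * r ^ 2)) := by gcongr
        _ = K * c * (1 / s₀ + 2 * c) * ((n ^ 2 * lg) * r ^ 3) := by ring
        _ = K * c * (1 / s₀ + 2 * c) * (r * y) ^ 3 := by rw [← hy3]; ring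
        _ ≤ C * (r * y) ^ 3 := by gcongr
        _ ≤ C ^ 3 * (r * y) ^ 3 := by gcongr; exact le_self_pow₀ hC1 (by norm_num)
        _ = (C * (r * y)) ^ 3 := by ring
        _ ≤ N ^ 3 := by gcongr
    · right; right
      refine hKc (by positivity) hN (by linarith) ?_
      rw [hz2]
      have : 0 ≤ n * g := by positivity
      linarith

/-- The numbers of rounds in which the rule is met are bounded by the query bounds. -/
theorem exists_rounds_le_queryBound {β ε₀ : ℝ} (hβ0 : 0 < β) (hε₀ : ε₀ < 1) :
    ∃ C : ℝ, 0 < C ∧ ∀ ε : ℝ, 0 < ε → ε ≤ ε₀ → ∀ (p : ℝ) (n γ N : ℕ), 0 < p → p ≤ 1 → 2 ≤ n →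
      1 ≤ γ → C * queryBound ε p n γ ≤ N →
        16 * (level ε + 1) ^ 2 ≤ C * queryBound ε p n γ ∧
        (36 * (level ε / ε ^ 2) ≤ p * (N * β) ∨
        ((1152 / β) ^ 2 * (n * (level ε / ε ^ 2)) ≤ (N : ℝ) ^ 2 ∧
          1152 / β * (n ^ 2 * (Real.log n + level ε) * (level ε / ε ^ 2)) ≤ (N : ℝ) ^ 3) ∨
        (1152 / β) ^ 2 * (n * γ * (level ε / ε ^ 2)) ≤ (N : ℝ) ^ 2) := by
  rcases le_or_gt ε₀ 0 with h | hε₀0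
  · exact ⟨1, one_pos, fun ε h0 h1 => absurd (h0.trans_le h1) (not_lt.2 h)⟩
  obtain ⟨ℓ₀, hℓ₀⟩ : ∃ ℓ₀, ℓ₀ = Real.log (1 / ε₀) := ⟨_, rfl⟩
  have hℓ₀0 : 0 < ℓ₀ := by
    rw [hℓ₀]
    exact Real.log_pos (by rwa [lt_div_iff₀ hε₀0, one_mul])
  have hs₀0 : 0 < Real.sqrt ℓ₀ := Real.sqrt_pos.2 hℓ₀0
  obtain ⟨K, hK⟩ : ∃ K, K = 1152 / β := ⟨_, rfl⟩
  have hK0 : 0 < K := by rw [hK]; positivity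
  -- As ε ≤ ε₀ < 1, log (1 / ε) is at least ℓ₀ > 0, so the additive constant of the level, plus 1
  -- for rounding up, becomes a multiple of it.
  obtain ⟨c, hc⟩ : ∃ c, c = 2 + 13 / ℓ₀ := ⟨_, rfl⟩
  have hc1 : 1 ≤ c := by
    have : 0 < 13 / ℓ₀ := by positivity
    linarith
  rw [← hK]
  refine ⟨48 * c ^ 2 + 48 * c ^ 2 / Real.sqrt ℓ₀ + 36 * c / β + 2 * K * c
    + K * c * (1 / Real.sqrt ℓ₀ + 2 * c), by positivity, fun ε hε0 hε p n γ N hp0 hp1 hn hγ => ?_⟩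
  have hn' : (2 : ℝ) ≤ n := by exact_mod_cast hn
  have hγ' : (1 : ℝ) ≤ γ := by exact_mod_cast hγ
  have hℓle : ℓ₀ ≤ Real.log (1 / ε) := by
    rw [hℓ₀]
    exact Real.log_le_log (by positivity) (by gcongr)
  have hℓ0 : 0 < Real.log (1 / ε) := hℓ₀0.trans_le hℓle
  have hs0 : 0 < Real.sqrt (Real.log (1 / ε)) := Real.sqrt_pos.2 hℓ0
  obtain ⟨hE1, hsE, hℓE⟩ := sqrt_log_bounds (Real.exp_log (show 0 < 1 / ε by positivity)).symm hs0
    (Real.sq_sqrt hℓ0.le)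
  obtain ⟨hy1, hy2, hy3, hlog⟩ := sizeFactor_bounds hn' rfl
  obtain ⟨hz1, hz2⟩ := degreeFactor_bounds (show (1 : ℝ) ≤ n by linarith) hγ' rfl
  have hLc : level ε + 1 ≤ c * Real.log (1 / ε) := by
    have : 13 ≤ 13 / ℓ₀ * Real.log (1 / ε) := by
      rw [div_mul_eq_mul_div, le_div_iff₀ hℓ₀0]
      nlinarith
    rw [level, hc]
    linarith
  have hL0 : 0 < level ε := by rw [level]; linarith
  have hdiv : ∀ a : ℝ, a / ε ^ 2 = a * (1 / ε) ^ 2 := fun a => by field_simp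
  have hb : 1 / ε ^ 2 * Real.log (1 / ε) * (1 / p)
      = (1 / ε * Real.sqrt (Real.log (1 / ε))) ^ 2 / p := by
    rw [mul_pow, Real.sq_sqrt hℓ0.le]
    field_simp
  rw [queryBound, hb]
  simp only [hdiv]
  refine rounds_of_min_le hs₀0 (Real.sqrt_le_sqrt hℓle) hE1 hsE hβ0 hK0 hc1 hp0 hp1 hL0 ?_ ?_
    (by linarith) (by linarith) hy1 hy2 hy3 hlog hz1 hz2 ?_ ?_ ?_ ?_ ?_
  · rw [Real.sq_sqrt hℓ0.le]
    linarith
  · calc 16 * (level ε + 1) ^ 2 ≤ 16 * (c * Real.log (1 / ε)) ^ 2 := by gcongr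
      _ = 16 * c ^ 2 * Real.log (1 / ε) ^ 2 := by ring
      _ ≤ 16 * c ^ 2 * (3 * (1 / ε * Real.sqrt (Real.log (1 / ε)))) := by gcongr
      _ = _ := by ring
  all_goals
    have h1 : 0 < 48 * c ^ 2 := by positivity
    have h2 : 0 < 48 * c ^ 2 / Real.sqrt ℓ₀ := by positivity
    have h3 : 0 < 36 * c / β := by positivity
    have h4 : 0 < 2 * K * c := by positivity
    have h5 : 0 < K * c * (1 / Real.sqrt ℓ₀ + 2 * c) := by positivity
  · linarith
  · rw [← div_le_iff₀ hs₀0]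
    linarith
  · rw [← div_le_iff₀ hβ0]
    linarith
  · linarith
  · linarith

theorem mainTheorem1 (α : ℝ) (hα0 : 0 < α) (hα1 : α < 1) (ε₀ : ℝ) (hε₀ : ε₀ < 1) :
    ∃ C : ℝ, 0 < C ∧ ∀ ε : ℝ, 0 < ε → ε ≤ ε₀ →
      ∃ A : QueryAlgorithm, ∀ (G : IdGraph) (n γ : ℕ), G.size = n → 2 ≤ n → 1 ≤ γ →
        (∀ u ∈ G.nodes, G.outdegree u ≤ γ) →
        ∀ v : G.nodes,
          ENNReal.ofReal (1 - ε) ≤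
            A.outputProb G v ⌊C * queryBound ε (G.pageRank α v) n γ⌋₊
              (Set.Icc ((1 - ε) * G.pageRank α v) ((1 + ε) * G.pageRank α v)) := by
  obtain ⟨C, hC0, hC⟩ := exists_rounds_le_queryBound (β := 1 - α) (by linarith) hε₀
  set a : ℝ := -Real.log ((1 + α) / 2) with ha
  have ha0 : 0 < a := by
    rw [ha, neg_pos]
    exact Real.log_neg (by linarith) (by linarith)
  refine ⟨2 * (7 + 15 / a) * C, by positivity, fun ε hε0 hε =>
    ⟨search α hα0.le hα1.le (search.ruleOf α ε), ?_⟩⟩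
  rintro G _ γ rfl hn hγ hdeg ⟨v, hv⟩
  have hε1 : ε ≤ 1 := by linarith
  rw [← G.rank_coe α ⟨v, hv⟩]
  set x := C * queryBound ε (G.rank α v) G.size γ with hx
  obtain ⟨hN, hcase⟩ := hC ε hε0 hε (G.rank α v) G.size γ ⌈x⌉₊ (G.rank_pos hα0.le hα1 hv)
    (G.rank_le_one hα0.le hα1 hv) hn hγ (Nat.le_ceil x)
  set N := ⌈x⌉₊ with hNdef
  have hL := level_ge hε0 hε1
  have hx1 : 1 ≤ x := by nlinarith
  have hNx : (N : ℝ) ≤ x + 1 := (Nat.ceil_lt_add_one (by linarith)).le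
  have hxN : x ≤ N := Nat.le_ceil x
  have hN' : 16 * ⌈level ε⌉₊ ^ 2 ≤ N := by
    have h2 : (16 : ℝ) * (⌈level ε⌉₊ : ℝ) ^ 2 ≤ N := by
      refine le_trans ?_ (hN.trans hxN)
      gcongr
      exact (Nat.ceil_lt_add_one (by linarith)).le
    exact_mod_cast h2
  -- Two of the three N compensate 2 ^ (2 * N); the third leaves exp (-N), below the permitted
  -- failure probability.
  set t := ⌈3 * N / a⌉₊ with ht
  have hta : 3 * N ≤ a * t := by
    have h2 := Nat.le_ceil (3 * N / a)
    rw [div_le_iff₀ ha0] at h2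
    linarith
  have hρ : ((1 + α) / 2) ^ t * 2 ^ (2 * N) ≤ ε / 8 := by
    have h2 : ((1 + α) / 2) ^ t = Real.exp (-(a * t)) := by
      rw [ha, neg_mul, neg_neg, mul_comm, Real.exp_nat_mul, Real.exp_log (by linarith)]
    have h3 := two_pow_le_exp (2 * N)
    push_cast at h3
    have h4 : level ε ≤ N := by nlinarith
    calc ((1 + α) / 2) ^ t * 2 ^ (2 * N) ≤ Real.exp (-(a * t)) * Real.exp (2 * N) := by
          rw [h2]
          gcongr
      _ = Real.exp (2 * N - a * t) := by
          rw [← Real.exp_add]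
          ring_nf
      _ ≤ Real.exp (-level ε) := by
          gcongr
          linarith
      _ ≤ 8 * Real.exp (-level ε) := by linarith [Real.exp_pos (-level ε)]
      _ ≤ ε / 8 := exp_neg_level_le hε0 hε1
  refine (search.le_outputProb_of_rounds (h0 := hα0.le) (h1 := hα1.le) hα1 hv hε0 hε1 hN' hρ hγ
    hdeg hcase).trans (QueryAlgorithm.outputProb_mono _ G v _ ?_)
  refine Nat.le_floor ?_
  have h2 : (t : ℝ) ≤ 3 * N / a + 1 := (Nat.ceil_lt_add_one (by positivity)).le
  have hN1 : (1 : ℝ) ≤ N := by linarith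
  push_cast
  calc (2 : ℝ) + 5 * t ≤ 7 * 1 + 15 / a * N := by
        have : 15 / a * N = 5 * (3 * N / a) := by ring
        linarith
    _ ≤ 7 * N + 15 / a * N := by gcongr
    _ = (7 + 15 / a) * N := by ring
    _ ≤ (7 + 15 / a) * (2 * x) := by gcongr; linarith
    _ = _ := by rw [hx]; ring

end
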